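/- Let $(M,\Omega,\theta)$ be a locally conformal symplectic (LCS) manifold: $M$ is a (finite-dimensional, Hausdorff) smooth manifold, $\Omega$ a non-degenerate smooth 2-form, $\theta$ a closed smooth 1-form, $d\Omega=\theta\wedge\Omega$. For $f\in C^\infty(M)$ put $d^\theta f=df-f\theta$, let $X_f$ be the Hamiltonian vector field of $f$, i.e. $X_f\lrcorner\Omega=d^\theta f$, and let $\{f,g\}=\Omega(X_f,X_g)$. By the flow of a vector field $X$ we mean its maximal smooth (possibly local) one-parameter group $\{\Psi_s\}$, $\Psi_s:D_s\to D_{-s}$, with infinitesimal generator $X$, where $D_s$ is the open set of the points whose integral curve is defined at time $s$ (if $X$ is complete, then $D_s$ is the whole space for every $s$). (1) Time-independent case. Let $H,f\in C^\infty(M)$, where $f$ is a dissipated quantity of $(M,\Omega,\theta,H)$, i.e. $\{H,f\}=0$, and suppose $\theta(X_f)=0$. Then $X_f$ generates a (possibly local) one-parameter group of canonical transformations that leave $H$ invariant: its flow exists, and each $\Psi_s:D_s\to D_{-s}$ is a diffeomorphism with $\Psi_s^*\Omega=\Omega$ and $H\circ\Psi_s=H$ on $D_s$. (2) Time-dependent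 case. On $\mathbb R\times M$ let $\hat\Omega,\hat\theta$ be the pullbacks of $\Omega,\theta$ along the projection to $M$. For $f\in C^\infty(\mathbb R\times M)$ let $d^{\hat\theta}f=df-f\hat\theta$ and let $X_f$ be the vector field with $X_f\lrcorner dt=0$ and $X_f\lrcorner\hat\Omega=d^{\hat\theta}f-\frac{\partial f}{\partial t}dt$ (so that $X_f$ at time $t$ is the Hamiltonian vector field of $f(t,\cdot)$ on $M$). Put $\{f,g\}=\hat\Omega(X_f,X_g)$ and $\tilde X_H=X_H+\partial/\partial t$. Let $H,f\in C^\infty(\mathbb R\times M)$, where $f$ is a dissipated quantity, i.e. $\{f,H\}+\frac{\partial f}{\partial t}=0$. Then $L_{X_f}\tilde X_H=[X_f,\tilde X_H]=0$. If moreover $\hat\theta(X_f)=0$, then $X_f$ generates a (possibly local) one-parameter group of canonical invariance transformations: its flow exists, and for each $s$ the map $\Psi_s:D_s\to D_{-s}$ is a diffeomorphism with $\Psi_s^*t=t$ and $\Psi_s^*\hat\theta=\hat\theta$, for which there is $K_s\in C^\infty(D_s)$ such that $$\Psi_s^*\hat\Omega=\hat\Omega+d^{\hat\theta}K_s\wedge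 dt\qquad\text{and}\qquad H\circ\Psi_s+K_s=H\quad\text{on }D_s,$$ that is, $\Psi_s$ is a canonical transformation and the Hamiltonian $H\circ\Psi_s+K_s$ into which it transforms $H$ is $H$ itself. Furthermore $H\circ\Psi_s=H$ on $D_s$ for all $s$ if and only if $\partial f/\partial t=0$. (3) In neither case need $f$ be a constant of motion: on $\mathbb R^4$ there are an LCS structure and smooth functions $H,f$ on $\mathbb R^4$ (respectively on $\mathbb R\times\mathbb R^4$) such that $f$ is a dissipated quantity, $\theta(X_f)=0$ (respectively $\hat\theta(X_f)=0$) and $X_f\neq0$, but $f$ is not a constant of motion, i.e. $\{f,H\}+f\,\theta(X_H)$ (respectively $\{f,H\}+f\,\hat\theta(X_H)+\frac{\partial f}{\partial t}$) does not vanish identically. -/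

import Mathlib

open Set Function
open scoped Manifold ContDiff

noncomputable section

/-! ### Differential forms on manifolds -/

/-- A (not necessarily smooth) differential `k`-form on the manifold `N`. -/
abbrev DForm {F : Type*} [NormedAddCommGroup F] [NormedSpace ℝ F]
    {H : Type*} [TopologicalSpace H] (I : ModelWithCorners ℝ F H)
    (N : Type*) [TopologicalSpace N] [ChartedSpace H N] (k : ℕ) :=
  (x : N) → TangentSpace I x [⋀^Fin k]→L[ℝ] ℝ

/-- `α ∧ η` for a linear form `α` and an alternating `k`-form `η` on a vector space:
`(α ∧ η)(v₀, …, v_k) = ∑ᵢ (-1)^i α(vᵢ) η(v₀, …, v̂ᵢ, …, v_k)`. -/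
def linWedge {F : Type*} [NormedAddCommGroup F] [NormedSpace ℝ F] {k : ℕ}
    (α : F [⋀^Fin 1]→L[ℝ] ℝ) (η : F [⋀^Fin k]→L[ℝ] ℝ) : F [⋀^Fin (k + 1)]→L[ℝ] ℝ :=
  ContinuousAlternatingMap.alternatizeUncurryFin
    (((ContinuousAlternatingMap.ofSubsingleton ℝ F ℝ (0 : Fin 1)).symm α).smulRight η)

section Forms

variable {F : Type*} [NormedAddCommGroup F] [NormedSpace ℝ F]
  {H : Type*} [TopologicalSpace H] {I : ModelWithCorners ℝ F H}
  {N : Type*} [TopologicalSpace N] [ChartedSpace H N]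
  {F' : Type*} [NormedAddCommGroup F'] [NormedSpace ℝ F']
  {H' : Type*} [TopologicalSpace H'] {I' : ModelWithCorners ℝ F' H'}
  {N' : Type*} [TopologicalSpace N'] [ChartedSpace H' N']

/-- The wedge product `α ∧ η` of a 1-form with a `k`-form. -/
def DForm.wedge {k : ℕ} (α : DForm I N 1) (η : DForm I N k) : DForm I N (k + 1) :=
  fun x => linWedge (F := F) (α x) (η x)

/-- The differential `df` of a function, as a 1-form. -/
def dFun (I : ModelWithCorners ℝ F H) (f : N → ℝ) : DForm I N 1 :=
  fun x => ContinuousAlternatingMap.ofSubsingleton ℝ (TangentSpace I x) ℝ (0 : Fin 1)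
    (mfderiv I 𝓘(ℝ, ℝ) f x)

/-- The Lichnerowicz–de Rham differential of a function, `d^θ f = df - f θ`. -/
def dTheta (θ : DForm I N 1) (f : N → ℝ) : DForm I N 1 :=
  fun x => dFun I f x - f x • θ x

/-- The pullback `Φ^* η`. -/
def DForm.pullback {k : ℕ} (I : ModelWithCorners ℝ F H) (Φ : N → N') (η : DForm I' N' k) :
    DForm I N k :=
  fun x => (η (Φ x)).compContinuousLinearMap (mfderiv I I' Φ x)

/-- `Φ` is a smooth diffeomorphism from the open set `U` onto the open set `V`. -/
def IsDiffeoOn (I : ModelWithCorners ℝ F H) (U V : Set N) (Φ : N → N) : Prop :=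
  IsOpen U ∧ IsOpen V ∧ MapsTo Φ U V ∧ ContMDiffOn I I ∞ Φ U ∧
    ∃ G : N → N, MapsTo G V U ∧ ContMDiffOn I I ∞ G V ∧ LeftInvOn G Φ U ∧ RightInvOn G Φ V

/-- `Ψ`, with domain `D ⊆ ℝ × N`, is the flow of the vector field `X`: a smooth (possibly local)
one-parameter group of transformations with infinitesimal generator `X`, defined on the largest
possible domain. If `X` is complete then `D` is everything. -/
structure IsFlow (I : ModelWithCorners ℝ F H) (X : (x : N) → TangentSpace I x)
    (D : Set (ℝ × N)) (Ψ : ℝ → N → N) : Prop where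
  isOpen : IsOpen D
  zero_mem : ∀ p, (0, p) ∈ D
  ordConnected : ∀ p, OrdConnected {s : ℝ | (s, p) ∈ D}
  smooth : ContMDiffOn (𝓘(ℝ, ℝ).prod I) I ∞ (fun q : ℝ × N => Ψ q.1 q.2) D
  map_zero : ∀ p, Ψ 0 p = p
  mem_add_iff : ∀ s r p, (r, p) ∈ D → ((s, Ψ r p) ∈ D ↔ (s + r, p) ∈ D)
  map_add : ∀ s r p, (r, p) ∈ D → (s + r, p) ∈ D → Ψ (s + r) p = Ψ s (Ψ r p)
  generator : ∀ p, IsMIntegralCurveOn (fun s => Ψ s p) X {s : ℝ | (s, p) ∈ D}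
  maximal : ∀ (p : N) (γ : ℝ → N) (J : Set ℝ), IsOpen J → OrdConnected J → 0 ∈ J → γ 0 = p →
    IsMIntegralCurveOn γ X J → ∀ s ∈ J, (s, p) ∈ D

end Forms

section LCS

variable {E : Type*} [NormedAddCommGroup E] [NormedSpace ℝ E]
  {M : Type*} [TopologicalSpace M] [ChartedSpace E M]

/-- The expression of a form in the chart around `x₀`: its pullback by the inverse chart. -/
def DForm.inChart {k : ℕ} (η : DForm 𝓘(ℝ, E) M k) (x₀ : M) : E → E [⋀^Fin k]→L[ℝ] ℝ :=
  DForm.pullback 𝓘(ℝ, E) (extChartAt 𝓘(ℝ, E) x₀).symm η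

/-- Smoothness of a form: its coefficients are smooth in every chart of the defining family. -/
def DForm.IsSmooth {k : ℕ} (η : DForm 𝓘(ℝ, E) M k) : Prop :=
  ∀ x₀ : M, ContDiffOn ℝ ∞ (η.inChart x₀) (extChartAt 𝓘(ℝ, E) x₀).target

/-- The exterior derivative, computed at `x` in the chart around `x`. -/
def DForm.d {k : ℕ} (η : DForm 𝓘(ℝ, E) M k) : DForm 𝓘(ℝ, E) M (k + 1) :=
  fun x => (extDeriv (η.inChart x) (extChartAt 𝓘(ℝ, E) x x)).compContinuousLinearMap
    (mfderiv 𝓘(ℝ, E) 𝓘(ℝ, E) (extChartAt 𝓘(ℝ, E) x) x)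

variable (E M) in
/-- A locally conformal symplectic structure `(Ω, θ)` on `M`. -/
structure LCSStructure where
  Ω : DForm 𝓘(ℝ, E) M 2
  θ : DForm 𝓘(ℝ, E) M 1
  smooth_Ω : Ω.IsSmooth
  smooth_θ : θ.IsSmooth
  nondegenerate : ∀ (x : M) (v : TangentSpace 𝓘(ℝ, E) x), (∀ w, Ω x ![v, w] = 0) → v = 0
  closed_θ : ∀ x, θ.d x = 0
  d_Ω : ∀ x, Ω.d x = θ.wedge Ω x

namespace LCSStructure

variable (S : LCSStructure E M)

/-- The musical map `v ↦ v ⌟ Ω` at a point. -/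
def flat (x : M) : TangentSpace 𝓘(ℝ, E) x →L[ℝ] TangentSpace 𝓘(ℝ, E) x [⋀^Fin 1]→L[ℝ] ℝ :=
  ContinuousAlternatingMap.curryLeft (E := E) (S.Ω x)

/-- The Hamiltonian vector field `X_f`, the solution of `X_f ⌟ Ω = d^θ f`. -/
def hamVF (f : M → ℝ) (x : M) : TangentSpace 𝓘(ℝ, E) x :=
  ContinuousLinearMap.inverse (S.flat x) (dTheta S.θ f x)

theorem flat_apply (x : M) (v w : TangentSpace 𝓘(ℝ, E) x) :
    S.flat x v ![w] = S.Ω x ![v, w] := rfl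

/-- The musical map is an isomorphism. -/
theorem isInvertible_flat [FiniteDimensional ℝ E] (x : M) : (S.flat x).IsInvertible := by
  let e : (E →L[ℝ] ℝ) ≃ₗ[ℝ] E [⋀^Fin 1]→L[ℝ] ℝ :=
    (ContinuousAlternatingMap.ofSubsingletonLIE (𝕜 := ℝ) (E := E) (F := ℝ) (0 : Fin 1)).toLinearEquiv
  let L : E →L[ℝ] E [⋀^Fin 1]→L[ℝ] ℝ := S.flat x
  have hinj : Injective L := by
    rw [injective_iff_map_eq_zero]
    intro v hv
    refine S.nondegenerate x v fun w => ?_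
    have := congrArg (fun a : E [⋀^Fin 1]→L[ℝ] ℝ => a ![w]) hv
    exact this
  have : FiniteDimensional ℝ (E [⋀^Fin 1]→L[ℝ] ℝ) := e.finiteDimensional
  have hdim : Module.finrank ℝ E = Module.finrank ℝ (E [⋀^Fin 1]→L[ℝ] ℝ) := by
    rw [← e.finrank_eq, ← (LinearMap.toContinuousLinearMap (𝕜 := ℝ) (E := E) (F' := ℝ)).finrank_eq]
    exact Subspace.dual_finrank_eq.symm
  exact ⟨(LinearMap.linearEquivOfInjective L.toLinearMap hinj hdim).toContinuousLinearEquiv, by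
    ext v; rfl⟩

/-- The defining equation `X_f ⌟ Ω = d^θ f` holds. -/
theorem flat_hamVF [FiniteDimensional ℝ E] (f : M → ℝ) (x : M) :
    S.flat x (S.hamVF f x) = dTheta S.θ f x := by
  obtain ⟨e, he⟩ := S.isInvertible_flat x
  rw [hamVF, ← he, ContinuousLinearMap.inverse_equiv]
  exact e.apply_symm_apply _

/-- The Jacobi bracket `{f, g} = Ω(X_f, X_g)`. -/
def bracket (f g : M → ℝ) (x : M) : ℝ := S.Ω x ![S.hamVF f x, S.hamVF g x]

/-- `f` is a dissipated quantity of `(M, Ω, θ, H)`. -/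
def IsDissipated (H f : M → ℝ) : Prop := ∀ x, S.bracket H f x = 0

/-- `f` is a constant of motion of `(M, Ω, θ, H)`. -/
def IsConstantOfMotion (H f : M → ℝ) : Prop :=
  ∀ x, S.bracket f H x + f x * S.θ x ![S.hamVF H x] = 0

/-- `Φ : U → V` is a (local) canonical transformation: a diffeomorphism with `Φ^* Ω = Ω`. -/
def IsCanonical (U V : Set M) (Φ : M → M) : Prop :=
  IsDiffeoOn 𝓘(ℝ, E) U V Φ ∧ ∀ x ∈ U, DForm.pullback 𝓘(ℝ, E) Φ S.Ω x = S.Ω x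

/-- `Φ : U → V` is a canonical transformation that leaves `H` invariant. -/
def IsCanonicalInvariance (H : M → ℝ) (U V : Set M) (Φ : M → M) : Prop :=
  S.IsCanonical U V Φ ∧ ∀ x ∈ U, H (Φ x) = H x

end LCSStructure

/-! ### The extended phase space `ℝ × M` -/

variable (E) in
/-- The model of the extended phase space `ℝ × M`. -/
abbrev extModel := 𝓘(ℝ, ℝ).prod 𝓘(ℝ, E)

/-- The partial derivative `∂f/∂t`. -/
def timeDeriv (f : ℝ × M → ℝ) (p : ℝ × M) : ℝ := deriv (fun t => f (t, p.2)) p.1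

namespace LCSStructure

variable (S : LCSStructure E M)

/-- `Ω̂ = pr^* Ω`. -/
def extΩ : DForm (extModel E) (ℝ × M) 2 := DForm.pullback (extModel E) Prod.snd S.Ω

/-- `θ̂ = pr^* θ`. -/
def extθ : DForm (extModel E) (ℝ × M) 1 := DForm.pullback (extModel E) Prod.snd S.θ

/-- The Hamiltonian vector field `X_f` on `ℝ × M` of a time-dependent function `f`: it has no
component along `∂/∂t`, and its component along `M` at time `t` is `X_{f_t}`, `f_t = f(t, ·)`. -/
def extHamVF (f : ℝ × M → ℝ) (p : ℝ × M) : TangentSpace (extModel E) p :=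
  ((0 : ℝ), (S.hamVF (fun m => f (p.1, m)) p.2 : E))

theorem extΩ_apply (p : ℝ × M) (u v : TangentSpace (extModel E) p) :
    S.extΩ p ![u, v] = S.Ω p.2 ![u.2, v.2] := by
  have h : mfderiv (extModel E) 𝓘(ℝ, E) (Prod.snd : ℝ × M → M) p =
    ContinuousLinearMap.snd ℝ ℝ E := mfderiv_snd
  change S.Ω p.2 (mfderiv (extModel E) 𝓘(ℝ, E) (Prod.snd : ℝ × M → M) p ∘ ![u, v]) = _
  rw [h]
  congr 1
  ext i
  fin_cases i <;> rfl

theorem extθ_apply (p : ℝ × M) (u : TangentSpace (extModel E) p) :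
    S.extθ p ![u] = S.θ p.2 ![u.2] := by
  have h : mfderiv (extModel E) 𝓘(ℝ, E) (Prod.snd : ℝ × M → M) p =
    ContinuousLinearMap.snd ℝ ℝ E := mfderiv_snd
  change S.θ p.2 (mfderiv (extModel E) 𝓘(ℝ, E) (Prod.snd : ℝ × M → M) p ∘ ![u]) = _
  rw [h]
  congr 1
  ext i
  fin_cases i
  rfl

/-- `X_f` is characterized by `X_f ⌟ dt = 0` and `X_f ⌟ Ω̂ = d^θ̂ f - (∂f/∂t) dt`. -/
theorem extHamVF_spec [FiniteDimensional ℝ E] {f : ℝ × M → ℝ}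
    (hf : ContMDiff (extModel E) 𝓘(ℝ, ℝ) ∞ f) (p : ℝ × M) (v : TangentSpace (extModel E) p) :
    dFun (extModel E) Prod.fst p ![S.extHamVF f p] = 0 ∧
    S.extΩ p ![S.extHamVF f p, v] = dTheta S.extθ f p ![v] -
      timeDeriv f p * dFun (extModel E) Prod.fst p ![v] := by
  have h1 : mfderiv (extModel E) 𝓘(ℝ, ℝ) (Prod.fst : ℝ × M → ℝ) p =
    ContinuousLinearMap.fst ℝ ℝ E := mfderiv_fst
  have hfst : ∀ u : TangentSpace (extModel E) p,
      dFun (extModel E) Prod.fst p ![u] = (u.1 : ℝ) := fun u => by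
    change mfderiv (extModel E) 𝓘(ℝ, ℝ) (Prod.fst : ℝ × M → ℝ) p u = _
    rw [h1]; rfl
  refine ⟨hfst _, ?_⟩
  have h2 : dFun (extModel E) f p ![v] = timeDeriv f p * (v.1 : ℝ) +
      dFun 𝓘(ℝ, E) (fun m => f (p.1, m)) p.2 ![v.2] := by
    have := mfderiv_prod_eq_add_apply (v := v) ((hf p).mdifferentiableAt (by simp))
    refine this.trans (congrArg₂ (fun a b : ℝ => a + b) ?_ rfl)
    rw [mfderiv_eq_fderiv]
    change fderiv ℝ (fun z => f (z, p.2)) p.1 v.1 = _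
    rw [timeDeriv, fderiv_eq_smul_deriv, smul_eq_mul, mul_comm]
  have h3 := congrArg (fun a : E [⋀^Fin 1]→L[ℝ] ℝ => a ![v.2])
    (S.flat_hamVF (fun m => f (p.1, m)) p.2)
  rw [extΩ_apply, hfst]
  refine (h3 : S.Ω p.2 ![S.hamVF (fun m => f (p.1, m)) p.2, v.2] = _).trans ?_
  change dFun 𝓘(ℝ, E) (fun m => f (p.1, m)) p.2 ![v.2] - f p * S.θ p.2 ![v.2] =
    dFun (extModel E) f p ![v] - f p * S.extθ p ![v] - timeDeriv f p * (v.1 : ℝ)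
  rw [h2, extθ_apply]
  ring

/-- The autonomization `X̃_H = ∂/∂t + X_H`. -/
def autonomization (H : ℝ × M → ℝ) (p : ℝ × M) : TangentSpace (extModel E) p :=
  ((1 : ℝ), (S.hamVF (fun m => H (p.1, m)) p.2 : E))

/-- The Jacobi bracket `{f, g} = Ω̂(X_f, X_g)` on `ℝ × M`. -/
def extBracket (f g : ℝ × M → ℝ) (p : ℝ × M) : ℝ :=
  S.extΩ p ![S.extHamVF f p, S.extHamVF g p]

/-- `f` is a dissipated quantity of `(ℝ × M, Ω̂, θ̂, H)`. -/
def IsExtDissipated (H f : ℝ × M → ℝ) : Prop :=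
  ∀ p, S.extBracket f H p + timeDeriv f p = 0

/-- `f` is a constant of motion of `(ℝ × M, Ω̂, θ̂, H)`. -/
def IsExtConstantOfMotion (H f : ℝ × M → ℝ) : Prop :=
  ∀ p, S.extBracket f H p + f p * S.extθ p ![S.extHamVF H p] + timeDeriv f p = 0

/-- `Φ : U → V` is a (local) canonical transformation of the extended phase space, with
generating function `K`: a diffeomorphism that preserves `t` and `θ̂`, such that
`Φ^* Ω̂ = Ω̂ + d^θ̂ K ∧ dt`. It turns a Hamiltonian `H` into `H ∘ Φ + K`, since
`Φ^* (Ω̂ + d^θ̂ H ∧ dt) = Ω̂ + d^θ̂ (H ∘ Φ + K) ∧ dt`. -/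
structure IsExtCanonicalWith (U V : Set (ℝ × M)) (Φ : ℝ × M → ℝ × M) (K : ℝ × M → ℝ) :
    Prop where
  diffeo : IsDiffeoOn (extModel E) U V Φ
  time : ∀ p ∈ U, (Φ p).1 = p.1
  pullback_θ : ∀ p ∈ U, DForm.pullback (extModel E) Φ S.extθ p = S.extθ p
  smooth_K : ContMDiffOn (extModel E) 𝓘(ℝ, ℝ) ∞ K U
  pullback_Ω : ∀ p ∈ U, DForm.pullback (extModel E) Φ S.extΩ p =
    S.extΩ p + (dTheta S.extθ K).wedge (dFun (extModel E) Prod.fst) p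

/-- `Φ : U → V` is a time-dependent canonical invariance transformation: a canonical
transformation for which the transformed Hamiltonian `H ∘ Φ + K` is `H` itself. -/
def IsExtCanonicalInvariance (H : ℝ × M → ℝ) (U V : Set (ℝ × M)) (Φ : ℝ × M → ℝ × M) : Prop :=
  ∃ K : ℝ × M → ℝ, S.IsExtCanonicalWith U V Φ K ∧ ∀ p ∈ U, H (Φ p) + K p = H p

end LCSStructure

end LCS

end

/-! The heart of the matter is Cartan's formula. From `X_f ⌟ Ω = df - f θ`, `dθ = 0` and `dΩ = θ ∧
Ω` it gives `L_{X_f} Ω = θ(X_f) Ω` (`lieDeriv_bilinInChart`), so the flow preserves `Ω` once `θ(X_f)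
= 0`. Moreover `X_f(H) = {H, f} + H θ(X_f)`, which under the hypotheses is `0` in the
time-independent case and `∂f/∂t` in the time-dependent one.

On `ℝ × M` the same computation yields `[X_f, X̃_H] = -X_g` with `g = {f, H} + ∂f/∂t`, hence `0` for
a dissipated quantity. If `θ̂(X_f) = 0`, then `L_{X_f} Ω̂ = -d^θ̂(∂f/∂t) ∧ dt`, whereas `L_{X_f}
(d^θ̂ H ∧ dt) = d^θ̂(X_f(H)) ∧ dt = d^θ̂(∂f/∂t) ∧ dt`. The two cancel, so the flow preserves `Ω̂ +
d^θ̂ H ∧ dt` (`pullback_hamForm_eq`). It also preserves `t` and `θ̂`, so the second summand pulls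
back to `d^θ̂(H ∘ Ψ_s) ∧ dt`, and `K_s = H - H ∘ Ψ_s` is forced by `H ∘ Ψ_s + K_s = H` and does the
job. The derivative of `H ∘ Ψ_s` in `s` is `∂f/∂t` along the flow, whence the last equivalence.

Two general facts turn these infinitesimal identities into statements on flows. A smooth vector
field on a Hausdorff manifold has a smooth maximal flow (`isFlow_maximalFlow`): the implicit
function theorem on a space of curves gives local flows, charts and a cutoff carry them to the
manifold, and connectedness of each orbit's time interval spreads regularity. A form with vanishing
Lie derivative is preserved (`IsFlow.pullback_eq`), because the group law reduces every time to time
`0`.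

Lie derivatives and brackets are evaluated at the centre of a chart, since `DForm.d` at a point is
computed in the chart around that point. There each identity becomes a linear combination of
Hamilton's equations and their first derivatives, the symmetry of second derivatives, and the
coordinate forms of `dθ = 0` and `dΩ = θ ∧ Ω`. -/

/-! ### Smooth dependence on initial conditions in a normed space -/

section Nemytskii

open Filter Topology

variable {K : Type*} [TopologicalSpace K] [CompactSpace K]
  {E F : Type*} [NormedAddCommGroup E] [NormedSpace ℝ E]
  [NormedAddCommGroup F] [NormedSpace ℝ F]

/-- Pointwise application of a continuous family of operators to a continuous family of vectors,
as a bounded bilinear map. -/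
noncomputable def ContinuousMap.pointwiseApply :
    C(K, E →L[ℝ] F) →L[ℝ] C(K, E) →L[ℝ] C(K, F) :=
  LinearMap.mkContinuous₂
    (LinearMap.mk₂ ℝ (fun (A : C(K, E →L[ℝ] F)) (h : C(K, E)) =>
        (⟨fun k => A k (h k), by fun_prop⟩ : C(K, F)))
      (fun _ _ _ => by ext; simp) (fun _ _ _ => by ext; simp)
      (fun _ _ _ => by ext; simp) (fun _ _ _ => by ext; simp)) 1
    (fun A h => by
      rw [one_mul]
      refine (ContinuousMap.norm_le _ (by positivity)).2 fun k => ?_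
      exact ((A k).le_opNorm _).trans (mul_le_mul (A.norm_coe_le_norm k) (h.norm_coe_le_norm k)
        (norm_nonneg _) (by positivity)))

@[simp]
theorem ContinuousMap.pointwiseApply_apply (A : C(K, E →L[ℝ] F)) (h : C(K, E)) (k : K) :
    ContinuousMap.pointwiseApply A h k = A k (h k) := rfl

/-- Composition on the left with a `C¹` map is differentiable on spaces of continuous maps. -/
theorem ContinuousMap.hasFDerivAt_comp_left (v : C(E, F)) (v' : C(E, E →L[ℝ] F))
    (hv : ∀ x, HasFDerivAt v (v' x) x) (γ : C(K, E)) :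
    HasFDerivAt (fun γ : C(K, E) => v.comp γ) (ContinuousMap.pointwiseApply (v'.comp γ)) γ := by
  rw [hasFDerivAt_iff_isLittleO_nhds_zero, Asymptotics.isLittleO_iff]
  intro ε hε
  -- Compactness of the range makes one `δ` serve all `k`, which upgrades pointwise
  -- differentiability to differentiability for the sup norm; the mean value inequality on each ball
  -- then bounds the remainder.
  have hK : IsCompact (range γ) := isCompact_range γ.continuous
  have huc := hK.uniformContinuousAt_of_continuousAt v' (fun a _ => v'.continuous.continuousAt)
    (Metric.dist_mem_uniformity hε)
  obtain ⟨δ, hδ, hδ'⟩ := Metric.mem_uniformity_dist.1 huc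
  filter_upwards [Metric.ball_mem_nhds (0 : C(K, E)) hδ] with h hh
  rw [mem_ball_zero_iff] at hh
  refine (ContinuousMap.norm_le _ (by positivity)).2 fun k => ?_
  have hb : ∀ y ∈ Metric.ball (γ k) δ, ‖v' y - v' (γ k)‖ ≤ ε := by
    intro y hy
    have := hδ' (a := γ k) (b := y) (by rw [dist_comm]; exact hy) ⟨k, rfl⟩
    rw [← dist_eq_norm, dist_comm]
    exact le_of_lt this
  have hk : ‖h k‖ ≤ ‖h‖ := h.norm_coe_le_norm k
  have := (convex_ball (γ k) δ).norm_image_sub_le_of_norm_hasFDerivWithin_le'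
    (fun y _ => (hv y).hasFDerivWithinAt) hb (Metric.mem_ball_self hδ)
    (show γ k + h k ∈ Metric.ball (γ k) δ by
      rw [mem_ball_iff_norm, add_sub_cancel_left]; exact hk.trans_lt hh)
  rw [add_sub_cancel_left] at this
  refine le_trans ?_ (this.trans (mul_le_mul_of_nonneg_left hk hε.le))
  exact le_of_eq rfl

end Nemytskii

/-- Composition on the left with a `C^n` map is `C^n` on spaces of continuous maps. -/
theorem ContinuousMap.contDiff_comp_left.{u} {K : Type*} [TopologicalSpace K] [CompactSpace K]
    {E : Type u} [NormedAddCommGroup E] [NormedSpace ℝ E] (n : ℕ) :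
    ∀ {F : Type u} [NormedAddCommGroup F] [NormedSpace ℝ F] (v : C(E, F)),
      ContDiff ℝ n v → ContDiff ℝ n (fun γ : C(K, E) => v.comp γ) := by
  induction n with
  | zero =>
    intro F _ _ v _
    exact contDiff_zero.2 (ContinuousMap.continuous_postcomp v)
  | succ n ih =>
    intro F _ _ v hv
    -- The derivative at `γ` is pointwise application of `v' ∘ γ`: a bounded linear map after the
    -- composition operator of `v'`. Induction therefore applies to `v'`, with target `E →L[ℝ] F`;
    -- this is why `F` varies and shares the universe of `E`.
    obtain ⟨f', hc, hd⟩ := (contDiff_succ_iff_hasFDerivAt (n := n)).1 (by exact_mod_cast hv)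
    refine (contDiff_succ_iff_hasFDerivAt (n := n)).2 ⟨_, ?_, fun γ =>
      ContinuousMap.hasFDerivAt_comp_left v ⟨f', hc.continuous⟩ hd γ⟩
    exact ContinuousMap.pointwiseApply.contDiff.comp (ih ⟨f', hc.continuous⟩ hc)

/-! ### Local flows from the implicit function theorem on curves. -/

section LocalFlow

open Filter Topology unitInterval intervalIntegral

variable {E : Type*} [NormedAddCommGroup E] [NormedSpace ℝ E]

/-- The primitive vanishing at `0`, as an operator on continuous curves on `[0, 1]`. -/
noncomputable def ContinuousMap.primitive : C(I, E) →L[ℝ] C(I, E) :=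
  LinearMap.mkContinuous
    { toFun := fun γ => ⟨fun τ => ∫ ρ in (0 : ℝ)..τ, γ (projIcc 0 1 zero_le_one ρ), by
        have h : Continuous fun ρ => γ (projIcc 0 1 zero_le_one ρ) :=
          γ.continuous.comp continuous_projIcc
        exact (continuous_primitive (fun a b => h.intervalIntegrable a b) 0).comp
          continuous_subtype_val⟩
      map_add' := fun γ γ' => by
        ext τ
        have h : ∀ γ : C(I, E), Continuous fun ρ => γ (projIcc 0 1 zero_le_one ρ) :=
          fun γ => γ.continuous.comp continuous_projIcc
        exact integral_add ((h γ).intervalIntegrable _ _) ((h γ').intervalIntegrable _ _)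
      map_smul' := fun c γ => by
        ext τ
        exact integral_smul c _ } 1
    (fun γ => by
      rw [one_mul]
      refine (ContinuousMap.norm_le _ (norm_nonneg _)).2 fun τ => ?_
      refine (norm_integral_le_of_norm_le_const fun ρ _ => γ.norm_coe_le_norm _).trans ?_
      rw [sub_zero, abs_of_nonneg τ.2.1]
      exact mul_le_of_le_one_right (norm_nonneg _) τ.2.2)

theorem ContinuousMap.primitive_apply (γ : C(I, E)) (τ : I) :
    ContinuousMap.primitive γ τ = ∫ ρ in (0 : ℝ)..τ, γ (projIcc 0 1 zero_le_one ρ) := rfl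

/-- The flow of a bounded smooth vector field on a Banach space is `C^n` near any initial point. -/
theorem exists_contDiffAt_flow [CompleteSpace E] {v : E → E} (hv : ContDiff ℝ ∞ v) {C : ℝ}
    (hC : ∀ x, ‖v x‖ ≤ C) (x₀ : E) (n : ℕ) (hn : n ≠ 0) :
    ∃ Φ : ℝ × E → E, ContDiffAt ℝ n Φ (0, x₀) ∧ (∀ᶠ x in 𝓝 x₀, Φ (0, x) = x) ∧
      ∀ᶠ q : ℝ × E in 𝓝 (0, x₀), HasDerivAt (fun s => Φ (s, q.2)) (v (Φ q)) q.1 := by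
  let V : C(E, E) := ⟨v, hv.continuous⟩
  -- A zero of `G` at `((s, x), γ)` is a curve with `γ τ = x + s ∫₀^τ v(γ)`, that is, the solution
  -- from `x` run at speed `s`. Its value at `τ = 1` is the flow at time `s`, so time becomes a
  -- parameter on the fixed interval `[0, 1]`.
  let G : (ℝ × E) × C(I, E) → C(I, E) := fun w =>
    w.2 - ContinuousMap.const I w.1.2 - w.1.1 • ContinuousMap.primitive (V.comp w.2)
  let cst : E →L[ℝ] C(I, E) := LinearMap.mkContinuous
    { toFun := ContinuousMap.const I, map_add' := fun _ _ => rfl, map_smul' := fun _ _ => rfl } 1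
    (fun x => by
      rw [one_mul]
      exact (ContinuousMap.norm_le _ (norm_nonneg _)).2 fun _ => le_rfl)
  have hn' : ((n : ℕ∞) : WithTop ℕ∞) ≠ 0 := by exact_mod_cast hn
  have hG : ContDiff ℝ n G := by
    have h1 : ContDiff ℝ n (fun γ : C(I, E) => V.comp γ) :=
      ContinuousMap.contDiff_comp_left n V (hv.of_le (by exact_mod_cast le_top))
    exact (contDiff_snd.sub (cst.contDiff.comp (contDiff_snd.comp contDiff_fst))).sub
      ((contDiff_fst.comp contDiff_fst).smul
        (ContinuousMap.primitive.contDiff.comp (h1.comp contDiff_snd)))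
  let u : (ℝ × E) × C(I, E) := ((0, x₀), ContinuousMap.const I x₀)
  -- At `s = 0` the integral term disappears and `G` is a translation in `γ`, so its partial
  -- derivative is the identity.
  have hinr : fderiv ℝ G u ∘L .inr ℝ (ℝ × E) C(I, E) = ContinuousLinearMap.id ℝ _ := by
    have h1 : HasFDerivAt (fun γ : C(I, E) => G ((0, x₀), γ))
        (fderiv ℝ G u ∘L .inr ℝ (ℝ × E) C(I, E)) (ContinuousMap.const I x₀) :=
      ((hG.differentiable hn').differentiableAt.hasFDerivAt (x := u)).comp
        (f := fun γ : C(I, E) => ((0, x₀), γ)) _ (hasFDerivAt_prodMk_right _ _)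
    have h2 : HasFDerivAt (fun γ : C(I, E) => G ((0, x₀), γ))
        (ContinuousLinearMap.id ℝ _) (ContinuousMap.const I x₀) := by
      have : (fun γ : C(I, E) => G ((0, x₀), γ)) = fun γ => γ - ContinuousMap.const I x₀ := by
        funext γ
        simp [G]
      rw [this]
      exact (hasFDerivAt_id _).sub_const _
    exact h1.unique h2
  have hinv : (fderiv ℝ G u ∘L .inr ℝ (ℝ × E) C(I, E)).IsInvertible := by
    rw [hinr]; exact ⟨.refl ℝ _, rfl⟩
  have hGu : ContDiffAt ℝ n G u := hG.contDiffAt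
  let g := hGu.implicitFunction hn' hinv
  have hg : ContDiffAt ℝ n g (0, x₀) := hGu.contDiffAt_implicitFunction hn' hinv
  have hGu0 : G u = 0 := by simp [G, u]
  have hiff : ∀ᶠ w in 𝓝 u, G w = G u ↔ g w.1 = w.2 :=
    hGu.eventually_apply_eq_iff_implicitFunction hn' hinv
  -- The solutions `α x` come from Picard–Lindelöf. They are identified with the implicit function
  -- through its local uniqueness, which requires the rescaled solution curve to lie within `δ` of
  -- the constant curve.
  obtain ⟨r, hr, ε, hε, H⟩ := (hv.contDiffAt.of_le (m := 1)
    (by exact_mod_cast le_top)).exists_forall_mem_closedBall_exists_eq_forall_mem_Ioo_hasDerivAt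
    (x₀ := x₀) 0
  choose! α hα0 hα using H
  simp only [zero_sub, zero_add] at hα
  obtain ⟨δ, hδ, hδ'⟩ := Metric.eventually_nhds_iff.1 hiff
  have hC0 : 0 ≤ C := (norm_nonneg _).trans (hC x₀)
  -- near the base point, the evaluation of the implicit function at time `1` is the solution
  have key : ∀ᶠ q : ℝ × E in 𝓝 (0, x₀), g q 1 = α q.2 q.1 := by
    have e1 : ∀ᶠ q : ℝ × E in 𝓝 (0, x₀), |q.1| < ε ∧ q.2 ∈ Metric.closedBall x₀ r := by
      have a : Tendsto (fun q : ℝ × E => |q.1|) (𝓝 (0, x₀)) (𝓝 |(0:ℝ)|) :=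
        (continuous_abs.comp continuous_fst).tendsto _
      rw [abs_zero] at a
      exact (a.eventually_lt_const hε).and
        ((continuous_snd.tendsto (0, x₀)).eventually (Metric.closedBall_mem_nhds x₀ hr))
    -- The bound `C` on `v` keeps the whole rescaled curve within `‖x - x₀‖ + C |s|` of `x₀`.
    have e2 : ∀ᶠ q : ℝ × E in 𝓝 (0, x₀), ‖q.2 - x₀‖ + C * |q.1| < δ := by
      have a : Tendsto (fun q : ℝ × E => ‖q.2 - x₀‖ + C * |q.1|) (𝓝 (0, x₀))
          (𝓝 (‖x₀ - x₀‖ + C * |(0:ℝ)|)) := Continuous.tendsto (by fun_prop) _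
      simp only [sub_self, norm_zero, abs_zero, mul_zero, add_zero] at a
      exact a.eventually_lt_const hδ
    have e3 : ∀ᶠ q : ℝ × E in 𝓝 (0, x₀), dist q (0, x₀) < δ := Metric.ball_mem_nhds _ hδ
    filter_upwards [e1, e2, e3] with q ⟨hq1, hq2⟩ hq3 hq4
    obtain ⟨s, x⟩ := q
    dsimp only at hq1 hq2 hq3 ⊢
    have hmem : ∀ τ : ℝ, τ ∈ Icc (0 : ℝ) 1 → s * τ ∈ Ioo (-ε) ε := fun τ hτ => by
      rw [mem_Ioo, ← abs_lt, abs_mul, abs_of_nonneg hτ.1]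
      exact (mul_le_of_le_one_right (abs_nonneg _) hτ.2).trans_lt hq1
    have hder : ∀ τ ∈ Icc (0 : ℝ) 1,
        HasDerivAt (fun τ => α x (s * τ)) (s • v (α x (s * τ))) τ := fun τ hτ => by
      have := (hα x hq2 (s * τ) (hmem τ hτ)).scomp τ ((hasDerivAt_id τ).const_mul s)
      simpa [Function.comp_def] using this
    have hcont : ContinuousOn (fun τ => α x (s * τ)) (Icc (0 : ℝ) 1) :=
      fun τ hτ => (hder τ hτ).continuousAt.continuousWithinAt
    let γ : C(I, E) := ⟨fun τ => α x (s * τ), hcont.domRestrict⟩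
    have hFTC : ∀ τ : I, α x (s * τ) - x = s • ∫ ρ in (0 : ℝ)..τ, v (α x (s * ρ)) := by
      intro τ
      have hsub : Set.uIcc (0 : ℝ) τ ⊆ Icc 0 1 := by
        rw [Set.uIcc_of_le τ.2.1]; exact Icc_subset_Icc_right τ.2.2
      rw [← integral_smul, integral_eq_sub_of_hasDerivAt (f := fun τ => α x (s * τ))
        (fun ρ hρ => hder ρ (hsub hρ))]
      · simp [hα0 x hq2]
      · exact ((hv.continuous.comp_continuousOn (hcont.mono hsub)).const_smul
          s).intervalIntegrable
    have hG0 : G ((s, x), γ) = G u := by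
      rw [hGu0]
      ext τ
      change α x (s * τ) - x - s • ContinuousMap.primitive (V.comp γ) τ = 0
      rw [ContinuousMap.primitive_apply, hFTC, sub_eq_zero]
      congr 1
      refine integral_congr fun ρ hρ => ?_
      rw [Set.uIcc_of_le τ.2.1] at hρ
      have : projIcc 0 1 zero_le_one ρ = ⟨ρ, hρ.1, hρ.2.trans τ.2.2⟩ :=
        projIcc_of_mem _ ⟨hρ.1, hρ.2.trans τ.2.2⟩
      simp only [this]
      rfl
    have hdist : dist ((s, x), γ) u < δ := by
      rw [Prod.dist_eq]
      refine max_lt hq4 ?_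
      rw [ContinuousMap.dist_lt_iff hδ]
      intro τ
      refine lt_of_le_of_lt ?_ hq3
      rw [dist_eq_norm]
      change ‖α x (s * τ) - x₀‖ ≤ _
      have : α x (s * τ) - x₀ = (x - x₀) + s • ∫ ρ in (0 : ℝ)..τ, v (α x (s * ρ)) := by
        rw [← hFTC]; abel
      rw [this]
      refine (norm_add_le _ _).trans (add_le_add_right ?_ _)
      rw [norm_smul, Real.norm_eq_abs, mul_comm]
      refine mul_le_mul_of_nonneg_right ?_ (abs_nonneg _)
      refine (norm_integral_le_of_norm_le_const fun ρ _ => hC _).trans ?_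
      rw [sub_zero, abs_of_nonneg τ.2.1]
      exact mul_le_of_le_one_right hC0 τ.2.2
    have := (hδ' hdist).1 hG0
    rw [this]
    change α x (s * 1) = _
    rw [mul_one]
  have hev : ContDiff ℝ n (fun γ : C(I, E) => γ 1) := 
    (ContinuousMap.evalCLM ℝ (1 : I) : C(I, E) →L[ℝ] E).contDiff
  refine ⟨fun q => g q 1, hev.contDiffAt.comp _ hg, ?_, ?_⟩
  · have h0 : Tendsto (fun x : E => ((0 : ℝ), x)) (𝓝 x₀) (𝓝 (0, x₀)) :=
      Continuous.tendsto (by fun_prop) _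
    filter_upwards [h0.eventually key, Metric.closedBall_mem_nhds x₀ hr] with x h1 h2
    exact h1.trans (hα0 x h2)
  · have e1 : ∀ᶠ q : ℝ × E in 𝓝 (0, x₀), q.1 ∈ Ioo (-ε) ε ∧ q.2 ∈ Metric.closedBall x₀ r :=
      ((continuous_fst.tendsto (0, x₀)).eventually (Ioo_mem_nhds (neg_lt_zero.2 hε) hε)).and
        ((continuous_snd.tendsto (0, x₀)).eventually (Metric.closedBall_mem_nhds x₀ hr))
    filter_upwards [e1, key.eventually_nhds] with q hq hk
    have hk' : (fun s => g (s, q.2) 1) =ᶠ[𝓝 q.1] α q.2 := by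
      have h0 : Tendsto (fun s : ℝ => (s, q.2)) (𝓝 q.1) (𝓝 q) :=
        Continuous.tendsto (by fun_prop) _
      exact h0.eventually hk
    have hq' : g q 1 = α q.2 q.1 := hk.self_of_nhds
    rw [hq']
    exact (hα q.2 hq.2 q.1 hq.1).congr_of_eventuallyEq hk'

end LocalFlow

/-! ### Vector fields in charts -/

section VectorFieldChart

open Filter Topology Bundle

variable {F : Type*} [NormedAddCommGroup F] [NormedSpace ℝ F]
  {H : Type*} [TopologicalSpace H] {I : ModelWithCorners ℝ F H}
  {N : Type*} [TopologicalSpace N] [ChartedSpace H N]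

/-- The expression of a vector field in the chart around `x₀`. -/
noncomputable def vectorFieldInChart (I : ModelWithCorners ℝ F H) (X : (x : N) → TangentSpace I x)
    (x₀ : N) (y : F) : F :=
  mfderiv I 𝓘(ℝ, F) (extChartAt I x₀) ((extChartAt I x₀).symm y) (X ((extChartAt I x₀).symm y))

/-- The tangent space at `x₀` is identified with `F` by the preferred chart at `x₀`, so the
differential of that chart at its own centre is the identity. -/
theorem vectorFieldInChart_self [IsManifold I 1 N] (X : (x : N) → TangentSpace I x) (x₀ : N) :
    vectorFieldInChart I X x₀ (extChartAt I x₀ x₀) = X x₀ := by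
  rw [vectorFieldInChart, extChartAt_to_inv, mfderiv_extChartAt_self]
  rfl

/-- Over the source of a chart, the trivialization of the tangent bundle is the differential of that
chart, so the fibre coordinate of the section is its chart expression. -/
theorem contMDiffOn_vectorField_iff [IsManifold I ∞ N] {X : (x : N) → TangentSpace I x} {x₀ : N}
    {n : ℕ∞} :
    ContMDiffOn I I.tangent n (fun x => (⟨x, X x⟩ : TangentBundle I N)) (chartAt H x₀).source ↔
      ContMDiffOn I 𝓘(ℝ, F) n (fun x => vectorFieldInChart I X x₀ (extChartAt I x₀ x))
        (chartAt H x₀).source := by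
  have hs : (chartAt H x₀).source = (trivializationAt F (TangentSpace I) x₀).baseSet := rfl
  rw [hs, Trivialization.contMDiffOn_section_baseSet_iff]
  refine contMDiffOn_congr fun x hx => ?_
  rw [vectorFieldInChart, (extChartAt I x₀).left_inv (by rwa [extChartAt_source]),
    ← TangentBundle.continuousLinearMapAt_trivializationAt hx]
  exact (Trivialization.continuousLinearMapAt_apply_of_mem (R := ℝ)
    (trivializationAt F (TangentSpace I) x₀) hx (X x)).symm

theorem contMDiff_vectorField_of_inChart [IsManifold I ∞ N]
    {X : (x : N) → TangentSpace I x} {n : ℕ∞}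
    (h : ∀ x₀, ContDiffOn ℝ n (vectorFieldInChart I X x₀) (extChartAt I x₀).target) :
    ContMDiff I I.tangent n (fun x => (⟨x, X x⟩ : TangentBundle I N)) := by
  intro x₀
  refine ContMDiffOn.contMDiffAt (contMDiffOn_vectorField_iff.2 ?_) (chart_source_mem_nhds H x₀)
  refine (h x₀).contMDiffOn.comp ((contMDiffOn_extChartAt (n := ∞)).of_le
    (by exact_mod_cast le_top)) ?_
  intro x hx
  exact (extChartAt I x₀).map_source (by rwa [extChartAt_source])

theorem contDiffOn_vectorFieldInChart [I.Boundaryless] [IsManifold I ∞ N]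
    {X : (x : N) → TangentSpace I x} {n : ℕ∞}
    (h : ContMDiff I I.tangent n (fun x => (⟨x, X x⟩ : TangentBundle I N))) (x₀ : N) :
    ContDiffOn ℝ n (vectorFieldInChart I X x₀) (extChartAt I x₀).target := by
  have h1 := contMDiffOn_vectorField_iff.1 (h.contMDiffOn (s := (chartAt H x₀).source))
  rw [← contMDiffOn_iff_contDiffOn]
  refine (h1.comp ((contMDiffOn_extChartAt_symm (I := I) (n := ∞) x₀).of_le (m := n)
    (by exact_mod_cast le_top)) ?_).congr ?_
  · intro y hy
    have := (extChartAt I x₀).map_target hy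
    rwa [extChartAt_source] at this
  · intro y hy
    simp only [comp_apply, (extChartAt I x₀).right_inv hy]

/-- A smooth vector field has `C^n` local flows, for each finite `n`. -/
theorem exists_contMDiffAt_flow [FiniteDimensional ℝ F] [I.Boundaryless] [IsManifold I ∞ N]
    {X : (x : N) → TangentSpace I x}
    (h : ContMDiff I I.tangent ∞ (fun x => (⟨x, X x⟩ : TangentBundle I N))) (x₀ : N)
    (n : ℕ) (hn : n ≠ 0) :
    ∃ Φ : ℝ × N → N, ContMDiffAt (𝓘(ℝ, ℝ).prod I) I n Φ (0, x₀) ∧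
      (∀ᶠ x in 𝓝 x₀, Φ (0, x) = x) ∧
      ∀ᶠ q : ℝ × N in 𝓝 (0, x₀), HasMFDerivAt 𝓘(ℝ, ℝ) I (fun s => Φ (s, q.2)) q.1
        ((1 : ℝ →L[ℝ] ℝ).smulRight (X (Φ q))) := by
  set φ := extChartAt I x₀ with hφ
  have hto : IsOpen φ.target := isOpen_extChartAt_target x₀
  have hy₀ : φ x₀ ∈ φ.target := mem_extChartAt_target x₀
  have hχ := contDiffOn_vectorFieldInChart h x₀
  -- cut the local expression off
  obtain ⟨δ, hδ, hball⟩ := Metric.isOpen_iff.1 hto _ hy₀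
  -- The bump is `1` on the closed ball of radius `δ / 3` and has support in that of radius `δ / 2`,
  -- inside the chart target. The cut-off field is thus smooth and bounded on all of `F`.
  let b : ContDiffBump (φ x₀) := ⟨δ / 3, δ / 2, by positivity, by linarith⟩
  have hbt : tsupport b ⊆ φ.target := by
    rw [b.tsupport_eq]
    exact (Metric.closedBall_subset_ball (by simp only [b]; linarith)).trans hball
  let v : F → F := fun y => b y • vectorFieldInChart I X x₀ y
  have hv : ContDiff ℝ ∞ v := by
    rw [contDiff_iff_contDiffAt]
    intro y
    by_cases hy : y ∈ tsupport b
    · exact b.contDiff.contDiffAt.smul (hχ.contDiffAt (hto.mem_nhds (hbt hy)))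
    · have : v =ᶠ[𝓝 y] fun _ => 0 := by
        filter_upwards [(isClosed_tsupport b).isOpen_compl.mem_nhds hy] with z hz
        simp only [v, image_eq_zero_of_notMem_tsupport hz, zero_smul]
      exact contDiffAt_const.congr_of_eventuallyEq this
  have hvs : HasCompactSupport v := b.hasCompactSupport.smul_right
  obtain ⟨C, hC⟩ := hvs.exists_bound_of_continuous hv.continuous
  obtain ⟨Φ, hΦ, hΦ0, hΦ'⟩ := exists_contDiffAt_flow hv hC (φ x₀) n hn
  have hcφ : ContinuousAt φ x₀ := continuousAt_extChartAt x₀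
  have hΦ00 : Φ (0, φ x₀) = φ x₀ := hΦ0.self_of_nhds
  have hT : Tendsto (fun q : ℝ × N => (q.1, φ q.2)) (𝓝 (0, x₀)) (𝓝 (0, φ x₀)) :=
    continuousAt_fst.prodMk (hcφ.comp continuousAt_snd)
  refine ⟨fun q => φ.symm (Φ (q.1, φ q.2)), ?_, ?_, ?_⟩
  · have h1 : ContMDiffAt (𝓘(ℝ, ℝ).prod I) 𝓘(ℝ, ℝ × F) n
        (fun q : ℝ × N => (q.1, φ q.2)) (0, x₀) :=
      contMDiffAt_fst.prodMk_space
        (((contMDiffAt_extChartAt (I := I) (n := ∞)).of_le (by exact_mod_cast le_top)).comp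
          (0, x₀) contMDiffAt_snd)
    have h2 : ContMDiffAt (𝓘(ℝ, ℝ).prod I) 𝓘(ℝ, F) n
        (fun q : ℝ × N => Φ (q.1, φ q.2)) (0, x₀) :=
      ContMDiffAt.comp (0, x₀) (g := Φ) (I' := 𝓘(ℝ, ℝ × F)) hΦ.contMDiffAt h1
    refine ContMDiffAt.comp (0, x₀) (g := φ.symm) (I' := 𝓘(ℝ, F)) ?_ h2
    rw [show Φ (((0, x₀) : ℝ × N).1, φ ((0, x₀) : ℝ × N).2) = φ x₀ from hΦ00]
    exact (((contMDiffOn_extChartAt_symm (I := I) (n := ∞) x₀).contMDiffAt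
      (hto.mem_nhds hy₀))).of_le (by exact_mod_cast le_top)
  · filter_upwards [hcφ.eventually hΦ0, extChartAt_source_mem_nhds (I := I) x₀] with x h1 h2
    rw [h1, φ.left_inv h2]
  -- For small times the flow of the cut-off field stays where the bump is `1`, and there it follows
  -- the original field.
  · have e1 : ∀ᶠ q : ℝ × N in 𝓝 (0, x₀), Φ (q.1, φ q.2) ∈ Metric.ball (φ x₀) (δ / 3) := by
      have : Tendsto (fun q : ℝ × N => Φ (q.1, φ q.2)) (𝓝 (0, x₀)) (𝓝 (φ x₀)) := by
        have := hΦ.continuousAt.tendsto.comp hT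
        rwa [hΦ00] at this
      exact this.eventually (Metric.ball_mem_nhds _ (by positivity))
    filter_upwards [e1, hT.eventually hΦ'] with q hq1 hq2
    set y := Φ (q.1, φ q.2) with hy
    have hyt : y ∈ φ.target := hball (Metric.ball_subset_ball (by linarith) hq1)
    have hb1 : b y = 1 := b.one_of_mem_closedBall (Metric.ball_subset_closedBall hq1)
    have hvy : v y = vectorFieldInChart I X x₀ y := by simp only [v, hb1, one_smul]
    have hs : HasMFDerivAt 𝓘(ℝ, F) I φ.symm y (mfderiv 𝓘(ℝ, F) I φ.symm y) :=
      ((contMDiffOn_extChartAt_symm (I := I) (n := ∞) x₀).contMDiffAt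
        (hto.mem_nhds hyt)).mdifferentiableAt (by simp) |>.hasMFDerivAt
    have hd : HasMFDerivAt 𝓘(ℝ, ℝ) 𝓘(ℝ, F) (fun s => Φ (s, φ q.2)) q.1
        ((1 : ℝ →L[ℝ] ℝ).smulRight (v y)) := hq2.hasFDerivAt.hasMFDerivAt
    refine (hs.comp q.1 hd).congr_mfderiv ?_
    have hinv := mfderivWithin_extChartAt_symm_comp_mfderiv_extChartAt (I := I) hyt
    rw [I.range_eq_univ, mfderivWithin_univ] at hinv
    refine ContinuousLinearMap.ext_ring ?_
    change mfderiv 𝓘(ℝ, F) I φ.symm y ((1 : ℝ) • v y : F) = (1 : ℝ) • X (φ.symm y)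
    rw [hvy, one_smul, one_smul]
    exact congrArg (fun L => L (X (φ.symm y))) hinv

end VectorFieldChart

/-! ### The maximal flow of a vector field -/

section MaximalFlow

open Filter Topology

/-- Supplies an open interval around both `0` and a given time, on which uniqueness of integral
curves is applied. -/
theorem exists_Ioo_subset_of_ordConnected {U : Set ℝ} (hU : IsOpen U) (hU' : OrdConnected U)
    {x y : ℝ} (hx : x ∈ U) (hy : y ∈ U) :
    ∃ a b, x ∈ Ioo a b ∧ y ∈ Ioo a b ∧ Ioo a b ⊆ U := by
  have hmin : min x y ∈ U := by rcases min_choice x y with h | h <;> rw [h] <;> assumption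
  have hmax : max x y ∈ U := by rcases max_choice x y with h | h <;> rw [h] <;> assumption
  obtain ⟨δ, hδ, h1⟩ := Metric.isOpen_iff.1 hU _ hmin
  obtain ⟨η, hη, h2⟩ := Metric.isOpen_iff.1 hU _ hmax
  have ha : min x y - δ / 2 ∈ U := h1 (by
    rw [Metric.mem_ball, Real.dist_eq, sub_sub_cancel_left, abs_neg, abs_of_pos] <;> linarith)
  have hb : max x y + η / 2 ∈ U := h2 (by
    rw [Metric.mem_ball, Real.dist_eq, add_sub_cancel_left, abs_of_pos] <;> linarith)
  have hx1 := min_le_left x y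
  have hx2 := le_max_left x y
  have hy1 := min_le_right x y
  have hy2 := le_max_right x y
  exact ⟨_, _, ⟨by linarith, by linarith⟩, ⟨by linarith, by linarith⟩,
    Ioo_subset_Icc_self.trans (hU'.out ha hb)⟩

variable {F : Type*} [NormedAddCommGroup F] [NormedSpace ℝ F]
  {H : Type*} [TopologicalSpace H] {I : ModelWithCorners ℝ F H}
  {N : Type*} [TopologicalSpace N] [ChartedSpace H N]

/-- `γ` is an integral curve of `X` on the open interval `J ∋ 0`, starting at `p`. -/
structure IsIntegralCurveFrom (X : (x : N) → TangentSpace I x) (p : N) (γ : ℝ → N) (J : Set ℝ) :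
    Prop where
  isOpen : IsOpen J
  ordConnected : OrdConnected J
  zero_mem : 0 ∈ J
  map_zero : γ 0 = p
  isMIntegralCurveOn : IsMIntegralCurveOn γ X J

/-- The domain of the maximal flow. -/
def flowDomain (X : (x : N) → TangentSpace I x) : Set (ℝ × N) :=
  {q | ∃ γ J, IsIntegralCurveFrom X q.2 γ J ∧ q.1 ∈ J}

open Classical in
/-- The maximal flow. -/
noncomputable def maximalFlow (X : (x : N) → TangentSpace I x) (s : ℝ) (p : N) : N :=
  if h : (s, p) ∈ flowDomain X then h.choose s else p

variable {X : (x : N) → TangentSpace I x} {p : N}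

theorem IsIntegralCurveFrom.eq_of_mem [I.Boundaryless] [IsManifold I ∞ N] [T2Space N]
    (hX : ContMDiff I I.tangent ∞ (fun x => (⟨x, X x⟩ : TangentBundle I N)))
    {γ γ' : ℝ → N} {J J' : Set ℝ} (h : IsIntegralCurveFrom X p γ J)
    (h' : IsIntegralCurveFrom X p γ' J') {s : ℝ} (hs : s ∈ J) (hs' : s ∈ J') : γ s = γ' s := by
  obtain ⟨a, b, h0, hsab, hab⟩ := exists_Ioo_subset_of_ordConnected (h.isOpen.inter h'.isOpen)
    (h.ordConnected.inter h'.ordConnected) ⟨h.zero_mem, h'.zero_mem⟩ ⟨hs, hs'⟩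
  exact isMIntegralCurveOn_Ioo_eqOn_of_contMDiff_boundaryless h0
    (hX.of_le (by exact_mod_cast le_top))
    (h.isMIntegralCurveOn.mono (hab.trans inter_subset_left))
    (h'.isMIntegralCurveOn.mono (hab.trans inter_subset_right))
    (h.map_zero.trans h'.map_zero.symm) hsab

theorem isOpen_flowDomain_slice (X : (x : N) → TangentSpace I x) (p : N) :
    IsOpen {s : ℝ | (s, p) ∈ flowDomain X} := by
  rw [isOpen_iff_mem_nhds]
  rintro s ⟨γ, J, h, hs⟩
  filter_upwards [h.isOpen.mem_nhds hs] with r hr using ⟨γ, J, h, hr⟩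

theorem ordConnected_flowDomain_slice (X : (x : N) → TangentSpace I x) (p : N) :
    OrdConnected {s : ℝ | (s, p) ∈ flowDomain X} := by
  refine ⟨fun s hs t ht r hr => ?_⟩
  obtain ⟨γ, J, h, hs⟩ := hs
  obtain ⟨γ', J', h', ht⟩ := ht
  rcases le_total r 0 with h0 | h0
  · exact ⟨γ, J, h, h.ordConnected.out hs h.zero_mem ⟨hr.1, h0⟩⟩
  · exact ⟨γ', J', h', h'.ordConnected.out h'.zero_mem ht ⟨h0, hr.2⟩⟩

/-- Time translation along an integral curve. -/
theorem IsIntegralCurveFrom.shift {X : (x : N) → TangentSpace I x} {γ : ℝ → N} {J : Set ℝ}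
    (h : IsIntegralCurveFrom X p γ J) {r : ℝ} (hr : r ∈ J) :
    IsIntegralCurveFrom X (γ r) (γ ∘ (· + r)) {s | s + r ∈ J} where
  isOpen := h.isOpen.preimage (by fun_prop)
  ordConnected := ⟨fun s hs t ht q hq => h.ordConnected.out hs ht
    ⟨by linarith [hq.1], by linarith [hq.2]⟩⟩
  zero_mem := by simpa using hr
  map_zero := by simp
  isMIntegralCurveOn := h.isMIntegralCurveOn.comp_add r

theorem zero_mem_flowDomain [I.Boundaryless] [IsManifold I ∞ N] [CompleteSpace F]
    (hX : ContMDiff I I.tangent ∞ (fun x => (⟨x, X x⟩ : TangentBundle I N))) (p : N) :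
    (0, p) ∈ flowDomain X := by
  obtain ⟨γ, h0, h⟩ := exists_isMIntegralCurveAt_of_contMDiffAt_boundaryless (t₀ := 0)
    ((hX.of_le (m := 1) (by exact_mod_cast le_top)) p)
  obtain ⟨ε, hε, h⟩ := isMIntegralCurveAt_iff'.1 h
  exact ⟨γ, _, ⟨Metric.isOpen_ball, (convex_ball _ _).ordConnected, Metric.mem_ball_self hε,
    h0, h⟩, Metric.mem_ball_self hε⟩

variable [I.Boundaryless] [IsManifold I ∞ N] [T2Space N]

/-- By uniqueness the integral curve chosen in `maximalFlow` does not matter; every later property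
of the flow is read off from a convenient curve. -/
theorem IsIntegralCurveFrom.maximalFlow_eq
    (hX : ContMDiff I I.tangent ∞ (fun x => (⟨x, X x⟩ : TangentBundle I N)))
    {γ : ℝ → N} {J : Set ℝ}
    (h : IsIntegralCurveFrom X p γ J) {s : ℝ} (hs : s ∈ J) : maximalFlow X s p = γ s := by
  have hm : (s, p) ∈ flowDomain X := ⟨γ, J, h, hs⟩
  rw [maximalFlow, dif_pos hm]
  obtain ⟨J', h', hs'⟩ := hm.choose_spec
  exact h'.eq_of_mem hX h hs' hs

/-- The maximal integral curve starting at `p`. -/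
theorem isIntegralCurveFrom_maximalFlow [CompleteSpace F]
    (hX : ContMDiff I I.tangent ∞ (fun x => (⟨x, X x⟩ : TangentBundle I N))) (p : N) :
    IsIntegralCurveFrom X p (fun s => maximalFlow X s p) {s : ℝ | (s, p) ∈ flowDomain X} where
  isOpen := isOpen_flowDomain_slice X p
  ordConnected := ordConnected_flowDomain_slice X p
  zero_mem := zero_mem_flowDomain hX p
  map_zero := by
    obtain ⟨γ, J, h, hs⟩ := zero_mem_flowDomain hX p
    rw [h.maximalFlow_eq hX hs]
    exact h.map_zero
  isMIntegralCurveOn := by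
    rintro s ⟨γ, J, h, hs⟩
    have hnhds := h.isOpen.mem_nhds hs
    have heq : (fun s => maximalFlow X s p) =ᶠ[𝓝 s] γ := by
      filter_upwards [hnhds] with r hr using h.maximalFlow_eq hX hr
    have h1 := ((h.isMIntegralCurveOn s hs).hasMFDerivAt hnhds).congr_of_eventuallyEq heq
    rw [← h.maximalFlow_eq hX hs] at h1
    exact h1.hasMFDerivWithinAt

/-- The time translate of the maximal curve from `p` is an integral curve from the point reached at
time `r`. -/
theorem maximalFlow_add [CompleteSpace F]
    (hX : ContMDiff I I.tangent ∞ (fun x => (⟨x, X x⟩ : TangentBundle I N))) {s r : ℝ} {p : N}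
    (hr : (r, p) ∈ flowDomain X) (hs : (s + r, p) ∈ flowDomain X) :
    (s, maximalFlow X r p) ∈ flowDomain X ∧
      maximalFlow X (s + r) p = maximalFlow X s (maximalFlow X r p) := by
  have h := (isIntegralCurveFrom_maximalFlow hX p).shift hr
  exact ⟨⟨_, _, h, hs⟩, (h.maximalFlow_eq hX hs).symm⟩

theorem mem_flowDomain_add_iff [CompleteSpace F]
    (hX : ContMDiff I I.tangent ∞ (fun x => (⟨x, X x⟩ : TangentBundle I N))) {s r : ℝ} {p : N}
    (hr : (r, p) ∈ flowDomain X) :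
    (s, maximalFlow X r p) ∈ flowDomain X ↔ (s + r, p) ∈ flowDomain X := by
  refine ⟨fun h => ?_, fun h => (maximalFlow_add hX hr h).1⟩
  -- Flowing back by `-r` returns to `p`. Seen from `maximalFlow X r p`, time `s` is then time `-r`
  -- followed by time `s + r` from `p`.
  have h0 : (-r + r, p) ∈ flowDomain X := by
    rw [neg_add_cancel]; exact zero_mem_flowDomain hX p
  obtain ⟨h1, h2⟩ := maximalFlow_add hX hr h0
  rw [neg_add_cancel, (isIntegralCurveFrom_maximalFlow hX p).map_zero] at h2
  have h3 := (maximalFlow_add hX (s := s + r) h1 (by rwa [add_neg_cancel_right])).1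
  rwa [← h2] at h3

/-- The maximal flow is defined and `C^n` near `(0, p)`. -/
theorem maximalFlow_contMDiffAt_zero [FiniteDimensional ℝ F]
    (hX : ContMDiff I I.tangent ∞ (fun x => (⟨x, X x⟩ : TangentBundle I N))) (p : N)
    (n : ℕ) (hn : n ≠ 0) :
    flowDomain X ∈ 𝓝 ((0 : ℝ), p) ∧
      ContMDiffAt (𝓘(ℝ, ℝ).prod I) I n (fun q : ℝ × N => maximalFlow X q.1 q.2) (0, p) := by
  obtain ⟨Φ, hΦ, hΦ0, hΦ'⟩ := exists_contMDiffAt_flow hX p n hn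
  obtain ⟨u, hu, w, hw, huw⟩ := mem_nhds_prod_iff.1 hΦ'
  obtain ⟨ε, hε, hεu⟩ := Metric.mem_nhds_iff.1 hu
  have hcurve : ∀ x ∈ w, Φ (0, x) = x →
      IsIntegralCurveFrom X x (fun s => Φ (s, x)) (Metric.ball 0 ε) := fun x hx hx0 =>
    ⟨Metric.isOpen_ball, (convex_ball _ _).ordConnected, Metric.mem_ball_self hε, hx0,
      fun s hs => (huw (show (s, x) ∈ u ×ˢ w from ⟨hεu hs, hx⟩)).hasMFDerivWithinAt⟩
  have hnear : ∀ᶠ q : ℝ × N in 𝓝 (0, p), q.1 ∈ Metric.ball (0 : ℝ) ε ∧ q.2 ∈ w ∧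
      Φ (0, q.2) = q.2 :=
    ((continuous_fst.tendsto ((0 : ℝ), p)).eventually (Metric.ball_mem_nhds _ hε)).and
      ((continuous_snd.tendsto ((0 : ℝ), p)).eventually (Filter.Eventually.and hw hΦ0))
  refine ⟨?_, hΦ.congr_of_eventuallyEq ?_⟩
  · filter_upwards [hnear] with q ⟨h1, h2, h3⟩ using ⟨_, _, hcurve q.2 h2 h3, h1⟩
  · filter_upwards [hnear] with q ⟨h1, h2, h3⟩ using (hcurve q.2 h2 h3).maximalFlow_eq hX h1

/-- The maximal flow is defined and `C^n` near every point of its domain. -/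
theorem maximalFlow_contMDiffAt [FiniteDimensional ℝ F]
    (hX : ContMDiff I I.tangent ∞ (fun x => (⟨x, X x⟩ : TangentBundle I N)))
    (n : ℕ) (hn : n ≠ 0) {q : ℝ × N} (hq : q ∈ flowDomain X) :
    flowDomain X ∈ 𝓝 q ∧
      ContMDiffAt (𝓘(ℝ, ℝ).prod I) I n (fun q : ℝ × N => maximalFlow X q.1 q.2) q := by
  have : CompleteSpace F := FiniteDimensional.complete ℝ F
  let G : Set (ℝ × N) := {q | flowDomain X ∈ 𝓝 q ∧
    ContMDiffAt (𝓘(ℝ, ℝ).prod I) I n (fun q : ℝ × N => maximalFlow X q.1 q.2) q}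
  -- Being `C^n` at a point spreads to a neighbourhood for finite `n` only, so the argument is run
  -- for each `n` separately.
  have hG : IsOpen G := by
    rw [isOpen_iff_mem_nhds]
    rintro q ⟨h1, h2⟩
    have h3 := (contMDiffAt_iff_contMDiffAt_nhds (by exact_mod_cast ENat.natCast_ne_top n)).1 h2
    filter_upwards [eventually_eventually_nhds.2 h1, h3] with q' a b using ⟨a, b⟩
  obtain ⟨t, p⟩ := q
  -- The times at which the orbit of `p` is good form an open set containing `0`. Since the time
  -- interval is connected, it is enough to show that this set is relatively closed.
  have hsub : {s : ℝ | (s, p) ∈ flowDomain X} ⊆ (fun s : ℝ => (s, p)) ⁻¹' G := by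
    refine (ordConnected_flowDomain_slice X p).isPreconnected.subset_of_closure_inter_subset
      (hG.preimage (by fun_prop))
      ⟨0, zero_mem_flowDomain hX p, maximalFlow_contMDiffAt_zero hX p n hn⟩ ?_
    rintro s₀ ⟨hs₀, hs₀D⟩
    -- a nearby time at which the flow is `C^n`, and from which the remaining flow is `C^n`
    have hcurve := isIntegralCurveFrom_maximalFlow hX p
    have hcont : ContinuousAt (fun s => maximalFlow X s p) s₀ :=
      hcurve.isMIntegralCurveOn.continuousOn.continuousAt (hcurve.isOpen.mem_nhds hs₀D)
    have htend : Tendsto (fun s => (s₀ - s, maximalFlow X s p)) (𝓝 s₀)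
        (𝓝 (0, maximalFlow X s₀ p)) := by
      have : ContinuousAt (fun s => (s₀ - s, maximalFlow X s p)) s₀ :=
        (by fun_prop : ContinuousAt (fun s : ℝ => s₀ - s) s₀).prodMk hcont
      simpa [ContinuousAt] using this
    have hev : ∀ᶠ s in 𝓝 s₀, (s₀ - s, maximalFlow X s p) ∈ G :=
      htend.eventually (hG.mem_nhds (maximalFlow_contMDiffAt_zero hX _ n hn))
    obtain ⟨s₁, ⟨hs₁, hs₁'⟩⟩ := mem_closure_iff_nhds.1 hs₀ _ hev
    obtain ⟨hD1, hsm1⟩ := hs₁'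
    obtain ⟨hD2, hsm2⟩ := hs₁
    -- Near `(s₀, p)` the flow factors as the flow for time `q.1 - s₁`, which is near `0`, after the
    -- time `s₁` map; both factors are `C^n` there.
    have hin : ContMDiffAt (𝓘(ℝ, ℝ).prod I) (𝓘(ℝ, ℝ).prod I) n
        (fun q : ℝ × N => (s₁, q.2)) (s₀, p) := contMDiffAt_const.prodMk contMDiffAt_snd
    have hmid : ContMDiffAt (𝓘(ℝ, ℝ).prod I) (𝓘(ℝ, ℝ).prod I) n
        (fun q : ℝ × N => (q.1 - s₁, maximalFlow X s₁ q.2)) (s₀, p) := by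
      refine ContMDiffAt.prodMk ?_ (ContMDiffAt.comp (s₀, p)
        (g := fun q : ℝ × N => maximalFlow X q.1 q.2) (f := fun q : ℝ × N => (s₁, q.2)) hsm1 hin)
      exact contMDiffAt_fst.sub contMDiffAt_const
    have e1 : ∀ᶠ q : ℝ × N in 𝓝 (s₀, p), (s₁, q.2) ∈ flowDomain X :=
      hin.continuousAt.eventually hD1
    have e2 : ∀ᶠ q : ℝ × N in 𝓝 (s₀, p), (q.1 - s₁, maximalFlow X s₁ q.2) ∈ flowDomain X :=
      hmid.continuousAt.eventually hD2
    have e3 : ∀ᶠ q : ℝ × N in 𝓝 (s₀, p), q ∈ flowDomain X := by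
      filter_upwards [e1, e2] with q h1 h2
      have := (mem_flowDomain_add_iff hX h1).1 h2
      rwa [sub_add_cancel] at this
    refine ⟨e3, ?_⟩
    refine (ContMDiffAt.comp (s₀, p) (g := fun q : ℝ × N => maximalFlow X q.1 q.2)
      (f := fun q : ℝ × N => (q.1 - s₁, maximalFlow X s₁ q.2)) hsm2 hmid).congr_of_eventuallyEq ?_
    filter_upwards [e1, e3] with q h1 h3
    have := (maximalFlow_add hX (s := q.1 - s₁) h1 (by rwa [sub_add_cancel])).2
    rwa [sub_add_cancel] at this
  exact hsub hq

/-- A smooth vector field on a Hausdorff manifold has a maximal smooth flow. -/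
theorem isFlow_maximalFlow [FiniteDimensional ℝ F]
    (hX : ContMDiff I I.tangent ∞ (fun x => (⟨x, X x⟩ : TangentBundle I N))) :
    IsFlow I X (flowDomain X) (maximalFlow X) := by
  have : CompleteSpace F := FiniteDimensional.complete ℝ F
  exact
  { isOpen := isOpen_iff_mem_nhds.2 fun q hq => (maximalFlow_contMDiffAt hX 1 one_ne_zero hq).1
    zero_mem := zero_mem_flowDomain hX
    ordConnected := ordConnected_flowDomain_slice X
    smooth := by
      -- The order `n + 1` is used because order `0` is excluded in `maximalFlow_contMDiffAt`.
      refine contMDiffOn_infty.2 fun n q hq => ?_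
      exact (((maximalFlow_contMDiffAt hX (n + 1) n.succ_ne_zero hq).2).of_le
        (by exact_mod_cast n.le_succ)).contMDiffWithinAt
    map_zero := fun p => (isIntegralCurveFrom_maximalFlow hX p).map_zero
    mem_add_iff := fun s r p hr => mem_flowDomain_add_iff hX hr
    map_add := fun s r p hr hs => (maximalFlow_add hX hr hs).2
    generator := fun p => (isIntegralCurveFrom_maximalFlow hX p).isMIntegralCurveOn
    maximal := fun p γ J h1 h2 h3 h4 h5 s hs => ⟨γ, J, ⟨h1, h2, h3, h4, h5⟩, hs⟩ }

end MaximalFlow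

/-! ### Forms preserved by a flow -/

section FlowInvariance

open Filter Topology

/-- The variational equation at time `0`. -/
theorem hasDerivAt_fderiv_flow {F : Type*} [NormedAddCommGroup F] [NormedSpace ℝ F]
    {Φ : ℝ × F → F} {y₀ : F} {χ : F → F} (hΦ : ContDiffAt ℝ 2 Φ (0, y₀))
    (h : ∀ᶠ y in 𝓝 y₀, HasDerivAt (fun r => Φ (r, y)) (χ y) 0) (u : F) :
    HasDerivAt (fun r => fderiv ℝ (fun y => Φ (r, y)) y₀ u) (fderiv ℝ χ y₀ u) 0 := by
  have hA : DifferentiableAt ℝ (fderiv ℝ Φ) (0, y₀) :=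
    (hΦ.fderiv_right (m := 1) (by norm_num)).differentiableAt one_ne_zero
  set A' := fderiv ℝ (fderiv ℝ Φ) (0, y₀) with hA'
  have hd : ∀ᶠ q in 𝓝 ((0 : ℝ), y₀), DifferentiableAt ℝ Φ q := by
    filter_upwards [hΦ.eventually (by simp)] with q hq using hq.differentiableAt (by simp)
  -- Symmetry of the second derivative of `Φ` exchanges `∂/∂r` with the derivative in the initial
  -- point; this is the whole content of the variational equation.
  have hsymm : A' (1, 0) (0, u) = A' (0, u) (1, 0) :=
    (hΦ.isSymmSndFDerivAt (by simp)) (1, 0) (0, u)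
  have hT1 : Tendsto (fun r : ℝ => (r, y₀)) (𝓝 0) (𝓝 (0, y₀)) :=
    Continuous.tendsto (by fun_prop) _
  have hT2 : Tendsto (fun y : F => ((0 : ℝ), y)) (𝓝 y₀) (𝓝 (0, y₀)) :=
    Continuous.tendsto (by fun_prop) _
  have h1 : HasDerivAt (fun r : ℝ => fderiv ℝ Φ (r, y₀) (0, u)) (A' (1, 0) (0, u)) 0 := by
    have hl : HasDerivAt (fun r : ℝ => (r, y₀)) ((1 : ℝ), (0 : F)) 0 :=
      (hasDerivAt_id 0).prodMk (hasDerivAt_const 0 y₀)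
    have := (hA.hasFDerivAt.comp_hasDerivAt (f := fun r : ℝ => (r, y₀)) 0 hl)
    simpa using this.clm_apply (hasDerivAt_const (0 : ℝ) ((0 : ℝ), u))
  have h2 : (fun r => fderiv ℝ (fun y => Φ (r, y)) y₀ u) =ᶠ[𝓝 0]
      fun r : ℝ => fderiv ℝ Φ (r, y₀) (0, u) := by
    filter_upwards [hT1.eventually hd] with r hr
    have := hr.hasFDerivAt.comp (f := fun y : F => (r, y)) y₀ (hasFDerivAt_prodMk_right r y₀)
    change fderiv ℝ (Φ ∘ fun y : F => (r, y)) y₀ u = _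
    rw [this.fderiv]
    rfl
  have h3 : HasFDerivAt χ (ContinuousLinearMap.flip A' (1, 0) ∘L .inr ℝ ℝ F) y₀ := by
    have hq : HasFDerivAt (fun y : F => fderiv ℝ Φ (0, y) (1, 0))
        (ContinuousLinearMap.flip A' (1, 0) ∘L .inr ℝ ℝ F) y₀ := by
      have := (hA.hasFDerivAt.comp (f := fun y : F => ((0 : ℝ), y)) y₀
        (hasFDerivAt_prodMk_right (0 : ℝ) y₀)).clm_apply
          (hasFDerivAt_const ((1 : ℝ), (0 : F)) y₀)
      refine this.congr_fderiv ?_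
      ext v
      simp [hA']
    refine hq.congr_of_eventuallyEq ?_
    filter_upwards [hT2.eventually hd, h] with y hy hy'
    have hl : HasDerivAt (fun r : ℝ => (r, y)) ((1 : ℝ), (0 : F)) 0 :=
      (hasDerivAt_id 0).prodMk (hasDerivAt_const 0 y)
    exact hy'.unique (hy.hasFDerivAt.comp_hasDerivAt (f := fun r : ℝ => (r, y)) 0 hl)
  rw [h3.fderiv]
  have : (ContinuousLinearMap.flip A' (1, 0) ∘L .inr ℝ ℝ F) u = A' (1, 0) (0, u) := by
    rw [hsymm]; rfl
  rw [this]
  exact h1.congr_of_eventuallyEq h2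

variable {F : Type*} [NormedAddCommGroup F] [NormedSpace ℝ F]
  {H : Type*} [TopologicalSpace H] {I : ModelWithCorners ℝ F H}
  {N : Type*} [TopologicalSpace N] [ChartedSpace H N]
  {X : (x : N) → TangentSpace I x} {D : Set (ℝ × N)} {Ψ : ℝ → N → N}

theorem IsFlow.neg_mem (h : IsFlow I X D Ψ) {s : ℝ} {x : N} (hs : (s, x) ∈ D) :
    (-s, Ψ s x) ∈ D := by
  rw [h.mem_add_iff _ _ _ hs, neg_add_cancel]
  exact h.zero_mem x

theorem IsFlow.neg_apply (h : IsFlow I X D Ψ) {s : ℝ} {x : N} (hs : (s, x) ∈ D) :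
    Ψ (-s) (Ψ s x) = x := by
  have := h.map_add (-s) s x hs (by rw [neg_add_cancel]; exact h.zero_mem x)
  rw [← this, neg_add_cancel, h.map_zero]

theorem IsFlow.isOpen_slice (h : IsFlow I X D Ψ) (s : ℝ) : IsOpen {x | (s, x) ∈ D} :=
  h.isOpen.preimage (by fun_prop)

theorem IsFlow.contMDiffOn_slice (h : IsFlow I X D Ψ) (s : ℝ) :
    ContMDiffOn I I ∞ (Ψ s) {x | (s, x) ∈ D} :=
  h.smooth.comp (f := fun x : N => (s, x)) (contMDiff_const.prodMk contMDiff_id).contMDiffOn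
    fun _ hx => hx

theorem IsFlow.mdifferentiableAt (h : IsFlow I X D Ψ) {s : ℝ} {x : N} (hs : (s, x) ∈ D) :
    MDifferentiableAt I I (Ψ s) x :=
  ((h.contMDiffOn_slice s).contMDiffAt ((h.isOpen_slice s).mem_nhds hs)).mdifferentiableAt
    (by simp)

/-- The time `s` map of a flow is a diffeomorphism onto the domain of the time `-s` map. -/
theorem IsFlow.isDiffeoOn (h : IsFlow I X D Ψ) (s : ℝ) :
    IsDiffeoOn I {x | (s, x) ∈ D} {x | (-s, x) ∈ D} (Ψ s) := by
  refine ⟨h.isOpen_slice s, h.isOpen_slice (-s), fun x hx => h.neg_mem hx,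
    h.contMDiffOn_slice s, Ψ (-s), fun x hx => ?_, h.contMDiffOn_slice (-s),
    fun x hx => h.neg_apply hx, fun x hx => ?_⟩
  · simpa using h.neg_mem hx
  · simpa using h.neg_apply hx

/-- The expression of a form in the chart around `x₀`, for an arbitrary model. -/
noncomputable def DForm.chartRep {k : ℕ} (α : DForm I N k) (x₀ : N) : F → F [⋀^Fin k]→L[ℝ] ℝ :=
  DForm.pullback 𝓘(ℝ, F) (extChartAt I x₀).symm α

/-- The value of a form, computed in a chart. -/
theorem DForm.apply_eq_inChart [I.Boundaryless] [IsManifold I 1 N] {k : ℕ} (α : DForm I N k)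
    {x₀ z : N} (hz : z ∈ (extChartAt I x₀).source) (v : Fin k → TangentSpace I z) :
    α z v = α.chartRep x₀ (extChartAt I x₀ z)
      (fun i => mfderiv I 𝓘(ℝ, F) (extChartAt I x₀) z (v i)) := by
  have hinv := mfderivWithin_extChartAt_symm_comp_mfderiv_extChartAt' (I := I) hz
  rw [I.range_eq_univ, mfderivWithin_univ] at hinv
  -- The type of `α z'` depends on `z'`, so an equality of base points is used only after both forms
  -- are read on the common fibre `F`.
  have hc : ∀ (z' : N) (_ : z' = z) (w : Fin k → F),
      (α z' : F [⋀^Fin k]→L[ℝ] ℝ) w = (α z : F [⋀^Fin k]→L[ℝ] ℝ) w := by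
    rintro _ rfl w; rfl
  refine (hc _ ((extChartAt I x₀).left_inv hz) _).symm.trans ?_
  change (α ((extChartAt I x₀).symm (extChartAt I x₀ z)) : F [⋀^Fin k]→L[ℝ] ℝ) v =
    (α ((extChartAt I x₀).symm (extChartAt I x₀ z)) : F [⋀^Fin k]→L[ℝ] ℝ)
      (fun i => mfderiv 𝓘(ℝ, F) I (extChartAt I x₀).symm (extChartAt I x₀ z)
        (mfderiv I 𝓘(ℝ, F) (extChartAt I x₀) z (v i)))
  congr 1
  funext i
  exact (congrArg (fun L => L (v i)) hinv).symm

theorem DForm.chartRep_self [I.Boundaryless] [IsManifold I 1 N] {k : ℕ} (α : DForm I N k) (p : N) :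
    α.chartRep p (extChartAt I p p) = (α p : F [⋀^Fin k]→L[ℝ] ℝ) := by
  ext v
  have := DForm.apply_eq_inChart α (mem_extChartAt_source (I := I) p) v
  rw [mfderiv_extChartAt_self] at this
  exact this.symm

/-- The derivative of `Ψ_r^* α` at `r = 0`, in the chart around the point. -/
theorem IsFlow.hasDerivAt_pullback_zero [I.Boundaryless] [IsManifold I ∞ N]
    (h : IsFlow I X D Ψ) {k : ℕ} (α : DForm I N k) (p : N)
    (hα : DifferentiableAt ℝ (α.chartRep p) (extChartAt I p p)) (w : Fin k → F) :
    HasDerivAt (fun r => (DForm.pullback I (Ψ r) α p : F [⋀^Fin k]→L[ℝ] ℝ) w)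
      (fderiv ℝ (α.chartRep p) (extChartAt I p p) (X p) w +
        ∑ i, (α p : F [⋀^Fin k]→L[ℝ] ℝ) (update w i
          (fderiv ℝ (vectorFieldInChart I X p) (extChartAt I p p) (w i)))) 0 := by
  set φ := extChartAt I p with hφ
  set y₀ : F := φ p with hy₀
  set a : F → F [⋀^Fin k]→L[ℝ] ℝ := α.chartRep p with ha
  set χ := vectorFieldInChart I X p with hχ
  have hto : IsOpen φ.target := isOpen_extChartAt_target p
  have hyt : y₀ ∈ φ.target := mem_extChartAt_target p
  have hsym : φ.symm y₀ = p := extChartAt_to_inv p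
  let Φ : ℝ × F → F := fun q => φ (Ψ q.1 (φ.symm q.2))
  have hsymm_cont : ContMDiffAt 𝓘(ℝ, F) I ∞ φ.symm y₀ :=
    (contMDiffOn_extChartAt_symm (I := I) (n := ∞) p).contMDiffAt (hto.mem_nhds hyt)
  have hφ_cont : ContMDiffAt I 𝓘(ℝ, F) ∞ φ p := contMDiffAt_extChartAt
  have hΦ : ContDiffAt ℝ 2 Φ (0, y₀) := by
    have h1 : ContMDiffAt 𝓘(ℝ, ℝ × F) (𝓘(ℝ, ℝ).prod I) ∞ (fun q : ℝ × F => (q.1, φ.symm q.2))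
        (0, y₀) :=
      contDiffAt_fst.contMDiffAt.prodMk
        (ContMDiffAt.comp (I' := 𝓘(ℝ, F)) (0, y₀) (g := φ.symm) (f := Prod.snd) hsymm_cont
          contDiffAt_snd.contMDiffAt)
    have h2 : ContMDiffAt (𝓘(ℝ, ℝ).prod I) I ∞ (fun q : ℝ × N => Ψ q.1 q.2)
        ((0 : ℝ), φ.symm y₀) :=
      h.smooth.contMDiffAt (h.isOpen.mem_nhds (h.zero_mem _))
    have h3 : ContMDiffAt 𝓘(ℝ, ℝ × F) I ∞ (fun q : ℝ × F => Ψ q.1 (φ.symm q.2)) (0, y₀) :=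
      ContMDiffAt.comp (I' := 𝓘(ℝ, ℝ).prod I) (0, y₀) (g := fun q : ℝ × N => Ψ q.1 q.2)
        (f := fun q : ℝ × F => (q.1, φ.symm q.2)) h2 h1
    have h4 : ContMDiffAt 𝓘(ℝ, ℝ × F) 𝓘(ℝ, F) ∞ Φ (0, y₀) := by
      refine ContMDiffAt.comp (I' := I) (0, y₀) (g := φ)
        (f := fun q : ℝ × F => Ψ q.1 (φ.symm q.2)) ?_ h3
      change ContMDiffAt I 𝓘(ℝ, F) ∞ φ (Ψ 0 (φ.symm y₀))
      rw [h.map_zero, hsym]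
      exact hφ_cont
    exact h4.contDiffAt.of_le (WithTop.coe_le_coe.2 le_top)
  have hgen : ∀ z, HasMFDerivAt 𝓘(ℝ, ℝ) I (fun r => Ψ r z) 0
      ((1 : ℝ →L[ℝ] ℝ).smulRight (X (Ψ 0 z))) := fun z =>
    (h.generator z 0 (h.zero_mem z)).hasMFDerivAt
      ((h.isOpen.preimage (by fun_prop : Continuous fun s : ℝ => (s, z))).mem_nhds (h.zero_mem z))
  have hder : ∀ᶠ y in 𝓝 y₀, HasDerivAt (fun r => Φ (r, y)) (χ y) 0 := by
    filter_upwards [hto.mem_nhds hyt] with y hy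
    have hsrc : φ.symm y ∈ φ.source := φ.map_target hy
    have h1 : HasMFDerivAt I 𝓘(ℝ, F) φ (Ψ 0 (φ.symm y))
        (mfderiv I 𝓘(ℝ, F) φ (Ψ 0 (φ.symm y))) := by
      rw [h.map_zero]
      exact (mdifferentiableAt_extChartAt (by rwa [extChartAt_source] at hsrc)).hasMFDerivAt
    have h2 : HasFDerivAt (fun r => Φ (r, y)) (_ : ℝ →L[ℝ] F) 0 :=
      (h1.comp 0 (hgen (φ.symm y))).hasFDerivAt
    refine h2.hasDerivAt.congr_deriv ?_
    change mfderiv I 𝓘(ℝ, F) φ (Ψ 0 (φ.symm y)) ((1 : ℝ) • X (Ψ 0 (φ.symm y))) = _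
    rw [one_smul, h.map_zero]
    rfl
  have hvar := hasDerivAt_fderiv_flow hΦ hder
  have hΦ0 : Φ (0, y₀) = y₀ := by
    change φ (Ψ 0 (φ.symm y₀)) = y₀
    rw [h.map_zero, hsym]
  have hχ0 : χ y₀ = X p := vectorFieldInChart_self X p
  -- At `r = 0` the flow has identity differential, so the product rule leaves the derivative of the
  -- coefficients plus one term per slot: the coordinate expression of the Lie derivative.
  have hid : fderiv ℝ (fun y => Φ (0, y)) y₀ = ContinuousLinearMap.id ℝ F := by
    have : (fun y => Φ (0, y)) =ᶠ[𝓝 y₀] id := by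
      filter_upwards [hto.mem_nhds hyt] with y hy
      change φ (Ψ 0 (φ.symm y)) = y
      rw [h.map_zero, φ.right_inv hy]
    rw [this.fderiv_eq, fderiv_id]
  have ha0 : a y₀ = (α p : F [⋀^Fin k]→L[ℝ] ℝ) := α.chartRep_self p
  -- the form evaluated along the flow, in the chart
  have hmain : HasDerivAt (fun r => a (Φ (r, y₀)) fun i => fderiv ℝ (fun y => Φ (r, y)) y₀ (w i))
      (fderiv ℝ a y₀ (X p) w + ∑ i, (α p : F [⋀^Fin k]→L[ℝ] ℝ)
        (update w i (fderiv ℝ χ y₀ (w i)))) 0 := by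
    have hc : HasDerivAt (fun r => Φ (r, y₀)) (X p) 0 := by
      rw [← hχ0]; exact hder.self_of_nhds
    have hα' : HasFDerivAt a (fderiv ℝ a y₀) (Φ (0, y₀)) := by
      rw [hΦ0]; exact hα.hasFDerivAt
    have h1 := (hα'.comp_hasDerivAt (f := fun r => Φ (r, y₀)) 0 hc).hasFDerivAt
    have h2 := (h1.continuousAlternatingMap_apply
      (fun i => (hvar (w i)).hasFDerivAt)).hasDerivAt
    refine h2.congr_deriv ?_
    simp [hid, hΦ0, ha0]
    rfl
  refine hmain.congr_of_eventuallyEq ?_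
  have hD : ∀ᶠ r : ℝ in 𝓝 0, (r, p) ∈ D :=
    (h.isOpen.preimage (by fun_prop : Continuous fun s : ℝ => (s, p))).mem_nhds (h.zero_mem p)
  have hsrc : ∀ᶠ r : ℝ in 𝓝 0, Ψ r p ∈ φ.source := by
    have : ContinuousAt (fun r => Ψ r p) 0 := (hgen p).continuousAt
    refine this.eventually (p := (· ∈ φ.source)) ?_
    change φ.source ∈ 𝓝 (Ψ 0 p)
    rw [h.map_zero]
    exact extChartAt_source_mem_nhds p
  filter_upwards [hD, hsrc] with r hr hr'
  refine (DForm.apply_eq_inChart α hr' _).trans ?_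
  change a (φ (Ψ r p)) _ = a (φ (Ψ r (φ.symm y₀))) _
  rw [hsym]
  congr 1
  funext i
  have h1 : HasMFDerivAt 𝓘(ℝ, F) I φ.symm y₀ (ContinuousLinearMap.id ℝ F) := by
    have := (hsymm_cont.mdifferentiableAt (by simp)).hasMFDerivAt
    have h2 := mfderivWithin_range_extChartAt_symm (I := I) (x := p)
    rw [I.range_eq_univ, mfderivWithin_univ] at h2
    exact this.congr_mfderiv h2
  have h2 : HasMFDerivAt I I (Ψ r) (φ.symm y₀) (mfderiv I I (Ψ r) p) := by
    rw [hsym]; exact (h.mdifferentiableAt hr).hasMFDerivAt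
  have h3 : HasMFDerivAt I 𝓘(ℝ, F) φ (Ψ r (φ.symm y₀)) (mfderiv I 𝓘(ℝ, F) φ (Ψ r p)) := by
    rw [hsym]
    exact (mdifferentiableAt_extChartAt (by rwa [extChartAt_source] at hr')).hasMFDerivAt
  have h4 : HasFDerivAt (fun y => Φ (r, y)) (_ : F →L[ℝ] F) y₀ :=
    (h3.comp y₀ (h2.comp y₀ h1)).hasFDerivAt
  rw [h4.fderiv]
  rfl

/-- A form whose Lie derivative vanishes is preserved by the flow. The Lie derivative at a point
is computed in the chart around the point. -/
theorem IsFlow.pullback_eq [I.Boundaryless] [IsManifold I ∞ N]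
    (h : IsFlow I X D Ψ) {k : ℕ} (α : DForm I N k)
    (hα : ∀ p, DifferentiableAt ℝ (α.chartRep p) (extChartAt I p p))
    (hL : ∀ (p : N) (w : Fin k → F),
      fderiv ℝ (α.chartRep p) (extChartAt I p p) (X p) w +
        ∑ i, (α p : F [⋀^Fin k]→L[ℝ] ℝ) (update w i
          (fderiv ℝ (vectorFieldInChart I X p) (extChartAt I p p) (w i))) = 0)
    {s : ℝ} {x : N} (hs : (s, x) ∈ D) : DForm.pullback I (Ψ s) α x = α x := by
  ext w
  set g : ℝ → ℝ := fun s => (DForm.pullback I (Ψ s) α x : F [⋀^Fin k]→L[ℝ] ℝ) w with hg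
  have hJ : IsOpen {s : ℝ | (s, x) ∈ D} := h.isOpen.preimage (by fun_prop)
  -- Near `x` one has `Ψ s = Ψ (s - s₀) ∘ Ψ s₀`. The derivative of the pullback at `s₀` is therefore
  -- the derivative at time `0` at the point `p = Ψ s₀ x`, on the transported vectors, and vanishes
  -- by hypothesis.
  have hder : ∀ s ∈ {s : ℝ | (s, x) ∈ D}, HasDerivAt g 0 s := by
    intro s₀ hs₀
    set p := Ψ s₀ x with hp
    set w' : Fin k → F := fun i => mfderiv I I (Ψ s₀) x (w i) with hw'
    have h0 := h.hasDerivAt_pullback_zero α p (hα p) w'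
    rw [hL] at h0
    have h1 : HasDerivAt (fun s : ℝ => (DForm.pullback I (Ψ (s - s₀)) α p :
        F [⋀^Fin k]→L[ℝ] ℝ) w') 0 s₀ := by
      have := HasDerivAt.comp_sub_const (x := s₀) (a := s₀) (by rwa [sub_self])
        (f := fun r => (DForm.pullback I (Ψ r) α p : F [⋀^Fin k]→L[ℝ] ℝ) w') (f' := 0)
      exact this
    refine h1.congr_of_eventuallyEq ?_
    filter_upwards [hJ.mem_nhds hs₀] with s hs
    have hsx : (s - s₀ + s₀, x) ∈ D := by rwa [sub_add_cancel]
    have hm : (s - s₀, p) ∈ D := (h.mem_add_iff (s - s₀) s₀ x hs₀).2 hsx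
    have heq : Ψ s =ᶠ[𝓝 x] Ψ (s - s₀) ∘ Ψ s₀ := by
      filter_upwards [(h.isOpen_slice s).mem_nhds hs, (h.isOpen_slice s₀).mem_nhds hs₀]
        with z hz hz'
      have := h.map_add (s - s₀) s₀ z hz' (by rwa [sub_add_cancel])
      rwa [sub_add_cancel] at this
    have hd : HasMFDerivAt I I (Ψ s) x (mfderiv I I (Ψ (s - s₀)) p ∘L mfderiv I I (Ψ s₀) x) :=
      ((h.mdifferentiableAt hm).hasMFDerivAt.comp x
        (h.mdifferentiableAt hs₀).hasMFDerivAt).congr_of_eventuallyEq heq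
    have hpt : Ψ s x = Ψ (s - s₀) p := heq.self_of_nhds
    change (α (Ψ s x) : F [⋀^Fin k]→L[ℝ] ℝ) (fun i => mfderiv I I (Ψ s) x (w i)) =
      (α (Ψ (s - s₀) p) : F [⋀^Fin k]→L[ℝ] ℝ) (fun i => mfderiv I I (Ψ (s - s₀)) p (w' i))
    rw [hd.mfderiv, hpt]
    rfl
  have hconst : g s = g 0 := by
    refine hJ.is_const_of_deriv_eq_zero (h.ordConnected x).isPreconnected
      (fun r hr => (hder r hr).differentiableAt.differentiableWithinAt)
      (fun r hr => (hder r hr).deriv) hs (h.zero_mem x)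
  refine hconst.trans ?_
  have h0 : Ψ 0 = id := funext h.map_zero
  simp only [hg, h0]
  change (α x : F [⋀^Fin k]→L[ℝ] ℝ) (fun i => mfderiv I I id x (w i)) = _
  rw [mfderiv_id]
  rfl

end FlowInvariance

/-! ### Alternating forms of degree one and two -/

section LowDegree

variable {E : Type*} [NormedAddCommGroup E] [NormedSpace ℝ E]

/-- The bilinear map of an alternating 2-form. -/
noncomputable def altTwoBilin : (E [⋀^Fin 2]→L[ℝ] ℝ) →L[ℝ] E →L[ℝ] E →L[ℝ] ℝ :=
  (ContinuousLinearMap.compL ℝ E _ (E →L[ℝ] ℝ)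
    (continuousMultilinearCurryFin1 ℝ E ℝ).toContinuousLinearEquiv.toContinuousLinearMap) ∘L
  (continuousMultilinearCurryLeftEquiv ℝ (fun _ : Fin 2 => E)
    ℝ).toContinuousLinearEquiv.toContinuousLinearMap ∘L
  ContinuousAlternatingMap.toContinuousMultilinearMapCLM ℝ

/-- The linear map of an alternating 1-form. -/
noncomputable def altOneLin : (E [⋀^Fin 1]→L[ℝ] ℝ) →L[ℝ] E →L[ℝ] ℝ :=
  (ContinuousAlternatingMap.ofSubsingletonLIE (𝕜 := ℝ) (E := E) (F := ℝ)
    (0 : Fin 1)).symm.toContinuousLinearEquiv.toContinuousLinearMap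

theorem altTwoBilin_apply (η : E [⋀^Fin 2]→L[ℝ] ℝ) (u v : E) :
    altTwoBilin η u v = η ![u, v] := by
  change η _ = _
  congr 1
  ext i
  fin_cases i <;> rfl

theorem altOneLin_apply (α : E [⋀^Fin 1]→L[ℝ] ℝ) (v : E) : altOneLin α v = α ![v] := by
  change α _ = _
  congr 1
  ext i
  fin_cases i
  rfl

theorem altTwoBilin_swap (η : E [⋀^Fin 2]→L[ℝ] ℝ) (u v : E) :
    altTwoBilin η u v = -altTwoBilin η v u := by
  rw [altTwoBilin_apply, altTwoBilin_apply]
  have : η (![v, u] ∘ Equiv.swap 0 1) = -η ![v, u] :=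
    η.toAlternatingMap.map_swap ![v, u] (i := 0) (j := 1) (by decide)
  rw [← this]
  congr 1
  ext i
  fin_cases i <;> rfl

theorem altTwo_eq_vecCons (η : E [⋀^Fin 2]→L[ℝ] ℝ) (w : Fin 2 → E) :
    η w = altTwoBilin η (w 0) (w 1) := by
  rw [altTwoBilin_apply]
  congr 1
  ext i
  fin_cases i <;> rfl

theorem altOne_eq_vecCons (α : E [⋀^Fin 1]→L[ℝ] ℝ) (w : Fin 1 → E) :
    α w = altOneLin α (w 0) := by
  rw [altOneLin_apply]
  congr 1
  ext i
  fin_cases i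
  rfl

/-- Both `extDeriv` and `linWedge` are alternatizations, so this formula and its degree-two analogue
make both sides of `dΩ = θ ∧ Ω` explicit with the same signs. -/
theorem alternatizeUncurryFin_one_apply (A : E →L[ℝ] E [⋀^Fin 1]→L[ℝ] ℝ) (u v : E) :
    ContinuousAlternatingMap.alternatizeUncurryFin A ![u, v] =
      altOneLin (A u) v - altOneLin (A v) u := by
  rw [ContinuousAlternatingMap.alternatizeUncurryFin_apply, Fin.sum_univ_two,
    altOne_eq_vecCons, altOne_eq_vecCons]
  simp [Fin.removeNth, sub_eq_add_neg]

theorem alternatizeUncurryFin_two_apply (A : E →L[ℝ] E [⋀^Fin 2]→L[ℝ] ℝ) (u v w : E) :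
    ContinuousAlternatingMap.alternatizeUncurryFin A ![u, v, w] =
      altTwoBilin (A u) v w - altTwoBilin (A v) u w + altTwoBilin (A w) u v := by
  rw [ContinuousAlternatingMap.alternatizeUncurryFin_apply, Fin.sum_univ_three,
    altTwo_eq_vecCons, altTwo_eq_vecCons, altTwo_eq_vecCons]
  simp [Fin.removeNth, Fin.succAbove, sub_eq_add_neg]

theorem linWedge_one_apply (α η : E [⋀^Fin 1]→L[ℝ] ℝ) (u v : E) :
    linWedge α η ![u, v] = altOneLin α u * altOneLin η v - altOneLin α v * altOneLin η u := by
  rw [linWedge, alternatizeUncurryFin_one_apply]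
  simp [altOneLin]

theorem linWedge_two_apply (α : E [⋀^Fin 1]→L[ℝ] ℝ) (η : E [⋀^Fin 2]→L[ℝ] ℝ) (u v w : E) :
    linWedge α η ![u, v, w] = altOneLin α u * altTwoBilin η v w -
      altOneLin α v * altTwoBilin η u w + altOneLin α w * altTwoBilin η u v := by
  rw [linWedge, alternatizeUncurryFin_two_apply]
  simp [altOneLin]

/-- The bilinear map of a nondegenerate 2-form is an isomorphism onto the dual. -/
theorem altTwoBilin_isInvertible [FiniteDimensional ℝ E] {η : E [⋀^Fin 2]→L[ℝ] ℝ}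
    (h : ∀ v, (∀ w, altTwoBilin η v w = 0) → v = 0) : (altTwoBilin η).IsInvertible := by
  have hinj : Injective (altTwoBilin η) := by
    rw [injective_iff_map_eq_zero]
    intro v hv
    exact h v fun w => by rw [hv]; rfl
  have hdim : Module.finrank ℝ E = Module.finrank ℝ (E →L[ℝ] ℝ) := by
    rw [← (LinearMap.toContinuousLinearMap (𝕜 := ℝ) (E := E) (F' := ℝ)).finrank_eq]
    exact Subspace.dual_finrank_eq.symm
  exact ⟨(LinearMap.linearEquivOfInjective (altTwoBilin η).toLinearMap hinj
    hdim).toContinuousLinearEquiv, by ext v; rfl⟩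

end LowDegree

/-! ### Locally conformal symplectic structures in charts -/

section LCSChart

open Filter Topology

variable {E : Type*} [NormedAddCommGroup E] [NormedSpace ℝ E]
  {M : Type*} [TopologicalSpace M] [ChartedSpace E M]

/-- A time-dependent function, in the chart of `M` around `x₀`. -/
noncomputable def timeFunInChart (f : ℝ × M → ℝ) (x₀ : M) (z : ℝ × E) : ℝ :=
  f (z.1, (extChartAt 𝓘(ℝ, E) x₀).symm z.2)

theorem univ_prod_target_mem_nhds [IsManifold 𝓘(ℝ, E) ∞ M] {x₀ : M} {z : ℝ × E}
    (hz : z.2 ∈ (extChartAt 𝓘(ℝ, E) x₀).target) :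
    univ ×ˢ (extChartAt 𝓘(ℝ, E) x₀).target ∈ 𝓝 z :=
  (isOpen_univ.prod (isOpen_extChartAt_target x₀)).mem_nhds ⟨mem_univ _, hz⟩

section

variable [IsManifold 𝓘(ℝ, E) ∞ M] {x₀ : M}

theorem hasMFDerivAt_extChartAt_symm {y : E} (hy : y ∈ (extChartAt 𝓘(ℝ, E) x₀).target) :
    HasMFDerivAt 𝓘(ℝ, E) 𝓘(ℝ, E) (extChartAt 𝓘(ℝ, E) x₀).symm y
      (mfderiv 𝓘(ℝ, E) 𝓘(ℝ, E) (extChartAt 𝓘(ℝ, E) x₀).symm y) :=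
  (((contMDiffOn_extChartAt_symm (I := 𝓘(ℝ, E)) (n := ∞) x₀).contMDiffAt
    ((isOpen_extChartAt_target x₀).mem_nhds hy)).mdifferentiableAt (by simp)).hasMFDerivAt

theorem mfderiv_symm_comp_mfderiv {y : E} (hy : y ∈ (extChartAt 𝓘(ℝ, E) x₀).target)
    (v : TangentSpace 𝓘(ℝ, E) ((extChartAt 𝓘(ℝ, E) x₀).symm y)) :
    mfderiv 𝓘(ℝ, E) 𝓘(ℝ, E) (extChartAt 𝓘(ℝ, E) x₀).symm y
      (mfderiv 𝓘(ℝ, E) 𝓘(ℝ, E) (extChartAt 𝓘(ℝ, E) x₀) ((extChartAt 𝓘(ℝ, E) x₀).symm y) v) =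
      v := by
  have hinv := mfderivWithin_extChartAt_symm_comp_mfderiv_extChartAt (I := 𝓘(ℝ, E)) hy
  rw [ModelWithCorners.range_eq_univ, mfderivWithin_univ] at hinv
  exact congrArg (fun L => L v) hinv

theorem mfderiv_comp_mfderiv_symm {y : E} (hy : y ∈ (extChartAt 𝓘(ℝ, E) x₀).target) (v : E) :
    mfderiv 𝓘(ℝ, E) 𝓘(ℝ, E) (extChartAt 𝓘(ℝ, E) x₀) ((extChartAt 𝓘(ℝ, E) x₀).symm y)
      (mfderiv 𝓘(ℝ, E) 𝓘(ℝ, E) (extChartAt 𝓘(ℝ, E) x₀).symm y v) = v := by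
  have hinv := mfderiv_extChartAt_comp_mfderivWithin_extChartAt_symm (I := 𝓘(ℝ, E)) hy
  rw [ModelWithCorners.range_eq_univ, mfderivWithin_univ] at hinv
  exact congrArg (fun L => L v) hinv

theorem contDiffOn_timeFunInChart {f : ℝ × M → ℝ} (hf : ContMDiff (extModel E) 𝓘(ℝ, ℝ) ∞ f)
    (x₀ : M) :
    ContDiffOn ℝ ∞ (timeFunInChart f x₀ : ℝ × E → ℝ)
      (univ ×ˢ (extChartAt 𝓘(ℝ, E) x₀).target) := by
  rw [← contMDiffOn_iff_contDiffOn]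
  have h1 : ContMDiffOn 𝓘(ℝ, ℝ × E) (extModel E) ∞
      (fun z : ℝ × E => (z.1, (extChartAt 𝓘(ℝ, E) x₀).symm z.2))
      (univ ×ˢ (extChartAt 𝓘(ℝ, E) x₀).target) :=
    contDiff_fst.contMDiff.contMDiffOn.prodMk
      (ContMDiffOn.comp (I' := 𝓘(ℝ, E)) (g := (extChartAt 𝓘(ℝ, E) x₀).symm) (f := Prod.snd)
        (contMDiffOn_extChartAt_symm (I := 𝓘(ℝ, E)) (n := ∞) x₀)
        contDiff_snd.contMDiff.contMDiffOn fun z hz => hz.2)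
  exact hf.comp_contMDiffOn h1

theorem contDiffAt_timeFunInChart {f : ℝ × M → ℝ} (hf : ContMDiff (extModel E) 𝓘(ℝ, ℝ) ∞ f)
    {z : ℝ × E} (hz : z.2 ∈ (extChartAt 𝓘(ℝ, E) x₀).target) :
    ContDiffAt ℝ ∞ (timeFunInChart f x₀) z :=
  (contDiffOn_timeFunInChart hf x₀).contDiffAt (univ_prod_target_mem_nhds hz)

theorem fderiv_timeFunInChart_snd {f : ℝ × M → ℝ} (hf : ContMDiff (extModel E) 𝓘(ℝ, ℝ) ∞ f)
    {z : ℝ × E} (hz : z.2 ∈ (extChartAt 𝓘(ℝ, E) x₀).target) (u : E) :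
    fderiv ℝ (timeFunInChart f x₀) z (0, u) =
      mfderiv 𝓘(ℝ, E) 𝓘(ℝ, ℝ) (fun m => f (z.1, m)) ((extChartAt 𝓘(ℝ, E) x₀).symm z.2)
        (mfderiv 𝓘(ℝ, E) 𝓘(ℝ, E) (extChartAt 𝓘(ℝ, E) x₀).symm z.2 u) := by
  have h1 : HasFDerivAt (fun y : E => timeFunInChart f x₀ (z.1, y))
      (fderiv ℝ (timeFunInChart f x₀) z ∘L .inr ℝ ℝ E) z.2 :=
    (((contDiffAt_timeFunInChart hf hz).differentiableAt (by simp)).hasFDerivAt).comp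
      (f := fun y : E => (z.1, y)) z.2 (hasFDerivAt_prodMk_right z.1 z.2)
  have h2 : ContMDiff 𝓘(ℝ, E) 𝓘(ℝ, ℝ) ∞ (fun m => f (z.1, m)) :=
    hf.comp (contMDiff_const.prodMk contMDiff_id)
  have h3 := (((h2 _).mdifferentiableAt (by simp)).hasMFDerivAt.comp z.2
    (hasMFDerivAt_extChartAt_symm hz)).hasFDerivAt
  have h4 := h1.unique h3
  exact congrArg (fun L : E →L[ℝ] ℝ => L u) h4

theorem fderiv_timeFunInChart_fst {f : ℝ × M → ℝ} (hf : ContMDiff (extModel E) 𝓘(ℝ, ℝ) ∞ f)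
    {z : ℝ × E} (hz : z.2 ∈ (extChartAt 𝓘(ℝ, E) x₀).target) :
    fderiv ℝ (timeFunInChart f x₀) z (1, 0) =
      timeDeriv f (z.1, (extChartAt 𝓘(ℝ, E) x₀).symm z.2) := by
  have hl : HasDerivAt (fun r : ℝ => (r, z.2)) ((1 : ℝ), (0 : E)) z.1 :=
    (hasDerivAt_id z.1).prodMk (hasDerivAt_const z.1 z.2)
  have h1 := (((contDiffAt_timeFunInChart hf hz).differentiableAt
    (by simp)).hasFDerivAt).comp_hasDerivAt (f := fun r : ℝ => (r, z.2)) z.1 hl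
  exact h1.deriv.symm

end

namespace LCSStructure

variable (S : LCSStructure E M)

/-- `Ω` in the chart around `x₀`, as a field of bilinear forms. -/
noncomputable def bilinInChart (x₀ : M) (y : E) : E →L[ℝ] E →L[ℝ] ℝ :=
  altTwoBilin (S.Ω.inChart x₀ y)

/-- `θ` in the chart around `x₀`, as a field of linear forms. -/
noncomputable def linInChart (x₀ : M) (y : E) : E →L[ℝ] ℝ := altOneLin (S.θ.inChart x₀ y)

/-- The Hamiltonian vector field of a time-dependent function, in the chart around `x₀`. -/
noncomputable def hamInChart (f : ℝ × M → ℝ) (x₀ : M) (z : ℝ × E) : E :=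
  vectorFieldInChart 𝓘(ℝ, E) (S.hamVF fun m => f (z.1, m)) x₀ z.2

theorem bilinInChart_apply (x₀ : M) (y u v : E) :
    S.bilinInChart x₀ y u v = S.Ω ((extChartAt 𝓘(ℝ, E) x₀).symm y)
      ![mfderiv 𝓘(ℝ, E) 𝓘(ℝ, E) (extChartAt 𝓘(ℝ, E) x₀).symm y u,
        mfderiv 𝓘(ℝ, E) 𝓘(ℝ, E) (extChartAt 𝓘(ℝ, E) x₀).symm y v] := by
  rw [bilinInChart, altTwoBilin_apply]
  change S.Ω ((extChartAt 𝓘(ℝ, E) x₀).symm y) _ = _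
  congr 1
  ext i
  fin_cases i <;> rfl

theorem linInChart_apply (x₀ : M) (y v : E) :
    S.linInChart x₀ y v = S.θ ((extChartAt 𝓘(ℝ, E) x₀).symm y)
      ![mfderiv 𝓘(ℝ, E) 𝓘(ℝ, E) (extChartAt 𝓘(ℝ, E) x₀).symm y v] := by
  rw [linInChart, altOneLin_apply]
  change S.θ ((extChartAt 𝓘(ℝ, E) x₀).symm y) _ = _
  congr 1
  ext i
  fin_cases i
  rfl

theorem bilinInChart_swap (x₀ : M) (y u v : E) :
    S.bilinInChart x₀ y u v = -S.bilinInChart x₀ y v u := altTwoBilin_swap _ _ _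

variable {x₀ : M}

theorem contDiffAt_inChart_Ω {y : E} (hy : y ∈ (extChartAt 𝓘(ℝ, E) x₀).target) :
    ContDiffAt ℝ ∞ (S.Ω.inChart x₀) y :=
  (S.smooth_Ω x₀).contDiffAt ((isOpen_extChartAt_target x₀).mem_nhds hy)

theorem contDiffAt_inChart_θ {y : E} (hy : y ∈ (extChartAt 𝓘(ℝ, E) x₀).target) :
    ContDiffAt ℝ ∞ (S.θ.inChart x₀) y :=
  (S.smooth_θ x₀).contDiffAt ((isOpen_extChartAt_target x₀).mem_nhds hy)

theorem contDiffAt_bilinInChart {y : E} (hy : y ∈ (extChartAt 𝓘(ℝ, E) x₀).target) :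
    ContDiffAt ℝ ∞ (S.bilinInChart x₀) y :=
  ContDiffAt.continuousLinearMap_comp _ (S.contDiffAt_inChart_Ω hy)

theorem contDiffAt_linInChart {y : E} (hy : y ∈ (extChartAt 𝓘(ℝ, E) x₀).target) :
    ContDiffAt ℝ ∞ (S.linInChart x₀) y :=
  (altOneLin (E := E)).contDiff.contDiffAt.comp y (S.contDiffAt_inChart_θ hy)

theorem fderiv_bilinInChart {y : E} (hy : y ∈ (extChartAt 𝓘(ℝ, E) x₀).target) (u : E) :
    fderiv ℝ (S.bilinInChart x₀) y u = altTwoBilin (fderiv ℝ (S.Ω.inChart x₀) y u) := by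
  have := HasFDerivAt.comp (F := E [⋀^Fin 2]→L[ℝ] ℝ) (G := E →L[ℝ] E →L[ℝ] ℝ)
    (g := fun η => altTwoBilin η) (g' := altTwoBilin) y
    (by exact ContinuousLinearMap.hasFDerivAt _)
    ((S.contDiffAt_inChart_Ω hy).differentiableAt (by simp)).hasFDerivAt
  exact congrArg (fun L => L u) this.fderiv

theorem fderiv_bilinInChart_swap {y : E} (hy : y ∈ (extChartAt 𝓘(ℝ, E) x₀).target) (u v w : E) :
    fderiv ℝ (S.bilinInChart x₀) y u v w = -fderiv ℝ (S.bilinInChart x₀) y u w v := by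
  rw [S.fderiv_bilinInChart hy]
  exact altTwoBilin_swap _ _ _

theorem fderiv_linInChart {y : E} (hy : y ∈ (extChartAt 𝓘(ℝ, E) x₀).target) (u : E) :
    fderiv ℝ (S.linInChart x₀) y u = altOneLin (fderiv ℝ (S.θ.inChart x₀) y u) := by
  have := (altOneLin (E := E)).hasFDerivAt.comp y
    ((S.contDiffAt_inChart_θ hy).differentiableAt (by simp)).hasFDerivAt
  rw [show S.linInChart x₀ = altOneLin ∘ S.θ.inChart x₀ from rfl, this.fderiv]
  rfl

variable [IsManifold 𝓘(ℝ, E) ∞ M]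

/-- `dθ = 0`, in the chart around the point. -/
theorem fderiv_linInChart_symm (x₀ : M) (u v : E) :
    fderiv ℝ (S.linInChart x₀) (extChartAt 𝓘(ℝ, E) x₀ x₀) u v =
      fderiv ℝ (S.linInChart x₀) (extChartAt 𝓘(ℝ, E) x₀ x₀) v u := by
  have h := S.closed_θ x₀
  rw [DForm.d, mfderiv_extChartAt_self] at h
  have h1 := congrArg (fun a : E [⋀^Fin 2]→L[ℝ] ℝ => a ![u, v]) h
  have h2 : extDeriv (S.θ.inChart x₀) (extChartAt 𝓘(ℝ, E) x₀ x₀) ![u, v] = 0 := h1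
  rw [extDeriv, alternatizeUncurryFin_one_apply] at h2
  rw [S.fderiv_linInChart (mem_extChartAt_target x₀),
    S.fderiv_linInChart (mem_extChartAt_target x₀)]
  linarith

theorem bilinInChart_self (x₀ : M) :
    S.bilinInChart x₀ (extChartAt 𝓘(ℝ, E) x₀ x₀) = altTwoBilin (E := E) (S.Ω x₀) :=
  congrArg (altTwoBilin (E := E)) (S.Ω.chartRep_self x₀)

theorem linInChart_self (x₀ : M) :
    S.linInChart x₀ (extChartAt 𝓘(ℝ, E) x₀ x₀) = altOneLin (E := E) (S.θ x₀) :=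
  congrArg (altOneLin (E := E)) (S.θ.chartRep_self x₀)

/-- `dΩ = θ ∧ Ω`, in the chart around the point. -/
theorem fderiv_bilinInChart_cyclic (x₀ : M) (u v w : E) :
    let y := extChartAt 𝓘(ℝ, E) x₀ x₀
    fderiv ℝ (S.bilinInChart x₀) y u v w - fderiv ℝ (S.bilinInChart x₀) y v u w +
        fderiv ℝ (S.bilinInChart x₀) y w u v =
      S.linInChart x₀ y u * S.bilinInChart x₀ y v w -
        S.linInChart x₀ y v * S.bilinInChart x₀ y u w +
        S.linInChart x₀ y w * S.bilinInChart x₀ y u v := by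
  intro y
  have hy : y ∈ (extChartAt 𝓘(ℝ, E) x₀).target := mem_extChartAt_target x₀
  have h := S.d_Ω x₀
  rw [DForm.d, mfderiv_extChartAt_self] at h
  have h1 := congrArg (fun a : E [⋀^Fin 3]→L[ℝ] ℝ => a ![u, v, w]) h
  have h2 : extDeriv (S.Ω.inChart x₀) y ![u, v, w] =
    linWedge (F := E) (S.θ x₀) (S.Ω x₀) ![u, v, w] := h1
  rw [extDeriv, alternatizeUncurryFin_two_apply] at h2
  rw [S.fderiv_bilinInChart hy, S.fderiv_bilinInChart hy, S.fderiv_bilinInChart hy,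
    S.bilinInChart_self, S.linInChart_self]
  exact h2.trans (linWedge_two_apply (E := E) (S.θ x₀) (S.Ω x₀) u v w)

/-- `X_f ⌟ Ω = d^θ f`, in a chart. -/
theorem bilinInChart_hamInChart [FiniteDimensional ℝ E] {f : ℝ × M → ℝ}
    (hf : ContMDiff (extModel E) 𝓘(ℝ, ℝ) ∞ f)
    {z : ℝ × E} (hz : z.2 ∈ (extChartAt 𝓘(ℝ, E) x₀).target) (u : E) :
    S.bilinInChart x₀ z.2 (S.hamInChart f x₀ z) u =
      fderiv ℝ (timeFunInChart f x₀) z (0, u) -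
        timeFunInChart f x₀ z * S.linInChart x₀ z.2 u := by
  rw [S.bilinInChart_apply, S.linInChart_apply, fderiv_timeFunInChart_snd hf hz, hamInChart,
    vectorFieldInChart, mfderiv_symm_comp_mfderiv hz]
  have := congrArg (fun a : E [⋀^Fin 1]→L[ℝ] ℝ =>
    a ![mfderiv 𝓘(ℝ, E) 𝓘(ℝ, E) (extChartAt 𝓘(ℝ, E) x₀).symm z.2 u])
    (S.flat_hamVF (fun m => f (z.1, m)) ((extChartAt 𝓘(ℝ, E) x₀).symm z.2))
  exact this

theorem bilinInChart_isInvertible [FiniteDimensional ℝ E] {y : E}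
    (hy : y ∈ (extChartAt 𝓘(ℝ, E) x₀).target) : (S.bilinInChart x₀ y).IsInvertible := by
  refine altTwoBilin_isInvertible fun v hv => ?_
  have h0 : mfderiv 𝓘(ℝ, E) 𝓘(ℝ, E) (extChartAt 𝓘(ℝ, E) x₀).symm y v = 0 := by
    refine S.nondegenerate _ _ fun w => ?_
    have := hv (mfderiv 𝓘(ℝ, E) 𝓘(ℝ, E) (extChartAt 𝓘(ℝ, E) x₀)
      ((extChartAt 𝓘(ℝ, E) x₀).symm y) w)
    rw [← mfderiv_symm_comp_mfderiv hy w]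
    exact (S.bilinInChart_apply _ _ _ _).symm.trans this
  rw [← mfderiv_comp_mfderiv_symm hy v, h0]
  exact map_zero _

/-- In a chart `X_f` is the inverse of the musical map applied to `d^θ f`, and inversion is smooth
on invertible operators. Smoothness is joint in time and position. -/
theorem contDiffAt_hamInChart [FiniteDimensional ℝ E] {f : ℝ × M → ℝ}
    (hf : ContMDiff (extModel E) 𝓘(ℝ, ℝ) ∞ f)
    {z : ℝ × E} (hz : z.2 ∈ (extChartAt 𝓘(ℝ, E) x₀).target) :
    ContDiffAt ℝ ∞ (S.hamInChart f x₀) z := by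
  have : CompleteSpace E := FiniteDimensional.complete ℝ E
  have h1 : S.hamInChart f x₀ =ᶠ[𝓝 z] fun z => (S.bilinInChart x₀ z.2).inverse
      (fderiv ℝ (timeFunInChart f x₀) z ∘L .inr ℝ ℝ E -
        timeFunInChart f x₀ z • S.linInChart x₀ z.2) := by
    filter_upwards [univ_prod_target_mem_nhds hz] with z' hz'
    obtain ⟨e, he⟩ := S.bilinInChart_isInvertible hz'.2
    have h2 : S.bilinInChart x₀ z'.2 (S.hamInChart f x₀ z') =
        fderiv ℝ (timeFunInChart f x₀) z' ∘L .inr ℝ ℝ E -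
          timeFunInChart f x₀ z' • S.linInChart x₀ z'.2 := by
      ext u
      exact S.bilinInChart_hamInChart hf hz'.2 u
    rw [← h2, ← he, ContinuousLinearMap.inverse_equiv]
    exact (e.symm_apply_apply _).symm
  refine ContDiffAt.congr_of_eventuallyEq ?_ h1
  have hF := contDiffAt_timeFunInChart hf hz
  refine ContDiffAt.clm_apply ?_ ?_
  · exact ((S.bilinInChart_isInvertible hz).contDiffAt_map_inverse).comp z
      ((S.contDiffAt_bilinInChart hz).comp z contDiffAt_snd)
  · exact ((hF.fderiv_right (m := ∞) (by simp)).clm_comp contDiffAt_const).sub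
      (hF.smul ((S.contDiffAt_linInChart hz).comp z contDiffAt_snd))

end LCSStructure

end LCSChart

/-! ### The Lie bracket in a chart -/

/-- The bracket on a manifold is defined by pulling back along the inverse chart, whose differential
inverts that of the chart. At the centre no transport back is visible, the differential being the
identity. -/
theorem mlieBracket_eq_lieBracket_inChart {F : Type*} [NormedAddCommGroup F] [NormedSpace ℝ F]
    {H : Type*} [TopologicalSpace H] {I : ModelWithCorners ℝ F H} [I.Boundaryless]
    {N : Type*} [TopologicalSpace N] [ChartedSpace H N] [IsManifold I 1 N]
    (V W : (x : N) → TangentSpace I x) (x₀ : N) :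
    VectorField.mlieBracket I V W x₀ =
      VectorField.lieBracket ℝ (vectorFieldInChart I V x₀) (vectorFieldInChart I W x₀)
        (extChartAt I x₀ x₀) := by
  have hrep : ∀ U : (x : N) → TangentSpace I x,
      VectorField.mpullbackWithin 𝓘(ℝ, F) I (extChartAt I x₀).symm U (range I)
        =ᶠ[nhds (extChartAt I x₀ x₀)] vectorFieldInChart I U x₀ := by
    intro U
    filter_upwards [(isOpen_extChartAt_target (I := I) x₀).mem_nhds (mem_extChartAt_target x₀)]
      with y hy
    refine congrArg (fun L : TangentSpace I ((extChartAt I x₀).symm y) →L[ℝ] F =>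
      L (U ((extChartAt I x₀).symm y))) ?_
    exact ContinuousLinearMap.inverse_eq
      (mfderivWithin_extChartAt_symm_comp_mfderiv_extChartAt (I := I) hy)
      (mfderiv_extChartAt_comp_mfderivWithin_extChartAt_symm (I := I) hy)
  rw [VectorField.mlieBracket, VectorField.mlieBracketWithin_apply, mfderiv_extChartAt_self]
  refine (congrArg (fun L : F →L[ℝ] F => L _)
    (ContinuousLinearMap.inverse_id (R := ℝ) (M := F))).trans ?_
  change VectorField.lieBracketWithin ℝ _ _ _ _ = _
  rw [preimage_univ, univ_inter]
  refine (congrArg (fun s => VectorField.lieBracketWithin ℝ _ _ s _) I.range_eq_univ).trans ?_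
  refine (congrFun (VectorField.lieBracketWithin_univ (𝕜 := ℝ) (E := F)) _).trans ?_
  rw [I.range_eq_univ] at hrep
  exact Filter.EventuallyEq.lieBracket_vectorField_eq (hrep V) (hrep W)

section LCSJets

open Filter Topology

variable {E : Type*} [NormedAddCommGroup E] [NormedSpace ℝ E]
  {M : Type*} [TopologicalSpace M] [ChartedSpace E M]

/-! ### Charts of the extended phase space -/

theorem extChartAt_extModel (p : ℝ × M) : extChartAt (extModel E) p =
    (PartialEquiv.refl ℝ).prod (extChartAt 𝓘(ℝ, E) p.2) := by
  rw [extChartAt_prod, extChartAt_model_space_eq_id]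

theorem extChartAt_extModel_self (p : ℝ × M) :
    (extChartAt (extModel E) p p : ℝ × E) = (p.1, extChartAt 𝓘(ℝ, E) p.2 p.2) := by
  rw [extChartAt_extModel]; rfl

theorem mem_extChartAt_extModel_target {p : ℝ × M} {z : ℝ × E} :
    z ∈ (extChartAt (extModel E) p).target ↔ z.2 ∈ (extChartAt 𝓘(ℝ, E) p.2).target := by
  rw [extChartAt_extModel]
  simp

variable [IsManifold 𝓘(ℝ, E) ∞ M]

theorem mfderiv_extChartAt_extModel {p q : ℝ × M} (hq : q.2 ∈ (extChartAt 𝓘(ℝ, E) p.2).source)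
    (v : TangentSpace (extModel E) q) :
    mfderiv (extModel E) 𝓘(ℝ, ℝ × E) (extChartAt (extModel E) p) q v =
      ((v.1 : ℝ), (mfderiv 𝓘(ℝ, E) 𝓘(ℝ, E) (extChartAt 𝓘(ℝ, E) p.2) q.2 v.2 : E)) := by
  have h1 : HasMFDerivAt 𝓘(ℝ, E) 𝓘(ℝ, E) (extChartAt 𝓘(ℝ, E) p.2) q.2 _ :=
    (mdifferentiableAt_extChartAt (by rwa [extChartAt_source] at hq)).hasMFDerivAt
  have h2 : HasMFDerivAt (extModel E) 𝓘(ℝ, ℝ × E)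
      (fun q : ℝ × M => (q.1, extChartAt 𝓘(ℝ, E) p.2 q.2)) q
      ((ContinuousLinearMap.fst ℝ ℝ E).prod
        ((mfderiv 𝓘(ℝ, E) 𝓘(ℝ, E) (extChartAt 𝓘(ℝ, E) p.2) q.2) ∘L
          (ContinuousLinearMap.snd ℝ ℝ E))) := by
    rw [modelWithCornersSelf_prod, ← chartedSpaceSelf_prod]
    exact (hasMFDerivAt_fst (I := 𝓘(ℝ, ℝ)) (I' := 𝓘(ℝ, E)) q).prodMk
      (h1.comp q (hasMFDerivAt_snd (I := 𝓘(ℝ, ℝ)) (I' := 𝓘(ℝ, E)) q))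
  have h3 : (extChartAt (extModel E) p : ℝ × M → ℝ × E) =
      fun q : ℝ × M => (q.1, extChartAt 𝓘(ℝ, E) p.2 q.2) := by
    rw [extChartAt_extModel]; rfl
  rw [h3, h2.mfderiv]
  rfl

theorem mfderiv_extChartAt_extModel_symm {p : ℝ × M} {z : ℝ × E}
    (hz : z.2 ∈ (extChartAt 𝓘(ℝ, E) p.2).target) (v : ℝ × E) :
    mfderiv 𝓘(ℝ, ℝ × E) (extModel E) (extChartAt (extModel E) p).symm z v =
      ((v.1 : ℝ), (mfderiv 𝓘(ℝ, E) 𝓘(ℝ, E) (extChartAt 𝓘(ℝ, E) p.2).symm z.2 v.2 : E)) := by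
  have h1 := hasMFDerivAt_extChartAt_symm hz
  have hs : HasMFDerivAt 𝓘(ℝ, ℝ × E) 𝓘(ℝ, E) (Prod.snd : ℝ × E → E) z
      (ContinuousLinearMap.snd ℝ ℝ E) := hasFDerivAt_snd.hasMFDerivAt
  have hf : HasMFDerivAt 𝓘(ℝ, ℝ × E) 𝓘(ℝ, ℝ) (Prod.fst : ℝ × E → ℝ) z
      (ContinuousLinearMap.fst ℝ ℝ E) := hasFDerivAt_fst.hasMFDerivAt
  have h2 : HasMFDerivAt 𝓘(ℝ, ℝ × E) (extModel E)
      (fun z : ℝ × E => (z.1, (extChartAt 𝓘(ℝ, E) p.2).symm z.2)) z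
      ((ContinuousLinearMap.fst ℝ ℝ E).prod
        ((mfderiv 𝓘(ℝ, E) 𝓘(ℝ, E) (extChartAt 𝓘(ℝ, E) p.2).symm z.2) ∘L
          (ContinuousLinearMap.snd ℝ ℝ E))) :=
    hf.prodMk (h1.comp z hs)
  have h3 : ((extChartAt (extModel E) p).symm : ℝ × E → ℝ × M) =
      fun z : ℝ × E => (z.1, (extChartAt 𝓘(ℝ, E) p.2).symm z.2) := by
    rw [extChartAt_extModel]; rfl
  rw [h3, h2.mfderiv]
  rfl

namespace LCSStructure

variable (S : LCSStructure E M)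

theorem vectorFieldInChart_extHamVF (f : ℝ × M → ℝ) (p : ℝ × M) {z : ℝ × E}
    (hz : z.2 ∈ (extChartAt 𝓘(ℝ, E) p.2).target) :
    vectorFieldInChart (extModel E) (S.extHamVF f) p z = (0, S.hamInChart f p.2 z) := by
  have h : (extChartAt (extModel E) p).symm z = (z.1, (extChartAt 𝓘(ℝ, E) p.2).symm z.2) := by
    rw [extChartAt_extModel]; rfl
  rw [vectorFieldInChart, h, mfderiv_extChartAt_extModel ((extChartAt 𝓘(ℝ, E) p.2).map_target hz)]
  rfl

theorem extHamVF_eq_hamInChart (f : ℝ × M → ℝ) (p : ℝ × M) :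
    S.extHamVF f p = (0, S.hamInChart f p.2 (p.1, extChartAt 𝓘(ℝ, E) p.2 p.2)) := by
  have h := vectorFieldInChart_self (S.extHamVF f) p
  rw [extChartAt_extModel_self] at h
  exact h.symm.trans (S.vectorFieldInChart_extHamVF f p (mem_extChartAt_target p.2))

theorem vectorFieldInChart_autonomization (f : ℝ × M → ℝ) (p : ℝ × M) {z : ℝ × E}
    (hz : z.2 ∈ (extChartAt 𝓘(ℝ, E) p.2).target) :
    vectorFieldInChart (extModel E) (S.autonomization f) p z = (1, S.hamInChart f p.2 z) := by
  have h : (extChartAt (extModel E) p).symm z = (z.1, (extChartAt 𝓘(ℝ, E) p.2).symm z.2) := by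
    rw [extChartAt_extModel]; rfl
  rw [vectorFieldInChart, h, mfderiv_extChartAt_extModel ((extChartAt 𝓘(ℝ, E) p.2).map_target hz)]
  rfl

theorem bilinInChart_hamInChart_ham {x₀ : M} (f g : ℝ × M → ℝ)
    {z : ℝ × E} (hz : z.2 ∈ (extChartAt 𝓘(ℝ, E) x₀).target) :
    S.bilinInChart x₀ z.2 (S.hamInChart f x₀ z) (S.hamInChart g x₀ z) =
      S.extBracket f g (z.1, (extChartAt 𝓘(ℝ, E) x₀).symm z.2) := by
  rw [S.bilinInChart_apply, hamInChart, hamInChart, vectorFieldInChart, vectorFieldInChart,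
    mfderiv_symm_comp_mfderiv hz, mfderiv_symm_comp_mfderiv hz, extBracket, extΩ_apply]
  rfl

variable [FiniteDimensional ℝ E]

theorem contMDiff_extHamVF {f : ℝ × M → ℝ} (hf : ContMDiff (extModel E) 𝓘(ℝ, ℝ) ∞ f) :
    ContMDiff (extModel E) (extModel E).tangent ∞
      (fun p => (⟨p, S.extHamVF f p⟩ : TangentBundle (extModel E) (ℝ × M))) := by
  refine contMDiff_vectorField_of_inChart fun p => ?_
  have h : ContDiffOn ℝ ∞ (fun z : ℝ × E => ((0 : ℝ), S.hamInChart f p.2 z))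
      (extChartAt (extModel E) p).target := fun z hz =>
    (contDiffAt_const.prodMk
      (S.contDiffAt_hamInChart hf (mem_extChartAt_extModel_target.1 hz))).contDiffWithinAt
  exact h.congr fun z hz =>
    S.vectorFieldInChart_extHamVF f p (mem_extChartAt_extModel_target.1 hz)

theorem contMDiff_hamVF {f : M → ℝ} (hf : ContMDiff 𝓘(ℝ, E) 𝓘(ℝ, ℝ) ∞ f) :
    ContMDiff 𝓘(ℝ, E) (𝓘(ℝ, E)).tangent ∞
      (fun x => (⟨x, S.hamVF f x⟩ : TangentBundle 𝓘(ℝ, E) M)) := by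
  refine contMDiff_vectorField_of_inChart fun x₀ y hy => ContDiffAt.contDiffWithinAt ?_
  -- Regarding `f` as constant in time makes this the slice `t = 0` of the time-dependent result.
  have hf' : ContMDiff (extModel E) 𝓘(ℝ, ℝ) ∞ (fun p : ℝ × M => f p.2) := hf.comp contMDiff_snd
  exact ContDiffAt.comp (g := S.hamInChart (fun p => f p.2) x₀) (f := fun y : E => ((0 : ℝ), y)) y
    (S.contDiffAt_hamInChart hf' hy) (by fun_prop)

/-! ### Differentiated Hamilton equations -/

variable {x₀ : M}

/-- The derivative of `X_f ⌟ Ω = d^θ f`, in a chart. -/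
theorem fderiv_bilinInChart_hamInChart {f : ℝ × M → ℝ}
    (hf : ContMDiff (extModel E) 𝓘(ℝ, ℝ) ∞ f)
    {z : ℝ × E} (hz : z.2 ∈ (extChartAt 𝓘(ℝ, E) x₀).target) (u : ℝ × E) (w : E) :
    fderiv ℝ (S.bilinInChart x₀) z.2 u.2 (S.hamInChart f x₀ z) w +
        S.bilinInChart x₀ z.2 (fderiv ℝ (S.hamInChart f x₀) z u) w =
      fderiv ℝ (fderiv ℝ (timeFunInChart f x₀)) z u (0, w) -
        (fderiv ℝ (timeFunInChart f x₀) z u * S.linInChart x₀ z.2 w +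
          timeFunInChart f x₀ z * fderiv ℝ (S.linInChart x₀) z.2 u.2 w) := by
  have hF := contDiffAt_timeFunInChart hf hz
  have hb : HasFDerivAt (fun z : ℝ × E => S.bilinInChart x₀ z.2)
      (fderiv ℝ (S.bilinInChart x₀) z.2 ∘L .snd ℝ ℝ E) z :=
    ((S.contDiffAt_bilinInChart hz).differentiableAt (by simp)).hasFDerivAt.comp z hasFDerivAt_snd
  have ht : HasFDerivAt (fun z : ℝ × E => S.linInChart x₀ z.2)
      (fderiv ℝ (S.linInChart x₀) z.2 ∘L .snd ℝ ℝ E) z :=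
    ((S.contDiffAt_linInChart hz).differentiableAt (by simp)).hasFDerivAt.comp z hasFDerivAt_snd
  have hX := ((S.contDiffAt_hamInChart hf hz).differentiableAt (by simp)).hasFDerivAt
  have h1 := (hF.differentiableAt (by simp)).hasFDerivAt
  have h2 := ((hF.fderiv_right (m := ∞) (by simp)).differentiableAt (by simp)).hasFDerivAt
  have hl := (hb.clm_apply hX).clm_apply (hasFDerivAt_const w z)
  have hr := (h2.clm_apply (hasFDerivAt_const ((0 : ℝ), w) z)).sub
    (h1.mul (ht.clm_apply (hasFDerivAt_const w z)))
  have he : (fun z : ℝ × E => S.bilinInChart x₀ z.2 (S.hamInChart f x₀ z) w) =ᶠ[𝓝 z]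
      fun z => fderiv ℝ (timeFunInChart f x₀) z (0, w) -
        timeFunInChart f x₀ z * S.linInChart x₀ z.2 w := by
    filter_upwards [univ_prod_target_mem_nhds hz] with z' hz'
    exact S.bilinInChart_hamInChart hf hz'.2 w
  have := congrArg (fun L : ℝ × E →L[ℝ] ℝ => L u) (hl.unique (hr.congr_of_eventuallyEq he))
  simp at this
  linarith

/-- The derivative of `{f, H} + ∂f/∂t = 0`, in a chart. -/
theorem fderiv_isExtDissipated {H f : ℝ × M → ℝ}
    (hH : ContMDiff (extModel E) 𝓘(ℝ, ℝ) ∞ H) (hf : ContMDiff (extModel E) 𝓘(ℝ, ℝ) ∞ f)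
    (h : S.IsExtDissipated H f)
    {z : ℝ × E} (hz : z.2 ∈ (extChartAt 𝓘(ℝ, E) x₀).target) (u : ℝ × E) :
    fderiv ℝ (S.bilinInChart x₀) z.2 u.2 (S.hamInChart f x₀ z) (S.hamInChart H x₀ z) +
        S.bilinInChart x₀ z.2 (fderiv ℝ (S.hamInChart f x₀) z u) (S.hamInChart H x₀ z) +
        S.bilinInChart x₀ z.2 (S.hamInChart f x₀ z) (fderiv ℝ (S.hamInChart H x₀) z u) +
        fderiv ℝ (fderiv ℝ (timeFunInChart f x₀)) z u (1, 0) = 0 := by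
  have hF := contDiffAt_timeFunInChart hf hz
  have hb : HasFDerivAt (fun z : ℝ × E => S.bilinInChart x₀ z.2)
      (fderiv ℝ (S.bilinInChart x₀) z.2 ∘L .snd ℝ ℝ E) z :=
    ((S.contDiffAt_bilinInChart hz).differentiableAt (by simp)).hasFDerivAt.comp z hasFDerivAt_snd
  have hX := ((S.contDiffAt_hamInChart hf hz).differentiableAt (by simp)).hasFDerivAt
  have hY := ((S.contDiffAt_hamInChart hH hz).differentiableAt (by simp)).hasFDerivAt
  have h2 := ((hF.fderiv_right (m := ∞) (by simp)).differentiableAt (by simp)).hasFDerivAt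
  have hl := ((hb.clm_apply hX).clm_apply hY).add
    (h2.clm_apply (hasFDerivAt_const ((1 : ℝ), (0 : E)) z))
  have he : (fun z : ℝ × E => S.bilinInChart x₀ z.2 (S.hamInChart f x₀ z) (S.hamInChart H x₀ z) +
      fderiv ℝ (timeFunInChart f x₀) z (1, 0)) =ᶠ[𝓝 z] fun _ => 0 := by
    filter_upwards [univ_prod_target_mem_nhds hz] with z' hz'
    rw [S.bilinInChart_hamInChart_ham f H hz'.2, fderiv_timeFunInChart_fst hf hz'.2]
    exact h _
  have := congrArg (fun L : ℝ × E →L[ℝ] ℝ => L u)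
    ((hl.congr_of_eventuallyEq he.symm).unique (hasFDerivAt_const (0 : ℝ) z))
  simp at this
  linarith

theorem eq_zero_of_bilinInChart {y : E} (hy : y ∈ (extChartAt 𝓘(ℝ, E) x₀).target) {v : E}
    (h : ∀ w, S.bilinInChart x₀ y v w = 0) : v = 0 := by
  obtain ⟨e, he⟩ := S.bilinInChart_isInvertible hy
  have h0 : S.bilinInChart x₀ y v = 0 := ContinuousLinearMap.ext h
  rw [← he] at h0
  exact e.map_eq_zero_iff.1 h0

/-- The Hamiltonian vector field of a dissipated quantity commutes with the autonomization. -/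
theorem mlieBracket_extHamVF_autonomization {H f : ℝ × M → ℝ}
    (hH : ContMDiff (extModel E) 𝓘(ℝ, ℝ) ∞ H) (hf : ContMDiff (extModel E) 𝓘(ℝ, ℝ) ∞ f)
    (h : S.IsExtDissipated H f) (p : ℝ × M) :
    VectorField.mlieBracket (extModel E) (S.extHamVF f) (S.autonomization H) p = 0 := by
  obtain ⟨t₀, x₀⟩ := p
  rw [mlieBracket_eq_lieBracket_inChart]
  have hz : (extChartAt (extModel E) (t₀, x₀) (t₀, x₀) : ℝ × E) =
      (t₀, extChartAt 𝓘(ℝ, E) x₀ x₀) := by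
    rw [extChartAt_extModel]; rfl
  rw [hz]
  set z : ℝ × E := (t₀, extChartAt 𝓘(ℝ, E) x₀ x₀) with hzdef
  have hzt : z.2 ∈ (extChartAt 𝓘(ℝ, E) x₀).target := mem_extChartAt_target x₀
  have hX := ((S.contDiffAt_hamInChart hf hzt).differentiableAt (by simp)).hasFDerivAt
  have hY := ((S.contDiffAt_hamInChart hH hzt).differentiableAt (by simp)).hasFDerivAt
  have e1 : vectorFieldInChart (extModel E) (S.extHamVF f) (t₀, x₀) =ᶠ[𝓝 z]
      fun z => (0, S.hamInChart f x₀ z) := by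
    filter_upwards [univ_prod_target_mem_nhds hzt] with z' hz'
    exact S.vectorFieldInChart_extHamVF f (t₀, x₀) hz'.2
  have e2 : vectorFieldInChart (extModel E) (S.autonomization H) (t₀, x₀) =ᶠ[𝓝 z]
      fun z => (1, S.hamInChart H x₀ z) := by
    filter_upwards [univ_prod_target_mem_nhds hzt] with z' hz'
    exact S.vectorFieldInChart_autonomization H (t₀, x₀) hz'.2
  rw [Filter.EventuallyEq.lieBracket_vectorField_eq e1 e2, VectorField.lieBracket,
    ((hasFDerivAt_const (1 : ℝ) z).prodMk hY).fderiv,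
    ((hasFDerivAt_const (0 : ℝ) z).prodMk hX).fderiv]
  set X := S.hamInChart f x₀ z
  set Y := S.hamInChart H x₀ z
  set DX := fderiv ℝ (S.hamInChart f x₀) z
  set DY := fderiv ℝ (S.hamInChart H x₀) z
  -- The `∂/∂t` components are constant, so only this `M` component of the bracket remains. By
  -- nondegeneracy it is tested by pairing with an arbitrary `w`.
  have key : DY (0, X) - DX (1, Y) = 0 := by
    refine S.eq_zero_of_bilinInChart hzt fun w => ?_
    rw [map_sub, sub_apply]
    have q1 := S.fderiv_bilinInChart_hamInChart hH hzt (0, X) w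
    have q2 := S.fderiv_bilinInChart_hamInChart hf hzt (1, Y) w
    have q3 := S.fderiv_isExtDissipated hH hf h hzt (0, w)
    have q4 := S.fderiv_bilinInChart_hamInChart hf hzt (0, w) Y
    have q5 := S.fderiv_bilinInChart_hamInChart hH hzt (0, w) X
    have q6 := S.fderiv_bilinInChart_cyclic x₀ X Y w
    have sf := (contDiffAt_timeFunInChart hf hzt).isSymmSndFDerivAt
      (by rw [minSmoothness_of_isRCLikeNormedField]; exact WithTop.coe_le_coe.2 le_top)
    have sH := (contDiffAt_timeFunInChart hH hzt).isSymmSndFDerivAt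
      (by rw [minSmoothness_of_isRCLikeNormedField]; exact WithTop.coe_le_coe.2 le_top)
    have one_split : ((1 : ℝ), Y) = (1, 0) + (0, Y) := by simp
    have a1 : fderiv ℝ (fderiv ℝ (timeFunInChart f x₀)) z (1, Y) (0, w) =
        fderiv ℝ (fderiv ℝ (timeFunInChart f x₀)) z (0, w) (1, 0) +
          fderiv ℝ (fderiv ℝ (timeFunInChart f x₀)) z (0, w) (0, Y) := by
      rw [sf, one_split, map_add]
    have a2 := sH (0, X) (0, w)
    have a3 : fderiv ℝ (timeFunInChart f x₀) z (1, Y) =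
        fderiv ℝ (timeFunInChart f x₀) z (1, 0) + fderiv ℝ (timeFunInChart f x₀) z (0, Y) := by
      rw [one_split, map_add]
    have b1 := S.bilinInChart_hamInChart hf hzt w
    have b2 := S.bilinInChart_hamInChart hf hzt Y
    have b3 := S.bilinInChart_hamInChart hH hzt X
    have b4 := S.bilinInChart_hamInChart hH hzt w
    have b5 := S.bilinInChart_hamInChart_ham f H hzt
    have b6 := h (z.1, (extChartAt 𝓘(ℝ, E) x₀).symm z.2)
    rw [← b5, ← fderiv_timeFunInChart_fst hf hzt] at b6
    have c1 := S.fderiv_linInChart_symm x₀ X w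
    have c2 := S.fderiv_linInChart_symm x₀ Y w
    have d1 := S.fderiv_bilinInChart_swap hzt w Y X
    have d2 := S.bilinInChart_swap x₀ z.2 X (DY (0, w))
    have d3 := S.bilinInChart_swap x₀ z.2 X Y
    -- Hamilton's equations for `H` along `X_f` (`q1`) and for `f` along `X̃_H` (`q2`) produce the
    -- pairing. The remainder is removed by `dΩ = θ ∧ Ω` (`q6`) and by the dissipation identity
    -- differentiated along `w` (`q3`), rewritten with `q4` and `q5`.
    linear_combination q1 - q2 - q6 - (q3 - q4 + q5 - d2 - d1) - a1 + a2
      - timeFunInChart H x₀ z * c1 + timeFunInChart f x₀ z * c2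
      - S.linInChart x₀ z.2 X * b4 + S.linInChart x₀ z.2 Y * b1
      + S.linInChart x₀ z.2 w * (a3 + b3 + b6 - b2 - d3)
  refine Prod.ext ?_ key
  change (0 : ℝ) - 0 = 0
  simp

end LCSStructure

end LCSJets

/-! ### Invariance of forms of degree one and two, and of functions -/

section FlowLowDegree

open Filter Topology

theorem update_fin_one_eq {F : Type*} (w : Fin 1 → F) (v : F) : update w 0 v = ![v] := by
  ext i
  fin_cases i
  simp

theorem update_fin_two_zero_eq {F : Type*} (w : Fin 2 → F) (v : F) : update w 0 v = ![v, w 1] := by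
  ext i
  fin_cases i <;> simp

theorem update_fin_two_one_eq {F : Type*} (w : Fin 2 → F) (v : F) : update w 1 v = ![w 0, v] := by
  ext i
  fin_cases i <;> simp

variable {F : Type*} [NormedAddCommGroup F] [NormedSpace ℝ F]

theorem fderiv_altForm_apply {G : Type*} [NormedAddCommGroup G] [NormedSpace ℝ G] {k : ℕ}
    {a : G → F [⋀^Fin k]→L[ℝ] ℝ} {z : G} (h : DifferentiableAt ℝ a z) (u : G) (w : Fin k → F) :
    fderiv ℝ a z u w = fderiv ℝ (fun z => a z w) z u := by
  have := h.hasFDerivAt.continuousAlternatingMap_apply_const w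
  rw [this.fderiv]
  rfl

/-- In finite dimension an operator is a fixed linear expression in its values on a basis. This
allows forms to be differentiated one evaluation at a time. -/
theorem differentiableAt_of_clm_apply [FiniteDimensional ℝ F] {G : Type*} [NormedAddCommGroup G]
    [NormedSpace ℝ G] {V : Type*} [NormedAddCommGroup V] [NormedSpace ℝ V] {A : G → F →L[ℝ] V}
    {z : G} (h : ∀ v, DifferentiableAt ℝ (fun z => A z v) z) : DifferentiableAt ℝ A z := by
  let b := Module.finBasis ℝ F
  have h1 : A = fun z =>
      ∑ i, (LinearMap.toContinuousLinearMap (b.coord i)).smulRight (A z (b i)) := by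
    funext z
    ext v
    conv_lhs => rw [← b.sum_repr v, map_sum]
    simp
  rw [h1]
  refine DifferentiableAt.fun_sum fun i _ => ?_
  exact (ContinuousLinearMap.smulRightL ℝ F V
    (LinearMap.toContinuousLinearMap (b.coord i))).differentiableAt.comp z (h (b i))

theorem differentiableAt_altForm_one [FiniteDimensional ℝ F] {G : Type*} [NormedAddCommGroup G]
    [NormedSpace ℝ G] {a : G → F [⋀^Fin 1]→L[ℝ] ℝ} {z : G}
    (h : ∀ v, DifferentiableAt ℝ (fun z => a z ![v]) z) : DifferentiableAt ℝ a z := by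
  have h1 : DifferentiableAt ℝ (fun z => altOneLin (a z)) z := by
    refine differentiableAt_of_clm_apply fun v => ?_
    simp_rw [altOneLin_apply]
    exact h v
  have h2 : a = fun z => ContinuousAlternatingMap.ofSubsingletonLIE (𝕜 := ℝ) (E := F) (F := ℝ)
      (0 : Fin 1) (altOneLin (a z)) := by
    funext z
    exact (LinearIsometryEquiv.apply_symm_apply _ _).symm
  rw [h2]
  exact (ContinuousAlternatingMap.ofSubsingletonLIE (𝕜 := ℝ) (E := F) (F := ℝ)
    (0 : Fin 1)).toContinuousLinearEquiv.differentiableAt.comp z h1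

theorem differentiableAt_altForm_two [FiniteDimensional ℝ F] {G : Type*} [NormedAddCommGroup G]
    [NormedSpace ℝ G] {a : G → F [⋀^Fin 2]→L[ℝ] ℝ} {z : G}
    (h : ∀ u v, DifferentiableAt ℝ (fun z => a z ![u, v]) z) : DifferentiableAt ℝ a z := by
  have h1 : DifferentiableAt ℝ (fun z => altTwoBilin (a z)) z := by
    refine differentiableAt_of_clm_apply fun u => differentiableAt_of_clm_apply fun v => ?_
    simp_rw [altTwoBilin_apply]
    exact h u v
  let L : (F →L[ℝ] F →L[ℝ] ℝ) →L[ℝ] F [⋀^Fin 2]→L[ℝ] ℝ :=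
    ContinuousAlternatingMap.alternatizeUncurryFinCLM ℝ F ℝ ∘L
      ContinuousLinearMap.compL ℝ F (F →L[ℝ] ℝ) (F [⋀^Fin 1]→L[ℝ] ℝ)
        (ContinuousAlternatingMap.ofSubsingletonLIE (𝕜 := ℝ) (E := F) (F := ℝ)
          (0 : Fin 1)).toContinuousLinearEquiv.toContinuousLinearMap
  -- Alternatizing a bilinear form `B` gives `B u v - B v u`, which is twice `B` when `B` is already
  -- alternating.
  have h2 : a = fun z => (2⁻¹ : ℝ) • L (altTwoBilin (a z)) := by
    funext z
    ext w
    rw [altTwo_eq_vecCons, ContinuousAlternatingMap.smul_apply, altTwo_eq_vecCons]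
    have := alternatizeUncurryFin_one_apply
      ((ContinuousAlternatingMap.ofSubsingletonLIE (𝕜 := ℝ) (E := F) (F := ℝ)
          (0 : Fin 1)).toContinuousLinearEquiv.toContinuousLinearMap ∘L (altTwoBilin (a z)))
      (w 0) (w 1)
    rw [altTwoBilin_apply (L (altTwoBilin (a z)))]
    refine Eq.trans ?_ (congrArg (fun r : ℝ => (2⁻¹ : ℝ) • r) this.symm)
    change _ = (2⁻¹ : ℝ) • (altTwoBilin (a z) (w 0) (w 1) - altTwoBilin (a z) (w 1) (w 0))
    rw [altTwoBilin_swap (a z) (w 1) (w 0), smul_eq_mul]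
    ring
  rw [h2]
  have hL : HasFDerivAt (fun B : F →L[ℝ] F →L[ℝ] ℝ => L B) L (altTwoBilin (a z)) := by
    exact ContinuousLinearMap.hasFDerivAt _
  have h3 := (DifferentiableAt.comp (𝕜 := ℝ) (F := F →L[ℝ] F →L[ℝ] ℝ) (G := F [⋀^Fin 2]→L[ℝ] ℝ)
    (g := fun B => L B) (f := fun z => altTwoBilin (a z)) z (by exact hL.differentiableAt)
    h1)
  exact h3.const_smul (2⁻¹ : ℝ)

variable {H : Type*} [TopologicalSpace H] {I : ModelWithCorners ℝ F H}
  {N : Type*} [TopologicalSpace N] [ChartedSpace H N]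
  {X : (x : N) → TangentSpace I x} {D : Set (ℝ × N)} {Ψ : ℝ → N → N}

/-- Version of `IsFlow.pullback_eq` in which smoothness and the Lie derivative are checked on
real-valued coefficient functions. -/
theorem IsFlow.pullback_one_eq [FiniteDimensional ℝ F] [I.Boundaryless] [IsManifold I ∞ N]
    (h : IsFlow I X D Ψ) (α : DForm I N 1)
    (hα : ∀ p v, DifferentiableAt ℝ (fun z => α.chartRep p z ![v]) (extChartAt I p p))
    (hL : ∀ (p : N) (v : F), fderiv ℝ (fun z => α.chartRep p z ![v]) (extChartAt I p p) (X p) +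
      (α p : F [⋀^Fin 1]→L[ℝ] ℝ)
        ![fderiv ℝ (vectorFieldInChart I X p) (extChartAt I p p) v] = 0)
    {s : ℝ} {x : N} (hs : (s, x) ∈ D) : DForm.pullback I (Ψ s) α x = α x := by
  have hd := fun p => differentiableAt_altForm_one (hα p)
  refine h.pullback_eq α hd (fun p w => ?_) hs
  rw [altOne_eq_vecCons, altOneLin_apply]
  refine Eq.trans ?_ (hL p (w 0))
  rw [Fin.sum_univ_one]
  refine congrArg₂ (fun a b : ℝ => a + b) (fderiv_altForm_apply (hd p) _ _) ?_
  exact congrArg (α p : F [⋀^Fin 1]→L[ℝ] ℝ) (update_fin_one_eq w _)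

theorem IsFlow.pullback_two_eq [FiniteDimensional ℝ F] [I.Boundaryless] [IsManifold I ∞ N]
    (h : IsFlow I X D Ψ) (α : DForm I N 2)
    (hα : ∀ p u v, DifferentiableAt ℝ (fun z => α.chartRep p z ![u, v]) (extChartAt I p p))
    (hL : ∀ (p : N) (u v : F),
      fderiv ℝ (fun z => α.chartRep p z ![u, v]) (extChartAt I p p) (X p) +
      (α p : F [⋀^Fin 2]→L[ℝ] ℝ)
        ![fderiv ℝ (vectorFieldInChart I X p) (extChartAt I p p) u, v] +
      (α p : F [⋀^Fin 2]→L[ℝ] ℝ)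
        ![u, fderiv ℝ (vectorFieldInChart I X p) (extChartAt I p p) v] = 0)
    {s : ℝ} {x : N} (hs : (s, x) ∈ D) : DForm.pullback I (Ψ s) α x = α x := by
  have hd := fun p => differentiableAt_altForm_two (hα p)
  refine h.pullback_eq α hd (fun p w => ?_) hs
  rw [altTwo_eq_vecCons, altTwoBilin_apply]
  refine Eq.trans ?_ (hL p (w 0) (w 1))
  rw [Fin.sum_univ_two, ← add_assoc]
  refine congrArg₂ (fun a b : ℝ => a + b) (congrArg₂ (fun a b : ℝ => a + b)
    (fderiv_altForm_apply (hd p) _ _) ?_) ?_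
  · exact congrArg (α p : F [⋀^Fin 2]→L[ℝ] ℝ) (update_fin_two_zero_eq w _)
  · exact congrArg (α p : F [⋀^Fin 2]→L[ℝ] ℝ) (update_fin_two_one_eq w _)

/-- The derivative of a function along the flow. -/
theorem IsFlow.hasDerivAt_comp (h : IsFlow I X D Ψ) {g : N → ℝ}
    (hg : MDifferentiable I 𝓘(ℝ, ℝ) g) {s : ℝ} {x : N} (hs : (s, x) ∈ D) :
    HasDerivAt (fun r => g (Ψ r x)) (mfderiv I 𝓘(ℝ, ℝ) g (Ψ s x) (X (Ψ s x)) : ℝ) s := by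
  have h1 := (h.generator x s hs).hasMFDerivAt
    ((h.isOpen.preimage (by fun_prop : Continuous fun s : ℝ => (s, x))).mem_nhds hs)
  have h2 : HasFDerivAt (fun r => g (Ψ r x)) (_ : ℝ →L[ℝ] ℝ) s :=
    ((hg (Ψ s x)).hasMFDerivAt.comp s h1).hasFDerivAt
  refine h2.hasDerivAt.congr_deriv ?_
  change mfderiv I 𝓘(ℝ, ℝ) g (Ψ s x) ((1 : ℝ) • X (Ψ s x)) = _
  rw [one_smul]

/-- A function whose derivative along the vector field vanishes is preserved by the flow. -/
theorem IsFlow.comp_eq (h : IsFlow I X D Ψ) {g : N → ℝ} (hg : MDifferentiable I 𝓘(ℝ, ℝ) g)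
    (h0 : ∀ x, (mfderiv I 𝓘(ℝ, ℝ) g x (X x) : ℝ) = 0) {s : ℝ} {x : N} (hs : (s, x) ∈ D) :
    g (Ψ s x) = g x := by
  have hJ : IsOpen {s : ℝ | (s, x) ∈ D} := h.isOpen.preimage (by fun_prop)
  have hder : ∀ s ∈ {s : ℝ | (s, x) ∈ D}, HasDerivAt (fun r => g (Ψ r x)) 0 s := fun s hs =>
    (h.hasDerivAt_comp hg hs).congr_deriv (h0 _)
  have := hJ.is_const_of_deriv_eq_zero (h.ordConnected x).isPreconnected
    (fun r hr => (hder r hr).differentiableAt.differentiableWithinAt)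
    (fun r hr => (hder r hr).deriv) hs (h.zero_mem x)
  simpa [h.map_zero] using this

end FlowLowDegree

section Invariance

open Filter Topology

variable {E : Type*} [NormedAddCommGroup E] [NormedSpace ℝ E]
  {M : Type*} [TopologicalSpace M] [ChartedSpace E M]

namespace LCSStructure

variable (S : LCSStructure E M)

/-! ### Lie derivatives along Hamiltonian vector fields -/

/-- Hamilton's equation solved for `df`. Applied to `H` and the vector `X_f` it expresses `X_f(H)`
as `{H, f} + H θ(X_f)`. -/
theorem mfderiv_apply_eq_hamVF [FiniteDimensional ℝ E] (f : M → ℝ) (x : M)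
    (v : TangentSpace 𝓘(ℝ, E) x) :
    (mfderiv 𝓘(ℝ, E) 𝓘(ℝ, ℝ) f x v : ℝ) = S.Ω x ![S.hamVF f x, v] + f x * S.θ x ![v] := by
  have h : S.Ω x ![S.hamVF f x, v] =
      dFun 𝓘(ℝ, E) f x ![v] - f x * S.θ x ![v] :=
    congrArg (fun a : E [⋀^Fin 1]→L[ℝ] ℝ => a ![v]) (S.flat_hamVF f x)
  change dFun 𝓘(ℝ, E) f x ![v] = _
  rw [h]
  ring

theorem Ω_swap (x : M) (u v : TangentSpace 𝓘(ℝ, E) x) : S.Ω x ![u, v] = -S.Ω x ![v, u] :=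
  (altTwoBilin_apply (E := E) (S.Ω x) u v).symm.trans
    ((altTwoBilin_swap (E := E) (S.Ω x) u v).trans
      (congrArg Neg.neg (altTwoBilin_apply (E := E) (S.Ω x) v u)))

theorem linInChart_hamInChart [IsManifold 𝓘(ℝ, E) ∞ M] {x₀ : M} (f : ℝ × M → ℝ) {z : ℝ × E}
    (hz : z.2 ∈ (extChartAt 𝓘(ℝ, E) x₀).target) :
    S.linInChart x₀ z.2 (S.hamInChart f x₀ z) =
      S.extθ (z.1, (extChartAt 𝓘(ℝ, E) x₀).symm z.2)
        ![S.extHamVF f (z.1, (extChartAt 𝓘(ℝ, E) x₀).symm z.2)] := by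
  rw [S.linInChart_apply, hamInChart, vectorFieldInChart, mfderiv_symm_comp_mfderiv hz, extθ_apply]
  rfl

theorem hasFDerivAt_bilinInChart_apply {x₀ : M} {y : E}
    (hy : y ∈ (extChartAt 𝓘(ℝ, E) x₀).target) (u v : E) :
    HasFDerivAt (fun y => S.bilinInChart x₀ y u v)
      (((fderiv ℝ (S.bilinInChart x₀) y).flip u).flip v) y := by
  have := (((S.contDiffAt_bilinInChart hy).differentiableAt
    (by simp)).hasFDerivAt.clm_apply (hasFDerivAt_const u y)).clm_apply (hasFDerivAt_const v y)
  simpa using this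

theorem hasFDerivAt_linInChart_apply {x₀ : M} {y : E}
    (hy : y ∈ (extChartAt 𝓘(ℝ, E) x₀).target) (v : E) :
    HasFDerivAt (fun y => S.linInChart x₀ y v) ((fderiv ℝ (S.linInChart x₀) y).flip v) y := by
  have := ((S.contDiffAt_linInChart hy).differentiableAt
    (by simp)).hasFDerivAt.clm_apply (hasFDerivAt_const v y)
  simpa using this

variable [IsManifold 𝓘(ℝ, E) ∞ M] [FiniteDimensional ℝ E]

/-- `L_{X_f} Ω = θ(X_f) Ω`, in the chart around the point. -/
theorem lieDeriv_bilinInChart {f : ℝ × M → ℝ} (hf : ContMDiff (extModel E) 𝓘(ℝ, ℝ) ∞ f)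
    (t₀ : ℝ) (x₀ : M) (u v : E) :
    let z : ℝ × E := (t₀, extChartAt 𝓘(ℝ, E) x₀ x₀)
    fderiv ℝ (S.bilinInChart x₀) z.2 (S.hamInChart f x₀ z) u v +
        S.bilinInChart x₀ z.2 (fderiv ℝ (S.hamInChart f x₀) z (0, u)) v +
        S.bilinInChart x₀ z.2 u (fderiv ℝ (S.hamInChart f x₀) z (0, v)) =
      S.linInChart x₀ z.2 (S.hamInChart f x₀ z) * S.bilinInChart x₀ z.2 u v := by
  intro z
  have hz : z.2 ∈ (extChartAt 𝓘(ℝ, E) x₀).target := mem_extChartAt_target x₀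
  have q1 := S.fderiv_bilinInChart_hamInChart hf hz (0, u) v
  have q2 := S.fderiv_bilinInChart_hamInChart hf hz (0, v) u
  have q3 := S.fderiv_bilinInChart_cyclic x₀ (S.hamInChart f x₀ z) u v
  have a := (contDiffAt_timeFunInChart hf hz).isSymmSndFDerivAt
    (by rw [minSmoothness_of_isRCLikeNormedField]; exact WithTop.coe_le_coe.2 le_top) (0, u) (0, v)
  have b1 := S.bilinInChart_hamInChart hf hz u
  have b2 := S.bilinInChart_hamInChart hf hz v
  have c := S.fderiv_linInChart_symm x₀ u v
  have d := S.bilinInChart_swap x₀ z.2 u (fderiv ℝ (S.hamInChart f x₀) z (0, v))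
  -- Cartan's formula in coordinates: `q1 - q2` is `d(X_f ⌟ Ω) = d(d^θ f)`, where the second
  -- derivatives of `f` cancel by `a` and those terms with `dθ` by `c`, while `q3` is `X_f ⌟ dΩ =
  -- X_f ⌟ (θ ∧ Ω)`.
  linear_combination q1 - q2 + q3 + a + d - timeFunInChart f x₀ z * c
    + S.linInChart x₀ z.2 v * b1 - S.linInChart x₀ z.2 u * b2

/-! ### The time-independent case -/

/-- A Hamiltonian vector field with `θ(X_f) = 0` is an infinitesimal automorphism of `Ω`. -/
theorem pullback_Ω_eq [T2Space M] {f : M → ℝ} (hf : ContMDiff 𝓘(ℝ, E) 𝓘(ℝ, ℝ) ∞ f)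
    (hθ : ∀ x, S.θ x ![S.hamVF f x] = 0) {D : Set (ℝ × M)} {Ψ : ℝ → M → M}
    (h : IsFlow 𝓘(ℝ, E) (S.hamVF f) D Ψ) {s : ℝ} {x : M} (hs : (s, x) ∈ D) :
    DForm.pullback 𝓘(ℝ, E) (Ψ s) S.Ω x = S.Ω x := by
  have hf' : ContMDiff (extModel E) 𝓘(ℝ, ℝ) ∞ (fun p : ℝ × M => f p.2) := hf.comp contMDiff_snd
  have hrep : ∀ (p : M) (u v : E), (fun z => (S.Ω).chartRep p z ![u, v]) =
      fun y => S.bilinInChart p y u v := fun p u v => by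
    funext y
    rw [bilinInChart, altTwoBilin_apply]
    rfl
  have hder := fun (p : M) (u v : E) =>
    S.hasFDerivAt_bilinInChart_apply (mem_extChartAt_target (I := 𝓘(ℝ, E)) p) u v
  refine h.pullback_two_eq S.Ω (fun p u v => ?_) (fun p u v => ?_) hs
  · rw [hrep]
    exact (hder p u v).differentiableAt
  · rw [hrep, (hder p u v).fderiv]
    have h1 := S.lieDeriv_bilinInChart hf' 0 p u v
    have hz : ((0 : ℝ), extChartAt 𝓘(ℝ, E) p p).2 ∈ (extChartAt 𝓘(ℝ, E) p).target :=
      mem_extChartAt_target p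
    have h2 := S.linInChart_hamInChart (fun p : ℝ × M => f p.2) hz
    rw [extθ_apply] at h2
    replace h2 := h2.trans (hθ _)
    have h3 : ∀ w : E, fderiv ℝ (S.hamInChart (fun p : ℝ × M => f p.2) p)
        ((0 : ℝ), extChartAt 𝓘(ℝ, E) p p) (0, w) =
        fderiv ℝ (vectorFieldInChart 𝓘(ℝ, E) (S.hamVF f) p) (extChartAt 𝓘(ℝ, E) p p) w := by
      intro w
      have := ((S.contDiffAt_hamInChart hf' hz).differentiableAt (by simp)).hasFDerivAt.comp
        (f := fun y : E => ((0 : ℝ), y)) _ (hasFDerivAt_prodMk_right _ _)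
      exact (congrArg (fun L : E →L[ℝ] E => L w) this.fderiv).symm
    simp only [h2, h3, zero_mul] at h1
    rw [S.bilinInChart_self p] at h1
    have h4 : S.hamInChart (fun p : ℝ × M => f p.2) p ((0 : ℝ), extChartAt 𝓘(ℝ, E) p p) =
        S.hamVF f p := vectorFieldInChart_self _ _
    refine Eq.trans ?_ h1
    exact congrArg₂ (fun a b : ℝ => a + b) (congrArg₂ (fun a b : ℝ => a + b)
      (congrArg (fun X : E => fderiv ℝ (S.bilinInChart p) (extChartAt 𝓘(ℝ, E) p p) X u v) h4.symm)
      (altTwoBilin_apply (E := E) (S.Ω p) _ v).symm)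
      (altTwoBilin_apply (E := E) (S.Ω p) u _).symm

/-- The flow of a dissipated quantity with `θ(X_f) = 0` consists of canonical transformations
that leave the Hamiltonian invariant. -/
theorem isCanonicalInvariance_flow [T2Space M] {H f : M → ℝ}
    (hH : ContMDiff 𝓘(ℝ, E) 𝓘(ℝ, ℝ) ∞ H) (hf : ContMDiff 𝓘(ℝ, E) 𝓘(ℝ, ℝ) ∞ f)
    (hd : S.IsDissipated H f) (hθ : ∀ x, S.θ x ![S.hamVF f x] = 0)
    {D : Set (ℝ × M)} {Ψ : ℝ → M → M} (h : IsFlow 𝓘(ℝ, E) (S.hamVF f) D Ψ) (s : ℝ) :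
    S.IsCanonicalInvariance H {x | (s, x) ∈ D} {x | (-s, x) ∈ D} (Ψ s) := by
  refine ⟨⟨h.isDiffeoOn s, fun x hx => S.pullback_Ω_eq hf hθ h hx⟩, fun x hx => ?_⟩
  refine h.comp_eq (hH.mdifferentiable (by simp)) (fun x => ?_) hx
  -- Since `θ(X_f) = 0`, the derivative of `H` along `X_f` is exactly `{H, f}`.
  rw [S.mfderiv_apply_eq_hamVF, hθ, mul_zero, add_zero]
  exact hd x

end LCSStructure

end Invariance

section ExtInvariance

open Filter Topology

variable {E : Type*} [NormedAddCommGroup E] [NormedSpace ℝ E]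
  {M : Type*} [TopologicalSpace M] [ChartedSpace E M]

/-! ### Forms on the extended phase space -/

theorem mfderiv_extModel_fst (p : ℝ × M) (u : TangentSpace (extModel E) p) :
    (mfderiv (extModel E) 𝓘(ℝ, ℝ) (Prod.fst : ℝ × M → ℝ) p u : ℝ) = (u.1 : ℝ) := by
  have h1 : mfderiv (extModel E) 𝓘(ℝ, ℝ) (Prod.fst : ℝ × M → ℝ) p =
    ContinuousLinearMap.fst ℝ ℝ E := mfderiv_fst
  rw [h1]
  rfl

theorem dFun_apply {F : Type*} [NormedAddCommGroup F] [NormedSpace ℝ F] {H : Type*}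
    [TopologicalSpace H] {I : ModelWithCorners ℝ F H} {N : Type*} [TopologicalSpace N]
    [ChartedSpace H N] (f : N → ℝ) (x : N) (v : TangentSpace I x) :
    dFun I f x ![v] = mfderiv I 𝓘(ℝ, ℝ) f x v := rfl

theorem fderiv_timeFunInChart [IsManifold 𝓘(ℝ, E) ∞ M] {f : ℝ × M → ℝ}
    (hf : ContMDiff (extModel E) 𝓘(ℝ, ℝ) ∞ f) (p : ℝ × M)
    {z : ℝ × E} (hz : z ∈ (extChartAt (extModel E) p).target) (u : ℝ × E) :
    fderiv ℝ (timeFunInChart f p.2) z u =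
      mfderiv (extModel E) 𝓘(ℝ, ℝ) f ((extChartAt (extModel E) p).symm z)
        (mfderiv 𝓘(ℝ, ℝ × E) (extModel E) (extChartAt (extModel E) p).symm z u) := by
  have h1 : timeFunInChart f p.2 = f ∘ (extChartAt (extModel E) p).symm := by
    rw [extChartAt_extModel]; rfl
  have h2 := ((contMDiffOn_extChartAt_symm (I := extModel E) (n := ∞) p).contMDiffAt
    ((isOpen_extChartAt_target p).mem_nhds hz)).mdifferentiableAt (by simp)
  have h3 : HasFDerivAt (f ∘ (extChartAt (extModel E) p).symm) (_ : ℝ × E →L[ℝ] ℝ) z :=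
    (((hf _).mdifferentiableAt (by simp)).hasMFDerivAt.comp z h2.hasMFDerivAt).hasFDerivAt
  rw [h1, h3.fderiv]
  rfl

namespace LCSStructure

variable (S : LCSStructure E M)

theorem dTheta_extθ_apply (K : ℝ × M → ℝ) (p : ℝ × M) (u : TangentSpace (extModel E) p) :
    dTheta S.extθ K p ![u] =
      dFun (extModel E) K p ![u] - K p * S.extθ p ![u] := rfl

theorem dTheta_wedge_dt_apply (K : ℝ × M → ℝ) (p : ℝ × M) (u v : TangentSpace (extModel E) p) :
    (dTheta S.extθ K).wedge (dFun (extModel E) Prod.fst) p ![u, v] =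
      dTheta S.extθ K p ![u] * (v.1 : ℝ) - dTheta S.extθ K p ![v] * (u.1 : ℝ) := by
  have h : ∀ w : TangentSpace (extModel E) p,
      altOneLin (E := ℝ × E) (dFun (extModel E) (Prod.fst : ℝ × M → ℝ) p) w = (w.1 : ℝ) :=
    fun w => mfderiv_extModel_fst p w
  refine (linWedge_one_apply (E := ℝ × E) (dTheta S.extθ K p)
    (dFun (extModel E) (Prod.fst : ℝ × M → ℝ) p) u v).trans ?_
  refine congrArg₂ (fun a b : ℝ => a - b) (congrArg₂ (fun a b : ℝ => a * b) ?_ (h v))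
    (congrArg₂ (fun a b : ℝ => a * b) ?_ (h u))
  · exact altOneLin_apply (E := ℝ × E) (dTheta S.extθ K p) u
  · exact altOneLin_apply (E := ℝ × E) (dTheta S.extθ K p) v

/-- The form `Ω̂ + d^θ̂ H ∧ dt` on the extended phase space. -/
noncomputable def hamForm (H : ℝ × M → ℝ) : DForm (extModel E) (ℝ × M) 2 :=
  fun p => S.extΩ p + (dTheta S.extθ H).wedge (dFun (extModel E) Prod.fst) p

theorem hamForm_apply (H : ℝ × M → ℝ) (p : ℝ × M) (u v : TangentSpace (extModel E) p) :
    S.hamForm H p ![u, v] = S.extΩ p ![u, v] +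
      (dTheta S.extθ H p ![u] * (v.1 : ℝ) - dTheta S.extθ H p ![v] * (u.1 : ℝ)) := by
  rw [← S.dTheta_wedge_dt_apply]
  rfl

variable [IsManifold 𝓘(ℝ, E) ∞ M]

theorem hasFDerivAt_dTheta_inChart {x₀ : M} {H : ℝ × M → ℝ}
    (hH : ContMDiff (extModel E) 𝓘(ℝ, ℝ) ∞ H)
    {z : ℝ × E} (hz : z.2 ∈ (extChartAt 𝓘(ℝ, E) x₀).target) (u : ℝ × E) :
    HasFDerivAt (fun z => fderiv ℝ (timeFunInChart H x₀) z u -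
        timeFunInChart H x₀ z * S.linInChart x₀ z.2 u.2)
      ((fderiv ℝ (fderiv ℝ (timeFunInChart H x₀)) z).flip u -
        (timeFunInChart H x₀ z • ((fderiv ℝ (S.linInChart x₀) z.2).flip u.2 ∘L .snd ℝ ℝ E) +
          S.linInChart x₀ z.2 u.2 • fderiv ℝ (timeFunInChart H x₀) z)) z := by
  have hF := contDiffAt_timeFunInChart hH hz
  have h1 := (hF.differentiableAt (by simp)).hasFDerivAt
  have h2 := (((hF.fderiv_right (m := ∞) (by simp)).differentiableAt
    (by simp)).hasFDerivAt).clm_apply (hasFDerivAt_const u z)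
  have h3 := (S.hasFDerivAt_linInChart_apply hz u.2).comp z hasFDerivAt_snd
  simp only [ContinuousLinearMap.comp_zero, zero_add] at h2
  exact h2.sub (h1.mul h3)

theorem chartRep_extθ (p : ℝ × M) {z : ℝ × E} (hz : z ∈ (extChartAt (extModel E) p).target)
    (v : ℝ × E) : S.extθ.chartRep p z ![v] = S.linInChart p.2 z.2 v.2 := by
  have h : (extChartAt (extModel E) p).symm z = (z.1, (extChartAt 𝓘(ℝ, E) p.2).symm z.2) := by
    rw [extChartAt_extModel]; rfl
  have h1 : S.extθ.chartRep p z ![v] = S.extθ ((extChartAt (extModel E) p).symm z)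
      ![mfderiv 𝓘(ℝ, ℝ × E) (extModel E) (extChartAt (extModel E) p).symm z v] := by
    refine congrArg (S.extθ ((extChartAt (extModel E) p).symm z)) ?_
    ext i : 1
    fin_cases i
    rfl
  rw [h1, extθ_apply, mfderiv_extChartAt_extModel_symm (mem_extChartAt_extModel_target.1 hz),
    S.linInChart_apply, h]

theorem chartRep_hamForm {H : ℝ × M → ℝ} (hH : ContMDiff (extModel E) 𝓘(ℝ, ℝ) ∞ H)
    (p : ℝ × M) {z : ℝ × E} (hz : z ∈ (extChartAt (extModel E) p).target) (u v : ℝ × E) :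
    (S.hamForm H).chartRep p z ![u, v] = S.bilinInChart p.2 z.2 u.2 v.2 +
      ((fderiv ℝ (timeFunInChart H p.2) z u -
          timeFunInChart H p.2 z * S.linInChart p.2 z.2 u.2) * v.1 -
        (fderiv ℝ (timeFunInChart H p.2) z v -
          timeFunInChart H p.2 z * S.linInChart p.2 z.2 v.2) * u.1) := by
  have h : (extChartAt (extModel E) p).symm z = (z.1, (extChartAt 𝓘(ℝ, E) p.2).symm z.2) := by
    rw [extChartAt_extModel]; rfl
  have h1 : (S.hamForm H).chartRep p z ![u, v] = S.hamForm H ((extChartAt (extModel E) p).symm z)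
      ![mfderiv 𝓘(ℝ, ℝ × E) (extModel E) (extChartAt (extModel E) p).symm z u,
        mfderiv 𝓘(ℝ, ℝ × E) (extModel E) (extChartAt (extModel E) p).symm z v] := by
    refine congrArg (S.hamForm H ((extChartAt (extModel E) p).symm z)) ?_
    ext i : 1
    fin_cases i <;> rfl
  rw [h1, hamForm_apply, dTheta_extθ_apply, dTheta_extθ_apply, dFun_apply, dFun_apply,
    fderiv_timeFunInChart hH p hz, fderiv_timeFunInChart hH p hz, extΩ_apply, extθ_apply, extθ_apply,
    mfderiv_extChartAt_extModel_symm (mem_extChartAt_extModel_target.1 hz),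
    mfderiv_extChartAt_extModel_symm (mem_extChartAt_extModel_target.1 hz),
    S.linInChart_apply, S.linInChart_apply, S.bilinInChart_apply, timeFunInChart, h]

end LCSStructure

end ExtInvariance

/-! ### Lie derivatives of `θ̂` and of `Ω̂ + d^θ̂ H ∧ dt` along `X_f`. -/

section ExtLie

open Filter Topology

variable {E : Type*} [NormedAddCommGroup E] [NormedSpace ℝ E] [FiniteDimensional ℝ E]
  {M : Type*} [TopologicalSpace M] [ChartedSpace E M] [IsManifold 𝓘(ℝ, E) ∞ M]

namespace LCSStructure

variable (S : LCSStructure E M)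

/-- The derivative of `θ(X_f) = 0`, in a chart. -/
theorem fderiv_linInChart_hamInChart {x₀ : M} {f : ℝ × M → ℝ}
    (hf : ContMDiff (extModel E) 𝓘(ℝ, ℝ) ∞ f) (hθ : ∀ p, S.extθ p ![S.extHamVF f p] = 0)
    {z : ℝ × E} (hz : z.2 ∈ (extChartAt 𝓘(ℝ, E) x₀).target) (v : ℝ × E) :
    fderiv ℝ (S.linInChart x₀) z.2 v.2 (S.hamInChart f x₀ z) +
      S.linInChart x₀ z.2 (fderiv ℝ (S.hamInChart f x₀) z v) = 0 := by
  have ht : HasFDerivAt (fun z : ℝ × E => S.linInChart x₀ z.2)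
      (fderiv ℝ (S.linInChart x₀) z.2 ∘L .snd ℝ ℝ E) z :=
    ((S.contDiffAt_linInChart hz).differentiableAt (by simp)).hasFDerivAt.comp z hasFDerivAt_snd
  have hX := ((S.contDiffAt_hamInChart hf hz).differentiableAt (by simp)).hasFDerivAt
  have he : (fun z : ℝ × E => S.linInChart x₀ z.2 (S.hamInChart f x₀ z)) =ᶠ[𝓝 z] fun _ => 0 := by
    filter_upwards [univ_prod_target_mem_nhds hz] with z' hz'
    rw [S.linInChart_hamInChart f hz'.2, hθ]
  have := congrArg (fun L : ℝ × E →L[ℝ] ℝ => L v)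
    (((ht.clm_apply hX).congr_of_eventuallyEq he.symm).unique (hasFDerivAt_const (0 : ℝ) z))
  simp at this
  linarith

/-- `X_f(H) = ∂f/∂t` for a dissipated quantity with `θ(X_f) = 0`, in a chart. -/
theorem fderiv_timeFunInChart_hamInChart {x₀ : M} {H f : ℝ × M → ℝ}
    (hH : ContMDiff (extModel E) 𝓘(ℝ, ℝ) ∞ H) (hf : ContMDiff (extModel E) 𝓘(ℝ, ℝ) ∞ f)
    (hd : S.IsExtDissipated H f) (hθ : ∀ p, S.extθ p ![S.extHamVF f p] = 0)
    {z : ℝ × E} (hz : z.2 ∈ (extChartAt 𝓘(ℝ, E) x₀).target) :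
    fderiv ℝ (timeFunInChart H x₀) z (0, S.hamInChart f x₀ z) =
      fderiv ℝ (timeFunInChart f x₀) z (1, 0) := by
  have h1 := S.bilinInChart_hamInChart hH hz (S.hamInChart f x₀ z)
  have h2 := S.bilinInChart_swap x₀ z.2 (S.hamInChart H x₀ z) (S.hamInChart f x₀ z)
  have h3 := S.bilinInChart_hamInChart_ham f H hz
  have h4 := hd (z.1, (extChartAt 𝓘(ℝ, E) x₀).symm z.2)
  rw [S.linInChart_hamInChart f hz, hθ] at h1
  rw [fderiv_timeFunInChart_fst hf hz]
  linarith

/-- The derivative of `X_f(H) = ∂f/∂t`, in a chart. -/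
theorem fderiv_fderiv_timeFunInChart_hamInChart {x₀ : M} {H f : ℝ × M → ℝ}
    (hH : ContMDiff (extModel E) 𝓘(ℝ, ℝ) ∞ H) (hf : ContMDiff (extModel E) 𝓘(ℝ, ℝ) ∞ f)
    (hd : S.IsExtDissipated H f) (hθ : ∀ p, S.extθ p ![S.extHamVF f p] = 0)
    {z : ℝ × E} (hz : z.2 ∈ (extChartAt 𝓘(ℝ, E) x₀).target) (u : ℝ × E) :
    fderiv ℝ (fderiv ℝ (timeFunInChart H x₀)) z u (0, S.hamInChart f x₀ z) +
        fderiv ℝ (timeFunInChart H x₀) z (0, fderiv ℝ (S.hamInChart f x₀) z u) =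
      fderiv ℝ (fderiv ℝ (timeFunInChart f x₀)) z u (1, 0) := by
  have h2 : ∀ {g : ℝ × M → ℝ}, ContMDiff (extModel E) 𝓘(ℝ, ℝ) ∞ g →
      HasFDerivAt (fderiv ℝ (timeFunInChart g x₀))
        (fderiv ℝ (fderiv ℝ (timeFunInChart g x₀)) z) z :=
    fun hg => (((contDiffAt_timeFunInChart hg hz).fderiv_right (m := ∞) (by simp)).differentiableAt
      (by simp)).hasFDerivAt
  have hX := ((S.contDiffAt_hamInChart hf hz).differentiableAt (by simp)).hasFDerivAt
  have hl := (h2 hH).clm_apply ((hasFDerivAt_const (0 : ℝ) z).prodMk hX)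
  have hr := (h2 hf).clm_apply (hasFDerivAt_const ((1 : ℝ), (0 : E)) z)
  have he : (fun z => fderiv ℝ (timeFunInChart H x₀) z (0, S.hamInChart f x₀ z)) =ᶠ[𝓝 z]
      fun z => fderiv ℝ (timeFunInChart f x₀) z (1, 0) := by
    filter_upwards [univ_prod_target_mem_nhds hz] with z' hz'
    exact S.fderiv_timeFunInChart_hamInChart hH hf hd hθ hz'.2
  have := congrArg (fun L : ℝ × E →L[ℝ] ℝ => L u) (hl.unique (hr.congr_of_eventuallyEq he))
  simp at this
  linarith

/-- The horizontal part of `L_{X_f} (Ω̂ + d^θ̂ H ∧ dt) = 0`, in the chart around the point. -/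
theorem lieDeriv_dTheta_inChart {H f : ℝ × M → ℝ}
    (hH : ContMDiff (extModel E) 𝓘(ℝ, ℝ) ∞ H) (hf : ContMDiff (extModel E) 𝓘(ℝ, ℝ) ∞ f)
    (hd : S.IsExtDissipated H f) (hθ : ∀ p, S.extθ p ![S.extHamVF f p] = 0)
    (t₀ : ℝ) (x₀ : M) (w : E) :
    let z : ℝ × E := (t₀, extChartAt 𝓘(ℝ, E) x₀ x₀)
    let X := S.hamInChart f x₀ z
    let DX := fderiv ℝ (S.hamInChart f x₀) z
    fderiv ℝ (fderiv ℝ (timeFunInChart H x₀)) z (0, X) (0, w) -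
        (fderiv ℝ (timeFunInChart H x₀) z (0, X) * S.linInChart x₀ z.2 w +
          timeFunInChart H x₀ z * fderiv ℝ (S.linInChart x₀) z.2 X w) +
        (fderiv ℝ (timeFunInChart H x₀) z (0, DX (0, w)) -
          timeFunInChart H x₀ z * S.linInChart x₀ z.2 (DX (0, w))) =
      S.bilinInChart x₀ z.2 (DX (1, 0)) w := by
  intro z X DX
  have hz : z.2 ∈ (extChartAt 𝓘(ℝ, E) x₀).target := mem_extChartAt_target x₀
  have g0 := S.fderiv_timeFunInChart_hamInChart hH hf hd hθ hz
  have g1 := S.fderiv_fderiv_timeFunInChart_hamInChart hH hf hd hθ hz (0, w)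
  have g2 := S.fderiv_linInChart_hamInChart hf hθ hz (0, w)
  have g3 := S.fderiv_bilinInChart_hamInChart hf hz (1, 0) w
  have c := S.fderiv_linInChart_symm x₀ X w
  have hs : ∀ {g : ℝ × M → ℝ}, ContMDiff (extModel E) 𝓘(ℝ, ℝ) ∞ g →
      IsSymmSndFDerivAt ℝ (timeFunInChart g x₀) z := fun hg =>
    (contDiffAt_timeFunInChart hg hz).isSymmSndFDerivAt
      (by rw [minSmoothness_of_isRCLikeNormedField]; exact WithTop.coe_le_coe.2 le_top)
  have s1 := hs hH (0, X) (0, w)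
  have s2 := hs hf (1, 0) (0, w)
  simp only [map_zero, zero_apply, zero_add, mul_zero, add_zero] at g3
  -- The left side is `L_{X_f} d^θ̂ H = d^θ̂(X_f(H)) = d^θ̂(∂f/∂t)` on horizontal vectors. By `g3`,
  -- the time derivative of Hamilton's equation for `f`, this is the pairing of `∂X_f/∂t` with `w`.
  linear_combination s1 + g1 - g3 - s2 - timeFunInChart H x₀ z * (g2 + c)
    - S.linInChart x₀ z.2 w * g0

variable {D : Set (ℝ × (ℝ × M))} {Ψ : ℝ → ℝ × M → ℝ × M}

theorem fderiv_vectorFieldInChart_extHamVF {f : ℝ × M → ℝ}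
    (hf : ContMDiff (extModel E) 𝓘(ℝ, ℝ) ∞ f) (p : ℝ × M) (v : ℝ × E) :
    fderiv ℝ (vectorFieldInChart (extModel E) (S.extHamVF f) p) (extChartAt (extModel E) p p) v =
      (0, fderiv ℝ (S.hamInChart f p.2) (p.1, extChartAt 𝓘(ℝ, E) p.2 p.2) v) := by
  rw [extChartAt_extModel_self]
  set z : ℝ × E := (p.1, extChartAt 𝓘(ℝ, E) p.2 p.2)
  have hz : z.2 ∈ (extChartAt 𝓘(ℝ, E) p.2).target := mem_extChartAt_target p.2
  have hX := ((S.contDiffAt_hamInChart hf hz).differentiableAt (by simp)).hasFDerivAt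
  have e : vectorFieldInChart (extModel E) (S.extHamVF f) p =ᶠ[𝓝 z]
      fun z => (0, S.hamInChart f p.2 z) := by
    filter_upwards [univ_prod_target_mem_nhds hz] with z' hz'
    exact S.vectorFieldInChart_extHamVF f p hz'.2
  rw [e.fderiv_eq, ((hasFDerivAt_const (0 : ℝ) z).prodMk hX).fderiv]
  rfl

/-- The flow of `X_f` preserves `θ̂` if `θ̂(X_f) = 0`. -/
theorem pullback_extθ_eq {f : ℝ × M → ℝ}
    (hf : ContMDiff (extModel E) 𝓘(ℝ, ℝ) ∞ f) (hθ : ∀ p, S.extθ p ![S.extHamVF f p] = 0)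
    (h : IsFlow (extModel E) (S.extHamVF f) D Ψ) {s : ℝ} {p : ℝ × M} (hs : (s, p) ∈ D) :
    DForm.pullback (extModel E) (Ψ s) S.extθ p = S.extθ p := by
  have hev : ∀ (p : ℝ × M) (v : ℝ × E), (fun z => S.extθ.chartRep p z ![v])
      =ᶠ[𝓝 (extChartAt (extModel E) p p : ℝ × E)] fun z => S.linInChart p.2 z.2 v.2 := fun p v => by
    filter_upwards [(isOpen_extChartAt_target (I := extModel E) p).mem_nhds
      (mem_extChartAt_target p)] with z hz
    exact S.chartRep_extθ p hz v
  have hder : ∀ (p : ℝ × M) (v : ℝ × E), HasFDerivAt (fun z => S.extθ.chartRep p z ![v])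
      ((fderiv ℝ (S.linInChart p.2) (extChartAt 𝓘(ℝ, E) p.2 p.2)).flip v.2 ∘L .snd ℝ ℝ E)
      (extChartAt (extModel E) p p) := fun p v => by
    refine HasFDerivAt.congr_of_eventuallyEq ?_ (hev p v)
    rw [extChartAt_extModel_self]
    exact HasFDerivAt.comp (f := Prod.snd) (p.1, extChartAt 𝓘(ℝ, E) p.2 p.2)
      (S.hasFDerivAt_linInChart_apply (mem_extChartAt_target p.2) v.2) hasFDerivAt_snd
  refine h.pullback_one_eq S.extθ (fun p v => (hder p v).differentiableAt) (fun p v => ?_) hs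
  have h1 := S.fderiv_linInChart_hamInChart hf hθ
    (z := (p.1, extChartAt 𝓘(ℝ, E) p.2 p.2)) (mem_extChartAt_target p.2) v
  -- Closedness of `θ` swaps the two slots and turns the derivative of `θ̂(X_f) = 0` into `L_{X_f}
  -- θ̂ = 0`.
  rw [S.fderiv_linInChart_symm] at h1
  refine Eq.trans (congrArg₂ (fun a b : ℝ => a + b) ?_ ?_) h1
  · rw [(hder p v).fderiv, S.extHamVF_eq_hamInChart f p]
    rfl
  · refine (congrArg (fun a : (ℝ × E) [⋀^Fin 1]→L[ℝ] ℝ => a ![_])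
      (S.extθ.chartRep_self p).symm).trans ?_
    refine (S.chartRep_extθ p (mem_extChartAt_target p) _).trans ?_
    rw [S.fderiv_vectorFieldInChart_extHamVF hf, extChartAt_extModel_self]

/-- The flow of a dissipated quantity with `θ̂(X_f) = 0` preserves `Ω̂ + d^θ̂ H ∧ dt`. -/
theorem pullback_hamForm_eq {H f : ℝ × M → ℝ}
    (hH : ContMDiff (extModel E) 𝓘(ℝ, ℝ) ∞ H) (hf : ContMDiff (extModel E) 𝓘(ℝ, ℝ) ∞ f)
    (hd : S.IsExtDissipated H f) (hθ : ∀ p, S.extθ p ![S.extHamVF f p] = 0)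
    (h : IsFlow (extModel E) (S.extHamVF f) D Ψ) {s : ℝ} {p : ℝ × M} (hs : (s, p) ∈ D) :
    DForm.pullback (extModel E) (Ψ s) (S.hamForm H) p = S.hamForm H p := by
  have hder : ∀ (p : ℝ × M) (u v : ℝ × E), HasFDerivAt
      (fun z => (S.hamForm H).chartRep p z ![u, v]) (_ : ℝ × E →L[ℝ] ℝ)
      (p.1, extChartAt 𝓘(ℝ, E) p.2 p.2) := fun p u v =>
    have hz : (p.1, extChartAt 𝓘(ℝ, E) p.2 p.2).2 ∈ (extChartAt 𝓘(ℝ, E) p.2).target :=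
      mem_extChartAt_target p.2
    HasFDerivAt.congr_of_eventuallyEq
      (((S.hasFDerivAt_bilinInChart_apply hz u.2 v.2).comp
        (p.1, extChartAt 𝓘(ℝ, E) p.2 p.2) hasFDerivAt_snd).add
        (((S.hasFDerivAt_dTheta_inChart hH hz u).mul_const v.1).sub
          ((S.hasFDerivAt_dTheta_inChart hH hz v).mul_const u.1)))
      (by
        filter_upwards [univ_prod_target_mem_nhds hz] with z hz
        exact S.chartRep_hamForm hH p (mem_extChartAt_extModel_target.2 hz.2) u v)
  refine h.pullback_two_eq (S.hamForm H) (fun p u v => ?_) (fun p u v => ?_) hs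
  · rw [extChartAt_extModel_self]
    exact (hder p u v).differentiableAt
  · have hval : ∀ a b : ℝ × E, (S.hamForm H p : (ℝ × E) [⋀^Fin 2]→L[ℝ] ℝ) ![a, b] = _ := fun a b =>
      (congrArg (fun η : (ℝ × E) [⋀^Fin 2]→L[ℝ] ℝ => η ![a, b])
        ((S.hamForm H).chartRep_self p).symm).trans
        (S.chartRep_hamForm hH p (mem_extChartAt_target p) a b)
    have e1 : fderiv ℝ (fun z => (S.hamForm H).chartRep p z ![u, v]) (extChartAt (extModel E) p p)
        (S.extHamVF f p) = _ :=
      (congrArg (fun X : ℝ × E => fderiv ℝ (fun z => (S.hamForm H).chartRep p z ![u, v])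
        (extChartAt (extModel E) p p) X) (S.extHamVF_eq_hamInChart f p)).trans
        (congrArg (fun L : ℝ × E →L[ℝ] ℝ => L _)
          ((congrArg (fderiv ℝ _) (extChartAt_extModel_self p)).trans (hder p u v).fderiv))
    refine (congrArg₂ (fun a b : ℝ => a + b) (congrArg₂ (fun a b : ℝ => a + b) e1
      (hval _ v)) (hval u _)).trans ?_
    rw [S.fderiv_vectorFieldInChart_extHamVF hf, S.fderiv_vectorFieldInChart_extHamVF hf,
      extChartAt_extModel_self]
    have h1 := S.lieDeriv_bilinInChart hf p.1 p.2 u.2 v.2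
    have h2 := S.lieDeriv_dTheta_inChart hH hf hd hθ p.1 p.2 u.2
    have h3 := S.lieDeriv_dTheta_inChart hH hf hd hθ p.1 p.2 v.2
    have hz : (p.1, extChartAt 𝓘(ℝ, E) p.2 p.2).2 ∈ (extChartAt 𝓘(ℝ, E) p.2).target :=
      mem_extChartAt_target p.2
    have h4 := S.linInChart_hamInChart f hz
    rw [hθ] at h4
    obtain ⟨t₀, x₀⟩ := p
    set z : ℝ × E := (t₀, extChartAt 𝓘(ℝ, E) x₀ x₀)
    -- Each vector is split into its `∂/∂t` part and its horizontal part, because `X_f` depends on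
    -- time and its differential has a component along `(1, 0)`.
    have hsplit : ∀ w : ℝ × E, w = w.1 • ((1 : ℝ), (0 : E)) + (0, w.2) := fun w => by
      ext <;> simp
    have hDX : ∀ w : ℝ × E, fderiv ℝ (S.hamInChart f x₀) z w =
        w.1 • fderiv ℝ (S.hamInChart f x₀) z (1, 0) + fderiv ℝ (S.hamInChart f x₀) z (0, w.2) :=
      fun w => by conv_lhs => rw [hsplit w, map_add, map_smul]
    have hH2 : ∀ w : ℝ × E,
        fderiv ℝ (fderiv ℝ (timeFunInChart H x₀)) z (0, S.hamInChart f x₀ z) w =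
        w.1 * fderiv ℝ (fderiv ℝ (timeFunInChart H x₀)) z (0, S.hamInChart f x₀ z) (1, 0) +
          fderiv ℝ (fderiv ℝ (timeFunInChart H x₀)) z (0, S.hamInChart f x₀ z) (0, w.2) :=
      fun w => by conv_lhs => rw [hsplit w, map_add, map_smul, smul_eq_mul]
    have hH1 : ∀ (r : ℝ) (a b : E), fderiv ℝ (timeFunInChart H x₀) z (0, r • a + b) =
        r * fderiv ℝ (timeFunInChart H x₀) z (0, a) + fderiv ℝ (timeFunInChart H x₀) z (0, b) :=
      fun r a b => by
        rw [← smul_eq_mul, ← map_smul, ← map_add]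
        simp
    have hb := S.bilinInChart_swap x₀ z.2 u.2 (fderiv ℝ (S.hamInChart f x₀) z (1, 0))
    simp only [hDX u, hDX v, hH1, hH2 u, hH2 v, map_add, map_smul, add_apply, smul_apply,
      sub_apply, ContinuousLinearMap.comp_apply, ContinuousLinearMap.flip_apply, smul_eq_mul,
      ContinuousLinearMap.coe_snd'] at h1 h2 h3 h4 hb ⊢
    -- The purely horizontal part is `L_{X_f} Ω = θ(X_f) Ω = 0`. In the mixed parts the term with
    -- `∂X_f/∂t` coming from `Ω̂` cancels the one coming from `d^θ̂ H ∧ dt`.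
    linear_combination h1 + v.1 * h2 - u.1 * h3 + v.1 * hb
      + S.bilinInChart x₀ z.2 u.2 v.2 * h4

end LCSStructure

end ExtLie

/-! ### The flow on `ℝ × M` consists of canonical invariance transformations. -/

section ExtCanonical

open Filter Topology

variable {E : Type*} [NormedAddCommGroup E] [NormedSpace ℝ E]
  {M : Type*} [TopologicalSpace M] [ChartedSpace E M]

namespace LCSStructure

variable (S : LCSStructure E M) {D : Set (ℝ × (ℝ × M))} {Ψ : ℝ → ℝ × M → ℝ × M} {H f : ℝ × M → ℝ}

/-- The field `X_f` has no `∂/∂t` component, so `t` is constant along its orbits. -/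
theorem fst_flow_eq (h : IsFlow (extModel E) (S.extHamVF f) D Ψ) {s : ℝ} {p : ℝ × M}
    (hs : (s, p) ∈ D) : (Ψ s p).1 = p.1 :=
  h.comp_eq (g := Prod.fst) (contMDiff_fst.mdifferentiable (n := ∞) (by simp))
    (fun p => mfderiv_extModel_fst p _) hs

/-- The pullback of `d^θ̂ H` by a map that preserves `θ̂`. -/
theorem dTheta_mfderiv_eq {Φ : ℝ × M → ℝ × M} {p : ℝ × M}
    (hH : MDifferentiableAt (extModel E) 𝓘(ℝ, ℝ) H (Φ p))
    (hΦ : MDifferentiableAt (extModel E) (extModel E) Φ p)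
    (hθ : DForm.pullback (extModel E) Φ S.extθ p = S.extθ p) (u : TangentSpace (extModel E) p) :
    dTheta S.extθ H (Φ p) ![mfderiv (extModel E) (extModel E) Φ p u] =
      dTheta S.extθ (H ∘ Φ) p ![u] := by
  rw [dTheta_extθ_apply, dTheta_extθ_apply, dFun_apply, dFun_apply, mfderiv_comp p hH hΦ, ← hθ]
  have : DForm.pullback (extModel E) Φ S.extθ p ![u] =
      S.extθ (Φ p) ![mfderiv (extModel E) (extModel E) Φ p u] := by
    refine congrArg (S.extθ (Φ p)) ?_
    ext i : 1
    fin_cases i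
    rfl
  rw [this]
  rfl

variable [FiniteDimensional ℝ E]

/-- `X_f(H) = ∂f/∂t` for a dissipated quantity with `θ̂(X_f) = 0`. -/
theorem mfderiv_extHamVF_eq_timeDeriv
    (hH : ContMDiff (extModel E) 𝓘(ℝ, ℝ) ∞ H) (hd : S.IsExtDissipated H f)
    (hθ : ∀ p, S.extθ p ![S.extHamVF f p] = 0) (p : ℝ × M) :
    (mfderiv (extModel E) 𝓘(ℝ, ℝ) H p (S.extHamVF f p) : ℝ) = timeDeriv f p := by
  have h1 := mfderiv_prod_eq_add_apply (v := S.extHamVF f p) ((hH p).mdifferentiableAt (by simp))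
  refine h1.trans ?_
  have h2 := S.mfderiv_apply_eq_hamVF (fun m => H (p.1, m)) p.2 (S.hamVF (fun m => f (p.1, m)) p.2)
  have h3 := hθ p
  have h4 := hd p
  rw [extθ_apply] at h3
  rw [extBracket, extΩ_apply] at h4
  replace h3 : S.θ p.2 ![S.hamVF (fun m => f (p.1, m)) p.2] = 0 := h3
  replace h4 : S.Ω p.2 ![S.hamVF (fun m => f (p.1, m)) p.2, S.hamVF (fun m => H (p.1, m)) p.2] +
    timeDeriv f p = 0 := h4
  rw [h3, S.Ω_swap, mul_zero, add_zero] at h2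
  refine (congrArg₂ (fun a b : ℝ => a + b) (map_zero _) h2).trans ?_
  linarith

/-- The flow of a dissipated quantity with `θ̂(X_f) = 0` preserves the Hamiltonian if and only if
the dissipated quantity does not depend on time. -/
theorem flow_comp_eq_iff
    (hH : ContMDiff (extModel E) 𝓘(ℝ, ℝ) ∞ H) (hd : S.IsExtDissipated H f)
    (hθ : ∀ p, S.extθ p ![S.extHamVF f p] = 0)
    (h : IsFlow (extModel E) (S.extHamVF f) D Ψ) :
    (∀ s p, (s, p) ∈ D → H (Ψ s p) = H p) ↔ ∀ p, timeDeriv f p = 0 := by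
  have hHd : MDifferentiable (extModel E) 𝓘(ℝ, ℝ) H := hH.mdifferentiable (by simp)
  refine ⟨fun hc p => ?_, fun ht s p hs => h.comp_eq hHd (fun p => ?_) hs⟩
  · have h1 := h.hasDerivAt_comp hHd (h.zero_mem p)
    have h2 : (fun r => H (Ψ r p)) =ᶠ[𝓝 0] fun _ => H p := by
      filter_upwards [(h.isOpen.preimage (by fun_prop : Continuous fun s : ℝ => (s, p))).mem_nhds
        (h.zero_mem p)] with r hr using hc r p hr
    have h3 := h1.unique ((hasDerivAt_const (0 : ℝ) (H p)).congr_of_eventuallyEq h2)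
    rw [S.mfderiv_extHamVF_eq_timeDeriv hH hd hθ, h.map_zero] at h3
    exact h3
  · exact (S.mfderiv_extHamVF_eq_timeDeriv hH hd hθ p).trans (ht p)

variable [IsManifold 𝓘(ℝ, E) ∞ M]

/-- The flow of a dissipated quantity with `θ̂(X_f) = 0` consists of canonical invariance
transformations. -/
theorem isExtCanonicalInvariance_flow
    (hH : ContMDiff (extModel E) 𝓘(ℝ, ℝ) ∞ H) (hf : ContMDiff (extModel E) 𝓘(ℝ, ℝ) ∞ f)
    (hd : S.IsExtDissipated H f) (hθ : ∀ p, S.extθ p ![S.extHamVF f p] = 0)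
    (h : IsFlow (extModel E) (S.extHamVF f) D Ψ) (s : ℝ) :
    S.IsExtCanonicalInvariance H {p | (s, p) ∈ D} {p | (-s, p) ∈ D} (Ψ s) := by
  have hHd : MDifferentiable (extModel E) 𝓘(ℝ, ℝ) H := hH.mdifferentiable (by simp)
  -- This `K` is the only function with `H ∘ Ψ_s + K = H`; what has to be proved is its formula for
  -- `Ψ_s^* Ω̂`.
  refine ⟨fun p => H p - H (Ψ s p), ⟨h.isDiffeoOn s, fun p hp => S.fst_flow_eq h hp,
    fun p hp => S.pullback_extθ_eq hf hθ h hp, ?_, fun p hp => ?_⟩, fun p _ => by ring⟩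
  · exact hH.contMDiffOn.sub (hH.comp_contMDiffOn (h.contMDiffOn_slice s))
  · have hΨ := h.mdifferentiableAt hp
    have hK : ∀ u : TangentSpace (extModel E) p,
        dTheta S.extθ (fun p => H p - H (Ψ s p)) p ![u] =
          dTheta S.extθ H p ![u] - dTheta S.extθ (H ∘ Ψ s) p ![u] := fun u => by
      have h1 : HasMFDerivAt (extModel E) 𝓘(ℝ, ℝ) (fun p => H p - H (Ψ s p)) p _ :=
        (hHd p).hasMFDerivAt.sub ((hHd _).comp p hΨ).hasMFDerivAt
      have h2 : dFun (extModel E) (fun p => H p - H (Ψ s p)) p ![u] =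
          dFun (extModel E) H p ![u] - dFun (extModel E) (H ∘ Ψ s) p ![u] :=
        congrArg (fun L : ℝ × E →L[ℝ] ℝ => L u) h1.mfderiv
      rw [dTheta_extθ_apply, dTheta_extθ_apply, dTheta_extθ_apply, h2, comp_apply]
      ring
    have hfst : ∀ u : TangentSpace (extModel E) p,
        ((mfderiv (extModel E) (extModel E) (Ψ s) p u).1 : ℝ) = (u.1 : ℝ) := fun u => by
      have h1 : (Prod.fst ∘ Ψ s : ℝ × M → ℝ) =ᶠ[𝓝 p] Prod.fst := by
        filter_upwards [(h.isOpen_slice s).mem_nhds hp] with q hq using S.fst_flow_eq h hq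
      have h2 := h1.mfderiv_eq (I := extModel E) (I' := 𝓘(ℝ, ℝ))
      rw [mfderiv_comp p mdifferentiableAt_fst hΨ] at h2
      have h3 := congrArg (fun L : ℝ × E →L[ℝ] ℝ => L u) h2
      refine (mfderiv_extModel_fst _ _).symm.trans (Eq.trans h3 (mfderiv_extModel_fst _ _))
    have hθp := S.pullback_extθ_eq hf hθ h hp
    have hα := S.pullback_hamForm_eq hH hf hd hθ h hp
    ext w
    have hw : w = ![w 0, w 1] := by
      ext i : 1
      fin_cases i <;> rfl
    rw [hw]
    generalize w 0 = u
    generalize w 1 = v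
    have h1 := congrArg (fun a : (ℝ × E) [⋀^Fin 2]→L[ℝ] ℝ => a ![u, v]) hα
    have hpull : ∀ η : DForm (extModel E) (ℝ × M) 2, DForm.pullback (extModel E) (Ψ s) η p ![u, v] =
        η (Ψ s p) ![mfderiv (extModel E) (extModel E) (Ψ s) p u,
          mfderiv (extModel E) (extModel E) (Ψ s) p v] := fun η => by
      refine congrArg (η (Ψ s p)) ?_
      ext i : 1
      fin_cases i <;> rfl
    replace h1 : DForm.pullback (extModel E) (Ψ s) (S.hamForm H) p ![u, v] =
      S.hamForm H p ![u, v] := h1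
    -- As `Ψ_s` preserves `θ̂` and `t`, the term `d^θ̂ H ∧ dt` pulls back to `d^θ̂(H ∘ Ψ_s) ∧ dt`.
    -- Moving it to the other side of the invariance of `hamForm` gives `d^θ̂ K ∧ dt`.
    rw [hpull, hamForm_apply, hamForm_apply, S.dTheta_mfderiv_eq (hHd _) hΨ hθp,
      S.dTheta_mfderiv_eq (hHd _) hΨ hθp, hfst, hfst, ← hpull] at h1
    refine Eq.trans ?_ (congrArg (fun r : ℝ => S.extΩ p ![u, v] + r)
      (S.dTheta_wedge_dt_apply (fun p => H p - H (Ψ s p)) p u v).symm)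
    rw [hK, hK]
    linear_combination h1

end LCSStructure

end ExtCanonical

/-! ### An example on `ℝ⁴` -/

section Example

theorem DForm.inChart_model {E : Type*} [NormedAddCommGroup E] [NormedSpace ℝ E] {k : ℕ}
    (η : DForm 𝓘(ℝ, E) E k) (x₀ y : E) :
    η.inChart x₀ y = (η y : E [⋀^Fin k]→L[ℝ] ℝ) := by
  have h : mfderiv 𝓘(ℝ, E) 𝓘(ℝ, E) (extChartAt 𝓘(ℝ, E) x₀).symm y =
      ContinuousLinearMap.id ℝ E := by
    rw [extChartAt_model_space_eq_id]
    exact mfderiv_id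
  ext w
  change (η y : E [⋀^Fin k]→L[ℝ] ℝ) (mfderiv 𝓘(ℝ, E) 𝓘(ℝ, E) (extChartAt 𝓘(ℝ, E) x₀).symm y ∘ w) = _
  rw [h]
  rfl

/-- The function `a` is the same form with values in one fixed space, so that the ordinary
`extDeriv` applies. -/
theorem DForm.d_model {E : Type*} [NormedAddCommGroup E] [NormedSpace ℝ E] {k : ℕ}
    (η : DForm 𝓘(ℝ, E) E k) (a : E → E [⋀^Fin k]→L[ℝ] ℝ) (h : ∀ y, (η y : E [⋀^Fin k]→L[ℝ] ℝ) = a y)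
    (x : E) : (η.d x : E [⋀^Fin (k + 1)]→L[ℝ] ℝ) = extDeriv a x := by
  have h1 : η.inChart x = a := funext fun y => (η.inChart_model x y).trans (h y)
  rw [DForm.d, h1, mfderiv_extChartAt_self]
  ext w
  change extDeriv a (extChartAt 𝓘(ℝ, E) x x) w = _
  rw [extChartAt_model_space_eq_id]
  rfl

/-- The Euclidean space `ℝ⁴`. -/
abbrev FourSpace := EuclideanSpace ℝ (Fin 4)

/-- The standard symplectic form `dx₀ ∧ dx₁ + dx₂ ∧ dx₃` on `ℝ⁴`. -/
noncomputable def stdSymplectic : FourSpace [⋀^Fin 2]→L[ℝ] ℝ :=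
  linWedge
    (ContinuousAlternatingMap.ofSubsingleton ℝ FourSpace ℝ (0 : Fin 1) (EuclideanSpace.proj 0))
    (ContinuousAlternatingMap.ofSubsingleton ℝ FourSpace ℝ (0 : Fin 1) (EuclideanSpace.proj 1)) +
  linWedge
    (ContinuousAlternatingMap.ofSubsingleton ℝ FourSpace ℝ (0 : Fin 1) (EuclideanSpace.proj 2))
    (ContinuousAlternatingMap.ofSubsingleton ℝ FourSpace ℝ (0 : Fin 1) (EuclideanSpace.proj 3))

theorem stdSymplectic_apply (u v : FourSpace) :
    stdSymplectic ![u, v] = u 0 * v 1 - v 0 * u 1 + (u 2 * v 3 - v 2 * u 3) := by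
  rw [stdSymplectic, ContinuousAlternatingMap.add_apply, linWedge_one_apply, linWedge_one_apply]
  rfl

/-- The form `e^{x₀} (dx₀ ∧ dx₁ + dx₂ ∧ dx₃)` on `ℝ⁴`. -/
noncomputable def confSymplectic (x : FourSpace) : FourSpace [⋀^Fin 2]→L[ℝ] ℝ :=
  Real.exp (x 0) • stdSymplectic

theorem eq_zero_of_confSymplectic (x v : FourSpace) (h : ∀ w, confSymplectic x ![v, w] = 0) :
    v = 0 := by
  have h1 : ∀ w : FourSpace, v 0 * w 1 - w 0 * v 1 + (v 2 * w 3 - w 2 * v 3) = 0 := fun w => by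
    have h2 : Real.exp (x 0) * stdSymplectic ![v, w] = 0 := h w
    rw [stdSymplectic_apply] at h2
    exact (mul_eq_zero.1 h2).resolve_left (Real.exp_ne_zero _)
  have e0 := h1 (EuclideanSpace.single 0 1)
  have e1 := h1 (EuclideanSpace.single 1 1)
  have e2 := h1 (EuclideanSpace.single 2 1)
  have e3 := h1 (EuclideanSpace.single 3 1)
  simp at e0 e1 e2 e3
  ext i
  fin_cases i <;> simpa

theorem hasFDerivAt_exp_proj (x : FourSpace) : HasFDerivAt (fun x : FourSpace => Real.exp (x 0))
    (Real.exp (x 0) • (EuclideanSpace.proj 0 : FourSpace →L[ℝ] ℝ)) x :=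
  (EuclideanSpace.proj 0 : FourSpace →L[ℝ] ℝ).hasFDerivAt.exp

theorem contDiff_exp_proj : ContDiff ℝ ∞ (fun x : FourSpace => Real.exp (x 0)) :=
  (EuclideanSpace.proj 0 : FourSpace →L[ℝ] ℝ).contDiff.exp

/-- The locally conformal symplectic structure `(e^{x₀} (dx₀ ∧ dx₁ + dx₂ ∧ dx₃), dx₀)` on `ℝ⁴`. -/
noncomputable def confLCS : LCSStructure FourSpace FourSpace where
  Ω x := confSymplectic x
  θ x := ContinuousAlternatingMap.ofSubsingleton ℝ FourSpace ℝ (0 : Fin 1) (EuclideanSpace.proj 0)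
  smooth_Ω x₀ := by
    have : ContDiff ℝ ∞ confSymplectic := contDiff_exp_proj.smul contDiff_const
    refine this.contDiffOn.congr fun y _ => ?_
    exact DForm.inChart_model _ x₀ y
  smooth_θ x₀ := by
    refine (contDiffOn_const (c := ContinuousAlternatingMap.ofSubsingleton ℝ FourSpace ℝ (0 : Fin 1)
      (EuclideanSpace.proj 0))).congr fun y _ => ?_
    exact DForm.inChart_model _ x₀ y
  nondegenerate x v h := eq_zero_of_confSymplectic x v h
  closed_θ x := by
    refine (DForm.d_model _ (fun _ =>
      ContinuousAlternatingMap.ofSubsingleton ℝ FourSpace ℝ (0 : Fin 1) (EuclideanSpace.proj 0)) (fun _ => rfl) x).trans ?_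
    rw [extDeriv, fderiv_fun_const]
    exact map_zero (ContinuousAlternatingMap.alternatizeUncurryFinCLM ℝ FourSpace ℝ)
  d_Ω x := by
    refine (DForm.d_model _ confSymplectic (fun _ => rfl) x).trans ?_
    have h : HasFDerivAt confSymplectic ((Real.exp (x 0) •
        (EuclideanSpace.proj 0 : FourSpace →L[ℝ] ℝ)).smulRight stdSymplectic) x :=
      (hasFDerivAt_exp_proj x).smul_const stdSymplectic
    rw [extDeriv, h.fderiv]
    -- With `ω` the standard symplectic form, `d(e^{x₀}) ⊗ ω = dx₀ ⊗ e^{x₀} ω`, so the two sides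
    -- agree already before alternatization.
    refine congrArg ContinuousAlternatingMap.alternatizeUncurryFin ?_
    ext v w
    change (Real.exp (x 0) * v 0) * stdSymplectic w = v 0 * (Real.exp (x 0) * stdSymplectic w)
    ring

theorem confLCS_Ω_apply (x u v : FourSpace) : confLCS.Ω x ![u, v] =
    Real.exp (x 0) * (u 0 * v 1 - v 0 * u 1 + (u 2 * v 3 - v 2 * u 3)) := by
  rw [← stdSymplectic_apply]
  rfl

theorem confLCS_θ_apply (x v : FourSpace) : confLCS.θ x ![v] = v 0 := rfl

/-- The Hamiltonian vector field of `e^{x₀} (L + c)`, for a linear form `L`. -/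
theorem confLCS_hamVF (L : FourSpace →L[ℝ] ℝ) (c : ℝ) (u : FourSpace)
    (hu : ∀ v : FourSpace, u 0 * v 1 - v 0 * u 1 + (u 2 * v 3 - v 2 * u 3) = L v) (x : FourSpace) :
    confLCS.hamVF (fun x => Real.exp (x 0) * (L x + c)) x = u := by
  have hder : HasFDerivAt (fun x : FourSpace => Real.exp (x 0) * (L x + c)) _ x :=
    (hasFDerivAt_exp_proj x).mul (L.hasFDerivAt.add_const c)
  -- Since `θ = dx₀`, one has `d^θ(e^{x₀} g) = e^{x₀} dg`. The factor `e^{x₀}` cancels against the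
  -- one in `Ω`, leaving the symplectic Hamiltonian vector field of `g = L + c`.
  have h1 : ∀ w : FourSpace, Real.exp (x 0) * L w + (L x + c) * (Real.exp (x 0) * w 0) =
      confLCS.Ω x ![confLCS.hamVF (fun x => Real.exp (x 0) * (L x + c)) x, w] +
        Real.exp (x 0) * (L x + c) * w 0 := fun w => by
    have h1 := confLCS.mfderiv_apply_eq_hamVF (fun x => Real.exp (x 0) * (L x + c)) x w
    rw [mfderiv_eq_fderiv] at h1
    exact (congrArg (fun A : FourSpace →L[ℝ] ℝ => A w) hder.fderiv).symm.trans h1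
  have h2 : ∀ X : FourSpace, (∀ w : FourSpace,
      Real.exp (x 0) * L w + (L x + c) * (Real.exp (x 0) * w 0) =
      confLCS.Ω x ![X, w] + Real.exp (x 0) * (L x + c) * w 0) → X = u := fun X hX => by
    refine sub_eq_zero.1 (eq_zero_of_confSymplectic x (X - u) fun w => ?_)
    refine (confLCS_Ω_apply x (X - u) w).trans ?_
    have h3 := hX w
    rw [confLCS_Ω_apply] at h3
    simp only [PiLp.sub_apply]
    linear_combination -h3 - Real.exp (x 0) * hu w
  exact h2 _ h1

theorem neg_single_three_ne_zero : (-EuclideanSpace.single 3 1 : FourSpace) ≠ 0 := fun h => by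
  have := congrArg (fun v : FourSpace => v 3) h
  simp at this

/-- With `H = e^{x₀} x₁` and `f = e^{x₀} x₂` the fields are `X_H = ∂₀` and `X_f = -∂₃`. They are
`Ω`-orthogonal and `θ(X_f) = 0`, but `θ(X_H) = 1` leaves the defect `f`. -/
theorem exists_dissipated_not_constantOfMotion :
    ∃ (S₀ : LCSStructure FourSpace FourSpace) (H f : FourSpace → ℝ),
      ContDiff ℝ ∞ H ∧ ContDiff ℝ ∞ f ∧
      S₀.IsDissipated H f ∧ (∀ x, S₀.θ x ![S₀.hamVF f x] = 0) ∧
      (∃ x, S₀.hamVF f x ≠ 0) ∧ ¬ S₀.IsConstantOfMotion H f := by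
  set H : FourSpace → ℝ := fun x =>
    Real.exp (x 0) * ((EuclideanSpace.proj 1 : FourSpace →L[ℝ] ℝ) x + 0) with hH
  set f : FourSpace → ℝ := fun x =>
    Real.exp (x 0) * ((EuclideanSpace.proj 2 : FourSpace →L[ℝ] ℝ) x + 0) with hf
  have h1 : ∀ x, confLCS.hamVF H x = (EuclideanSpace.single 0 1 : FourSpace) :=
    confLCS_hamVF _ _ _ fun v => by simp
  have h2 : ∀ x, confLCS.hamVF f x = (-EuclideanSpace.single 3 1 : FourSpace) :=
    confLCS_hamVF _ _ _ fun v => by simp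
  refine ⟨confLCS, H, f,
    contDiff_exp_proj.mul ((ContinuousLinearMap.contDiff _).add contDiff_const),
    contDiff_exp_proj.mul ((ContinuousLinearMap.contDiff _).add contDiff_const), fun x => ?_,
    fun x => ?_, ⟨0, ?_⟩, fun h => ?_⟩
  · rw [LCSStructure.bracket, h1, h2]
    exact (confLCS_Ω_apply x _ _).trans (by simp)
  · rw [h2]
    exact (confLCS_θ_apply x _).trans (by simp)
  · rw [h2]
    exact neg_single_three_ne_zero
  -- At this point `x₀ = 0` and `x₂ = 1`, so `f = 1`.
  · have h3 := h (EuclideanSpace.single 2 1)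
    rw [LCSStructure.bracket, h1, h2] at h3
    have h4 := (congrArg₂ (fun a b : ℝ => a + f (EuclideanSpace.single 2 1) * b)
      (confLCS_Ω_apply (EuclideanSpace.single 2 1) (-EuclideanSpace.single 3 1)
        (EuclideanSpace.single 0 1))
      (confLCS_θ_apply (EuclideanSpace.single 2 1) (EuclideanSpace.single 0 1))).symm.trans h3
    simp [hf] at h4

/-- With `H = e^{x₀} (x₁ + x₃)` and `f = e^{x₀} (x₂ - t)` the fields are `X_H = ∂₀ + ∂₂` and `X_f =
-∂₃`. The added `x₃` makes `{f, H} = e^{x₀}`, which cancels `∂f/∂t`; the defect is again `f θ̂(X_H)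
= f`. -/
theorem exists_extDissipated_not_constantOfMotion :
    ∃ (S₀ : LCSStructure FourSpace FourSpace) (H f : ℝ × FourSpace → ℝ),
      ContDiff ℝ ∞ H ∧ ContDiff ℝ ∞ f ∧
      S₀.IsExtDissipated H f ∧ (∀ p, S₀.extθ p ![S₀.extHamVF f p] = 0) ∧
      (∃ p, S₀.extHamVF f p ≠ 0) ∧ ¬ S₀.IsExtConstantOfMotion H f := by
  set H : ℝ × FourSpace → ℝ := fun p => Real.exp (p.2 0) *
    ((EuclideanSpace.proj 1 + EuclideanSpace.proj 3 : FourSpace →L[ℝ] ℝ) p.2 + 0) with hH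
  set f : ℝ × FourSpace → ℝ := fun p => Real.exp (p.2 0) *
    ((EuclideanSpace.proj 2 : FourSpace →L[ℝ] ℝ) p.2 + -p.1) with hf
  have h1 : ∀ (t : ℝ) (x : FourSpace), confLCS.hamVF (fun m => H (t, m)) x =
      (EuclideanSpace.single 0 1 + EuclideanSpace.single 2 1 : FourSpace) := fun t =>
    confLCS_hamVF (EuclideanSpace.proj 1 + EuclideanSpace.proj 3) 0 _ fun v => by simp
  have h2 : ∀ (t : ℝ) (x : FourSpace), confLCS.hamVF (fun m => f (t, m)) x =
      (-EuclideanSpace.single 3 1 : FourSpace) := fun t =>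
    confLCS_hamVF (EuclideanSpace.proj 2) (-t) _ fun v => by simp
  have hb : ∀ p, confLCS.extBracket f H p = Real.exp (p.2 0) := fun p => by
    rw [LCSStructure.extBracket, LCSStructure.extΩ_apply]
    change confLCS.Ω p.2 ![confLCS.hamVF (fun m => f (p.1, m)) p.2,
      confLCS.hamVF (fun m => H (p.1, m)) p.2] = _
    rw [h1, h2]
    exact (confLCS_Ω_apply p.2 _ _).trans (by simp)
  have ht : ∀ p, timeDeriv f p = -Real.exp (p.2 0) := fun p => by
    have : HasDerivAt (fun t : ℝ => f (t, p.2)) (Real.exp (p.2 0) * -1) p.1 :=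
      ((hasDerivAt_neg p.1).const_add ((EuclideanSpace.proj 2 : FourSpace →L[ℝ] ℝ) p.2)).const_mul
        (Real.exp (p.2 0))
    rw [timeDeriv, this.deriv]
    ring
  have hexp : ContDiff ℝ ∞ (fun p : ℝ × FourSpace => Real.exp (p.2 0)) :=
    contDiff_exp_proj.comp contDiff_snd
  refine ⟨confLCS, H, f,
    hexp.mul (((ContinuousLinearMap.contDiff _).comp contDiff_snd).add contDiff_const),
    hexp.mul (((ContinuousLinearMap.contDiff _).comp contDiff_snd).add contDiff_fst.neg),
    fun p => ?_, fun p => ?_, ⟨0, ?_⟩, fun h => ?_⟩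
  · rw [hb, ht, add_neg_cancel]
  · rw [LCSStructure.extθ_apply]
    change confLCS.θ p.2 ![confLCS.hamVF (fun m => f (p.1, m)) p.2] = 0
    rw [h2]
    exact (confLCS_θ_apply p.2 _).trans (by simp)
  · intro h
    have h3 : confLCS.hamVF (fun m => f (0, m)) 0 = 0 := congrArg (fun v : ℝ × FourSpace => v.2) h
    rw [h2] at h3
    exact neg_single_three_ne_zero h3
  · have h3 := h (0, EuclideanSpace.single 2 1)
    rw [hb, ht, LCSStructure.extθ_apply] at h3
    replace h3 : _ + f (0, EuclideanSpace.single 2 1) * confLCS.θ (EuclideanSpace.single 2 1)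
      ![confLCS.hamVF (fun m => H (0, m)) (EuclideanSpace.single 2 1)] + _ = 0 := h3
    rw [h1] at h3
    have h4 := confLCS_θ_apply (EuclideanSpace.single 2 1)
      (EuclideanSpace.single 0 1 + EuclideanSpace.single 2 1)
    have h5 := (congrArg (fun b : ℝ => _ + f (0, EuclideanSpace.single 2 1) * b + _)
      h4).symm.trans h3
    simp [hf] at h5

end Example

/-! ### The main theorem, assembled for the maximal flow of `X_f`. -/

theorem mainTheorem9 {E : Type*} [NormedAddCommGroup E] [NormedSpace ℝ E] [FiniteDimensional ℝ E]
    {M : Type*} [TopologicalSpace M] [T2Space M] [ChartedSpace E M] [IsManifold 𝓘(ℝ, E) ∞ M]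
    (S : LCSStructure E M) :
    -- time-independent case
    (∀ H f : M → ℝ, ContMDiff 𝓘(ℝ, E) 𝓘(ℝ, ℝ) ∞ H → ContMDiff 𝓘(ℝ, E) 𝓘(ℝ, ℝ) ∞ f →
      S.IsDissipated H f → (∀ x, S.θ x ![S.hamVF f x] = 0) →
      ∃ (D : Set (ℝ × M)) (Ψ : ℝ → M → M), IsFlow 𝓘(ℝ, E) (S.hamVF f) D Ψ ∧
        ∀ s, S.IsCanonicalInvariance H {x | (s, x) ∈ D} {x | (-s, x) ∈ D} (Ψ s)) ∧
    -- time-dependent case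
    (∀ H f : ℝ × M → ℝ, ContMDiff (extModel E) 𝓘(ℝ, ℝ) ∞ H →
      ContMDiff (extModel E) 𝓘(ℝ, ℝ) ∞ f → S.IsExtDissipated H f →
      (∀ p, VectorField.mlieBracket (extModel E) (S.extHamVF f) (S.autonomization H) p = 0) ∧
      ((∀ p, S.extθ p ![S.extHamVF f p] = 0) →
        ∃ (D : Set (ℝ × (ℝ × M))) (Ψ : ℝ → ℝ × M → ℝ × M),
          IsFlow (extModel E) (S.extHamVF f) D Ψ ∧
          (∀ s, S.IsExtCanonicalInvariance H {p | (s, p) ∈ D} {p | (-s, p) ∈ D} (Ψ s)) ∧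
          ((∀ s p, (s, p) ∈ D → H (Ψ s p) = H p) ↔ ∀ p, timeDeriv f p = 0))) ∧
    -- in neither case need `f` be a constant of motion
    (∃ (S₀ : LCSStructure (EuclideanSpace ℝ (Fin 4)) (EuclideanSpace ℝ (Fin 4)))
      (H f : EuclideanSpace ℝ (Fin 4) → ℝ), ContDiff ℝ ∞ H ∧ ContDiff ℝ ∞ f ∧
      S₀.IsDissipated H f ∧ (∀ x, S₀.θ x ![S₀.hamVF f x] = 0) ∧
      (∃ x, S₀.hamVF f x ≠ 0) ∧ ¬ S₀.IsConstantOfMotion H f) ∧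
    (∃ (S₀ : LCSStructure (EuclideanSpace ℝ (Fin 4)) (EuclideanSpace ℝ (Fin 4)))
      (H f : ℝ × EuclideanSpace ℝ (Fin 4) → ℝ), ContDiff ℝ ∞ H ∧ ContDiff ℝ ∞ f ∧
      S₀.IsExtDissipated H f ∧ (∀ p, S₀.extθ p ![S₀.extHamVF f p] = 0) ∧
      (∃ p, S₀.extHamVF f p ≠ 0) ∧ ¬ S₀.IsExtConstantOfMotion H f) := by
  refine ⟨fun H f hH hf hd hθ => ?_, fun H f hH hf hd => ⟨?_, fun hθ => ?_⟩,
    exists_dissipated_not_constantOfMotion, exists_extDissipated_not_constantOfMotion⟩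
  · have h := isFlow_maximalFlow (S.contMDiff_hamVF hf)
    exact ⟨_, _, h, S.isCanonicalInvariance_flow hH hf hd hθ h⟩
  · exact S.mlieBracket_extHamVF_autonomization hH hf hd
  · have h := isFlow_maximalFlow (S.contMDiff_extHamVF hf)
    exact ⟨_, _, h, S.isExtCanonicalInvariance_flow hH hf hd hθ h, S.flow_comp_eq_iff hH hd hθ h⟩
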